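/- **Proposition.** The problem Graph Collision$(n,L)$, where $n\ge 1$ and $0\le L\le n^2$, is the following. * Input: two $n\times n$ Boolean matrices $A$ and $B$, a bipartite graph $G=(I\cup J,E)$ with $|I|=|J|=n$ and $E\subseteq I\times J$ (both $I$ and $J$ are identified with $\{1,\dots,n\}$), and an index $k\in\{1,\dots,n\}$. * Promise: $|E|\ge n^2-L$. * Output: a $k$-collision, i.e. an edge $(i,j)\in E$ with $A[i,k]=B[k,j]=1$, if there is one; otherwise the answer that there is none. The numbers $n,L,k$ are given to the algorithm explicitly. The matrices are accessed, in superposition, through oracles $|i\rangle|j\rangle|a\rangle\mapsto|i\rangle|j\rangle|a\oplus A[i,j]\rangle$ (and similarly for $B$) at unit cost. The graph is given by a data structure $\mathscr M$ which supports the following operations, also in superposition, each in time $\kappa(n)=\mathrm{poly}(\log n)$: the degree of a vertex $u\in I$; whether $u\in I$ and $v\in J$ are connected; the $r$-th smallest vertex of $I$ of degree at most $d$; the $r$-th smallest vertex of $J$ not connected to $u\in I$ (with an error message if there is no such vertex). The running time counts all the computational steps, quantum gates and oracle calls, in the worst case. For every constant $c$ there is a quantum algorithm (one program for all $n$, $L$,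 all inputs and all $\kappa$) that solves Graph Collision$(n,L)$ with probability at least $1-(n+1)^{-c}$ on every input that satisfies the promise, and whose running time is $\tilde O(\sqrt L+\sqrt n)$. Here $\tilde O$ hides factors polynomial in $\log n$, that is, the running time is at most $C(\sqrt L+\sqrt n)(1+\log n)^a$ for all $n\ge1$ and $0\le L\le n^2$, where $C$ and $a$ depend only on $c$, on the algorithm and on the polylogarithmic bound $\kappa$. -/

import Mathlib

namespace GraphCollision

/-! ## The computational problem -/

/-- An input: two `n × n` Boolean matrices `A`, `B`, a bipartite graph between two disjoint copies
`I`, `J` of `{0, …, n-1}` with edge set `E ⊆ I × J`, and an index `k`. -/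
structure Input (n : ℕ) where
  A : Matrix (Fin n) (Fin n) Bool
  B : Matrix (Fin n) (Fin n) Bool
  E : Finset (Fin n × Fin n)
  k : Fin n

/-- The edge `(i, j)` of the graph is a `k`-collision. -/
def Input.IsCollision {n : ℕ} (x : Input n) (i j : Fin n) : Prop :=
  (i, j) ∈ x.E ∧ x.A i x.k = true ∧ x.B x.k j = true

/-! ## The data structure holding the graph: its four access operations

Vertices are numbered from `0` to `n - 1` and ranks are counted from `0`.
The value `none` is the error message. -/

/-- The degree of the vertex `u` of `I`. -/
def degree {n : ℕ} (E : Finset (Fin n × Fin n)) (u : Fin n) : ℕ :=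
  (Finset.univ.filter fun v : Fin n => (u, v) ∈ E).card

def getDegree {n : ℕ} (E : Finset (Fin n × Fin n)) (u : ℕ) : Option ℕ :=
  if h : u < n then some (degree E ⟨u, h⟩) else none

def checkConnection {n : ℕ} (E : Finset (Fin n × Fin n)) (u v : ℕ) : Bool :=
  if h : u < n ∧ v < n then decide ((⟨u, h.1⟩, ⟨v, h.2⟩) ∈ E) else false

/-- The vertex of rank `r` among the vertices of `I` of degree at most `d`. -/
def getVertI {n : ℕ} (E : Finset (Fin n × Fin n)) (r d : ℕ) : Option ℕ :=
  ((Finset.univ.filter fun u : Fin n => degree E u ≤ d).sort (· ≤ ·))[r]?.map Fin.val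

/-- The vertex of rank `r` among the vertices of `J` that are not connected to `u`. -/
def getVertJ {n : ℕ} (E : Finset (Fin n × Fin n)) (r u : ℕ) : Option ℕ :=
  if h : u < n then
    ((Finset.univ.filter fun v : Fin n => (⟨u, h⟩, v) ∉ E).sort (· ≤ ·))[r]?.map Fin.val
  else none

/-! ## Oracles

With `w = Nat.size n` (the least `w` with `n < 2 ^ w`), an oracle acts on a block of `3 * w + 1`
consecutive qubits: two `w`-bit arguments followed by an answer register of `w + 1` bits, into which
the answer is added bitwise modulo 2. -/

inductive Oracle where
  | matA | matB | degree | connection | vertI | vertJ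

/-- An entry of a Boolean matrix; `0` at indices outside the matrix. -/
def entry {n : ℕ} (M : Matrix (Fin n) (Fin n) Bool) (i j : ℕ) : ℕ :=
  if h : i < n ∧ j < n then (M ⟨i, h.1⟩ ⟨j, h.2⟩).toNat else 0

/-- The number written in the answer register: an error sets the bit of index `w = Nat.size n`,
which no proper answer (a number that is at most `n`) does. -/
def encodeAnswer (n : ℕ) : Option ℕ → ℕ
  | none => 2 ^ Nat.size n
  | some a => a

/-- The answer to a query. The query `degree` has one argument only and ignores the second. -/
def Oracle.answer {n : ℕ} (x : Input n) : Oracle → ℕ → ℕ → ℕ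
  | .matA, i, j => entry x.A i j
  | .matB, i, j => entry x.B i j
  | .degree, u, _ => encodeAnswer n (getDegree x.E u)
  | .connection, u, v => (checkConnection x.E u v).toNat
  | .vertI, r, d => encodeAnswer n (getVertI x.E r d)
  | .vertJ, r, u => encodeAnswer n (getVertJ x.E r u)

/-- The price of a call: `1` for the matrices, `κ` for the access operations of the data
structure. -/
def Oracle.price (κ : ℕ) : Oracle → ℕ
  | .matA => 1
  | .matB => 1
  | _ => κ

/-! ## Quantum memory -/

/-- A computational basis state of a memory whose qubits are numbered by `ℕ`. -/
abbrev Basis := ℕ → Bool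

/-- A (possibly unnormalised) state: a finite superposition of basis states. -/
abbrev QState := Basis →₀ ℂ

/-- The squared norm of a state. -/
noncomputable def weight (ψ : QState) : ℝ := ψ.sum fun _ z => ‖z‖ ^ 2

/-- The number whose binary digits, least significant first, are the qubits `p, …, p + w - 1`. -/
def readBits (b : Basis) (p w : ℕ) : ℕ := ∑ i ∈ Finset.range w, (b (p + i)).toNat * 2 ^ i

/-- The action of an oracle on the block that begins at qubit `p`. -/
def queryBasis {n : ℕ} (x : Input n) (o : Oracle) (p : ℕ) (b : Basis) : Basis := fun q =>
  Bool.xor (b q) (decide (p + 2 * Nat.size n ≤ q) &&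
    (o.answer x (readBits b p (Nat.size n)) (readBits b (p + Nat.size n) (Nat.size n))).testBit
      (q - (p + 2 * Nat.size n)))

/-- Elementary unitary operations; the fields are the *addresses* of the qubits. A controlled gate
whose target is also a control does nothing. -/
inductive Gate where
  | X (q : ℕ)
  | H (q : ℕ)
  | T (q : ℕ)
  | CNOT (a q : ℕ)
  | Toffoli (a b q : ℕ)
  | query (o : Oracle) (p : ℕ)

/-- The image of a basis state under a gate. -/
noncomputable def Gate.onBasis {n : ℕ} (x : Input n) : Gate → Basis → QState
  | .X q, b => Finsupp.single (Function.update b q (!b q)) 1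
  | .H q, b =>
      Finsupp.single (Function.update b q false) ((1 / √2 : ℝ) : ℂ) +
      Finsupp.single (Function.update b q true) (if b q then -((1 / √2 : ℝ) : ℂ) else (1 / √2 : ℝ))
  | .T q, b => Finsupp.single b (if b q then Complex.exp (Complex.I * Real.pi / 4) else 1)
  | .CNOT a q, b =>
      Finsupp.single (if a = q then b else Function.update b q (Bool.xor (b q) (b a))) 1
  | .Toffoli a a' q, b =>
      Finsupp.single (if a = q ∨ a' = q then b
        else Function.update b q (Bool.xor (b q) (b a && b a'))) 1
  | .query o p, b => Finsupp.single (queryBasis x o p b) 1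

/-- The linear operator of a gate. -/
noncomputable def Gate.op {n : ℕ} (x : Input n) (g : Gate) : QState →ₗ[ℂ] QState :=
  Finsupp.linearCombination ℂ (g.onBasis x)

/-! ## Programs: random access machines with classical control and a quantum memory -/

/-- The classical registers. -/
abbrev Store := ℕ → ℕ

/-- Instructions; the fields are numbers of classical registers, except the constant `a`.
A gate acts on the qubits whose addresses stand in the registers that it names. -/
inductive Instr where
  | const (r a : ℕ)
  | add (r s t : ℕ)
  | sub (r s t : ℕ)
  | half (r s : ℕ)
  | gate (g : Gate)
  | measure (r q : ℕ)

inductive Prog where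
  | instr (c : Instr)
  | seq (p q : Prog)
  | ifNonzero (r : ℕ) (p q : Prog)
  | whileNonzero (r : ℕ) (p : Prog)

/-- Replace register numbers by the contents of the registers. -/
def Gate.resolve (σ : Store) : Gate → Gate
  | .X q => .X (σ q)
  | .H q => .H (σ q)
  | .T q => .T (σ q)
  | .CNOT a q => .CNOT (σ a) (σ q)
  | .Toffoli a b q => .Toffoli (σ a) (σ b) (σ q)
  | .query o p => .query o (σ p)

/-- The cost of a gate whose operands are addresses: a unit, the price if it is an oracle, and the
lengths of the addresses. -/
def Gate.cost (κ : ℕ) : Gate → ℕ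
  | .X q => 1 + Nat.size q
  | .H q => 1 + Nat.size q
  | .T q => 1 + Nat.size q
  | .CNOT a q => 1 + Nat.size a + Nat.size q
  | .Toffoli a b q => 1 + Nat.size a + Nat.size b + Nat.size q
  | .query o p => 1 + o.price κ + Nat.size p

/-- The logarithmic cost of an instruction: a unit and the bit lengths of its operands. -/
def Instr.cost (κ : ℕ) (σ : Store) : Instr → ℕ
  | .const _ a => 1 + Nat.size a
  | .add _ s t => 1 + Nat.size (σ s) + Nat.size (σ t)
  | .sub _ s t => 1 + Nat.size (σ s) + Nat.size (σ t)
  | .half _ s => 1 + Nat.size (σ s)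
  | .gate g => (g.resolve σ).cost κ
  | .measure _ q => 1 + Nat.size (σ q)

/-- A branch of a computation: the programs still to be run (first one first), the classical
registers, the quantum memory, and the time used so far. The state is not renormalised after a
measurement, so that its `weight` is the probability of the branch. -/
structure Config where
  todo : List Prog
  store : Store
  state : QState
  time : ℕ

/-- The branches after an instruction: two after a measurement, one otherwise. -/
noncomputable def Instr.exec {n : ℕ} (x : Input n) (σ : Store) (ψ : QState) :
    Instr → List (Store × QState)
  | .const r a => [(Function.update σ r a, ψ)]
  | .add r s t => [(Function.update σ r (σ s + σ t), ψ)]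
  | .sub r s t => [(Function.update σ r (σ s - σ t), ψ)]
  | .half r s => [(Function.update σ r (σ s / 2), ψ)]
  | .gate g => [(σ, (g.resolve σ).op x ψ)]
  | .measure r q =>
      [(Function.update σ r 0, ψ.filter fun b => b (σ q) = false),
       (Function.update σ r 1, ψ.filter fun b => b (σ q) = true)]

/-- One step of a branch. A branch with nothing left to do has halted and stays as it is. -/
noncomputable def step {n : ℕ} (x : Input n) (κ : ℕ) (C : Config) : List Config :=
  match C.todo with
  | [] => [C]
  | .instr c :: rest =>
      (c.exec x C.store C.state).map fun y => ⟨rest, y.1, y.2, C.time + c.cost κ C.store⟩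
  | .seq p q :: rest => [⟨p :: q :: rest, C.store, C.state, C.time + 1⟩]
  | .ifNonzero r p q :: rest =>
      [⟨(if C.store r = 0 then q else p) :: rest, C.store, C.state,
        C.time + (1 + Nat.size (C.store r))⟩]
  | .whileNonzero r p :: rest =>
      [⟨if C.store r = 0 then rest else p :: .whileNonzero r p :: rest, C.store, C.state,
        C.time + (1 + Nat.size (C.store r))⟩]

/-- All branches after `t` steps. -/
noncomputable def branches {n : ℕ} (x : Input n) (κ : ℕ) (C : Config) (t : ℕ) : List Config :=
  (fun l : List Config => l.flatMap (step x κ))^[t] [C]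

/-- The start: registers `0`, `1`, `2` hold `n`, `L`, `k`, all other registers are `0`, and all
qubits are in state `0`. -/
noncomputable def start {n : ℕ} (P : Prog) (x : Input n) (L : ℕ) : Config where
  todo := [P]
  store := fun r => if r = 0 then n else if r = 1 then L else if r = 2 then x.k.val else 0
  state := Finsupp.single (fun _ => false) 1
  time := 0

/-- On every branch of positive probability the computation halts and has used time at most `T`.
(Every step costs at least one unit, so a branch that halts in time `T` makes at most `T` steps.) -/
def HaltsWithin {n : ℕ} (P : Prog) (x : Input n) (L κ T : ℕ) : Prop :=
  ∀ C ∈ branches x κ (start P x L) T, C.state ≠ 0 → C.todo = [] ∧ C.time ≤ T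

/-- The output in registers `0`, `1`, `2` is correct: `1, i, j` for a `k`-collision `(i, j)`, or, if
there is no `k`-collision, `0` in register `0`. -/
def Input.Correct {n : ℕ} (x : Input n) (σ : Store) : Prop :=
  (∃ i j, x.IsCollision i j ∧ σ 0 = 1 ∧ σ 1 = i.val ∧ σ 2 = j.val) ∨
    ((¬ ∃ i j, x.IsCollision i j) ∧ σ 0 = 0)

open Classical in
/-- The probability that the computation has halted with a correct output after `T` steps. -/
noncomputable def successProb {n : ℕ} (P : Prog) (x : Input n) (L κ T : ℕ) : ℝ :=
  ((branches x κ (start P x L) T).map fun C =>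
    if C.todo = [] ∧ x.Correct C.store then weight C.state else 0).sum

/-! ## Asymptotics -/

/-- `κ n` is bounded by a polynomial in `log n`. -/
def IsPolylog (κ : ℕ → ℕ) : Prop :=
  ∃ (C : ℝ) (a : ℕ), ∀ n, 1 ≤ n → (κ n : ℝ) ≤ C * (1 + Real.log n) ^ a

/-- `T n L = Õ(f n L)` on the range `1 ≤ n`, `L ≤ n ^ 2`, where `Õ` hides factors that are
polynomial in `log n`. -/
def IsSoftO (T : ℕ → ℕ → ℕ) (f : ℕ → ℕ → ℝ) : Prop :=
  ∃ (C : ℝ) (a : ℕ), ∀ n L, 1 ≤ n → L ≤ n ^ 2 → (T n L : ℝ) ≤ C * f n L * (1 + Real.log n) ^ a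

end GraphCollision

/-! # Graph collision

Put `w = Nat.size n`, and call a vertex `u` of `I` marked if `A[u, k] = 1`. First a marked vertex
`u` of maximal degree `D` is found: the digits of `D` are determined from the highest one downwards,
each by a quantum search for a marked vertex whose degree begins with the digits that are to be
tested (`maxDegree_expect`); the number of items is at most `2 n`. If there is no marked vertex, then
there is no collision. Otherwise a quantum search goes through the neighbours `j` of `u` for a
collision `(u, j)`. If there is none, then every collision `(i, j)` has an `i` of degree at most `D`
and a `j` that is not connected to `u` (`no_collision`). There are `n - D` such `j`, and each such
`i` misses at least `n - D` edges, so the promise bounds the number of these pairs by `L`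
(`card_low_degree_mul_le`). The last search runs over these pairs, which the data structure lists by
ranks; rounding both numbers to powers of two leaves at most `4 L + 2 n` pairs of ranks
(`rankSearch_expect`). So every search takes about `√L + √n` rounds, up to logarithmic factors.

A search (`search_expect`) does not know the number of solutions. It performs `0, 1, 3, 7, …`
iterations of amplitude amplification, each number sufficiently often. With `s = sin² θ` the
fraction of solutions, one of these numbers `j` makes `sin² ((2 j + 1) θ)` at least `1 / 4`
(`exists_good_iterations`); hence all attempts fail with a probability that is exponentially small
in the number of repetitions. Every measured number is verified, so a solution reported on a
branch of positive weight is correct. After every attempt the quantum memory is blank again, so the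
analysis between searches concerns classical registers and branch probabilities only
(`CleanExpect`). The predicates of the searches are computed by reversible
circuits (`Block`), whose gates are executed by loops over addresses in classical registers; a phase
`-1` is produced by a chain of Toffoli gates and four `T` gates.

The semantics of programs is handled by a small logic. `Outcomes` describes all branches of a program
in a way that is stable under continuation, `Run` is the case of a program without measurements that
acts on the memory by a linear operator, and `Expect` bounds the sum over all branches of a function
of the registers and the state, such as the weight of the erroneous branches. Time is counted in
steps, each of which costs at most `Machine.unit` as long as the registers are below `2 ^ B`.
-/

namespace GraphCollision

/-! ### Runs of programs and their outcomes -/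

/-- An input together with the price `κ` of an access operation and a bound `B` on the bit lengths
of all classical registers; it determines a bound on the cost of a single step. -/
structure Machine (n : ℕ) where
  x : Input n
  κ : ℕ
  B : ℕ

/-- An upper bound for the cost of one step while all registers are below `2 ^ B`. -/
def Machine.unit {n : ℕ} (S : Machine n) : ℕ := S.κ + 3 * S.B + 3

/-- All registers hold numbers below `2 ^ B`. -/
def Bounded (B : ℕ) (σ : Store) : Prop := ∀ r, σ r < 2 ^ B

theorem Bounded.update {B : ℕ} {σ : Store} (h : Bounded B σ) {r v : ℕ} (hv : v < 2 ^ B) :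
    Bounded B (Function.update σ r v) := by
  intro q
  by_cases hq : q = r
  · subst hq; simpa using hv
  · simpa [Function.update_of_ne hq] using h q

theorem Bounded.size_le {B : ℕ} {σ : Store} (h : Bounded B σ) (r : ℕ) : Nat.size (σ r) ≤ B :=
  Nat.size_le.2 (h r)

variable {n : ℕ}

theorem flatMap_iterate (f : Config → List Config) (t : ℕ) (l : List Config) :
    (fun l : List Config => l.flatMap f)^[t] l =
      l.flatMap fun C => (fun l : List Config => l.flatMap f)^[t] [C] := by
  induction t generalizing l with
  | zero => simp
  | succ t ih =>
    simp only [Function.iterate_succ_apply]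
    rw [ih, List.flatMap_assoc]
    refine congrArg (fun g => List.flatMap g l) (funext fun C => ?_)
    rw [ih ([C].flatMap f)]
    simp

theorem branches_succ (x : Input n) (κ : ℕ) (C : Config) (t : ℕ) :
    branches x κ C (t + 1) = (step x κ C).flatMap fun C' => branches x κ C' t := by
  unfold branches
  rw [Function.iterate_succ_apply, flatMap_iterate]
  simp

theorem branches_nil (x : Input n) (κ : ℕ) (C : Config) (hC : C.todo = []) (t : ℕ) :
    branches x κ C t = [C] := by
  induction t with
  | zero => rfl
  | succ t ih => rw [branches_succ]; simp [step, hC, ih]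

/-- After `N` or more steps all branches of the computation have halted, having used time at most
`N * S.unit`, and `outs` lists their registers and memories. -/
def Halts (S : Machine n) (todo : List Prog) (σ : Store) (ψ : QState) (N : ℕ)
    (outs : List (Store × QState)) : Prop :=
  ∀ t M, N ≤ M →
    (branches S.x S.κ ⟨todo, σ, ψ, t⟩ M).map (fun C => (C.todo, C.store, C.state)) =
        outs.map (fun o => ([], o.1, o.2)) ∧
      ∀ C ∈ branches S.x S.κ ⟨todo, σ, ψ, t⟩ M, C.time ≤ t + N * S.unit

theorem Halts.nil (S : Machine n) (σ : Store) (ψ : QState) : Halts S [] σ ψ 0 [(σ, ψ)] := by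
  intro t M _
  rw [branches_nil _ _ _ rfl]
  simp

theorem Halts.mono {S : Machine n} {todo : List Prog} {σ : Store} {ψ : QState} {N N' : ℕ}
    {outs : List (Store × QState)} (h : Halts S todo σ ψ N outs) (hN : N ≤ N') :
    Halts S todo σ ψ N' outs := by
  intro t M hM
  obtain ⟨h1, h2⟩ := h t M (hN.trans hM)
  exact ⟨h1, fun C hC => (h2 C hC).trans
    (Nat.add_le_add_left (Nat.mul_le_mul_right _ hN) _)⟩

theorem Halts.step {S : Machine n} {todo todo' : List Prog} {σ : Store} {ψ : QState} {N c : ℕ}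
    {l : List (Store × QState)} {f : Store × QState → List (Store × QState)}
    (hs : ∀ t, step S.x S.κ ⟨todo, σ, ψ, t⟩ = l.map fun y => ⟨todo', y.1, y.2, t + c⟩)
    (hc : c ≤ S.unit) (h : ∀ y ∈ l, Halts S todo' y.1 y.2 N (f y)) :
    Halts S todo σ ψ (N + 1) (l.flatMap f) := by
  intro t M hM
  obtain ⟨M, rfl⟩ : ∃ M', M = M' + 1 := ⟨M - 1, by omega⟩
  rw [branches_succ, hs, List.flatMap_map]
  constructor
  · rw [List.map_flatMap, List.map_flatMap]
    refine List.flatMap_congr fun y hy => ?_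
    exact (h y hy _ M (by omega)).1
  · intro C hC
    obtain ⟨y, hy, hC⟩ := List.mem_flatMap.1 hC
    have := (h y hy _ M (by omega)).2 C hC
    rw [Nat.add_mul]
    omega

/-- Running `p` takes at most `N` steps and leads to the branches `outs`, whatever is run
afterwards. -/
def Outcomes (S : Machine n) (p : Prog) (σ : Store) (ψ : QState) (N : ℕ)
    (outs : List (Store × QState)) : Prop :=
  ∀ (rest : List Prog) (N' : ℕ) (f : Store × QState → List (Store × QState)),
    (∀ o ∈ outs, Halts S rest o.1 o.2 N' (f o)) →
      Halts S (p :: rest) σ ψ (N + N') (outs.flatMap f)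

section Outcomes

variable {S : Machine n} {p q : Prog} {σ : Store} {ψ : QState} {N N' N₁ N₂ r : ℕ}
  {outs : List (Store × QState)}

theorem Outcomes.mono (h : Outcomes S p σ ψ N outs) (hN : N ≤ N') : Outcomes S p σ ψ N' outs :=
  fun rest N₁ f hf => (h rest N₁ f hf).mono (by omega)

theorem Outcomes.halts (h : Outcomes S p σ ψ N outs) : Halts S [p] σ ψ N outs := by
  simpa using h [] 0 (fun o => [o]) fun o _ => Halts.nil S o.1 o.2

theorem Outcomes.instr {c : Instr} (hc : c.cost S.κ σ ≤ S.unit) :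
    Outcomes S (.instr c) σ ψ 1 (c.exec S.x σ ψ) := by
  intro rest N' f hf
  rw [Nat.add_comm]
  exact Halts.step (fun t => rfl) hc hf

theorem Outcomes.seq {f : Store × QState → List (Store × QState)}
    (hp : Outcomes S p σ ψ N₁ outs) (hq : ∀ o ∈ outs, Outcomes S q o.1 o.2 N₂ (f o)) :
    Outcomes S (.seq p q) σ ψ (N₁ + N₂ + 1) (outs.flatMap f) := by
  intro rest N' g hg
  have h := hp (q :: rest) (N₂ + N') (fun o => (f o).flatMap g) fun o ho =>
    hq o ho rest N' g fun o' ho' => hg o' (List.mem_flatMap.2 ⟨o, ho, ho'⟩)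
  rw [List.flatMap_assoc]
  have h' := Halts.step (S := S) (todo := .seq p q :: rest) (l := [(σ, ψ)]) (c := 1)
    (f := fun _ => outs.flatMap fun o => (f o).flatMap g) (fun t => rfl)
    (by unfold Machine.unit; omega) (by simpa using h)
  simp only [List.flatMap_cons, List.flatMap_nil, List.append_nil] at h'
  exact h'.mono (by omega)

theorem control_cost_le (hσ : Bounded S.B σ) (r : ℕ) : 1 + Nat.size (σ r) ≤ S.unit := by
  have := hσ.size_le r
  unfold Machine.unit
  omega

theorem Outcomes.ifNonzero (hσ : Bounded S.B σ)
    (h : Outcomes S (if σ r = 0 then q else p) σ ψ N outs) :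
    Outcomes S (.ifNonzero r p q) σ ψ (N + 1) outs := by
  intro rest N' f hf
  have h' := Halts.step (S := S) (todo := .ifNonzero r p q :: rest) (l := [(σ, ψ)])
    (c := 1 + Nat.size (σ r)) (f := fun _ => outs.flatMap f) (fun t => rfl)
    (control_cost_le hσ r) (by simpa using h rest N' f hf)
  simp only [List.flatMap_cons, List.flatMap_nil, List.append_nil] at h'
  exact h'.mono (by omega)

theorem Outcomes.while_zero (hσ : Bounded S.B σ) (h0 : σ r = 0) :
    Outcomes S (.whileNonzero r p) σ ψ 1 [(σ, ψ)] := by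
  intro rest N' f hf
  have h' := Halts.step (S := S) (todo := .whileNonzero r p :: rest) (todo' := rest) (σ := σ) (ψ := ψ)
    (l := [(σ, ψ)]) (c := 1 + Nat.size (σ r)) (f := f)
    (fun t => by simp [GraphCollision.step, h0])
    (control_cost_le hσ r) (N := N') (by simpa using hf)
  exact h'.mono (by omega)

theorem Outcomes.while_succ {f : Store × QState → List (Store × QState)} (hσ : Bounded S.B σ)
    (h0 : σ r ≠ 0) (hp : Outcomes S p σ ψ N₁ outs)
    (hq : ∀ o ∈ outs, Outcomes S (.whileNonzero r p) o.1 o.2 N₂ (f o)) :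
    Outcomes S (.whileNonzero r p) σ ψ (N₁ + N₂ + 1) (outs.flatMap f) := by
  intro rest N' g hg
  have h := hp (.whileNonzero r p :: rest) (N₂ + N') (fun o => (f o).flatMap g) fun o ho =>
    hq o ho rest N' g fun o' ho' => hg o' (List.mem_flatMap.2 ⟨o, ho, ho'⟩)
  rw [List.flatMap_assoc]
  have h' := Halts.step (S := S) (todo := .whileNonzero r p :: rest)
    (todo' := p :: .whileNonzero r p :: rest) (σ := σ) (ψ := ψ) (l := [(σ, ψ)])
    (c := 1 + Nat.size (σ r)) (f := fun _ => outs.flatMap fun o => (f o).flatMap g)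
    (fun t => by simp [GraphCollision.step, h0]) (control_cost_le hσ r) (by simpa using h)
  simp only [List.flatMap_cons, List.flatMap_nil, List.append_nil] at h'
  exact h'.mono (by omega)

end Outcomes

/-! ### Conservation of probability -/

theorem weight_eq_sum (ψ : QState) (s : Finset Basis) (hs : ψ.support ⊆ s) :
    weight ψ = ∑ b ∈ s, ‖ψ b‖ ^ 2 :=
  Finsupp.sum_of_support_subset _ hs _ (by simp)

theorem weight_nonneg (ψ : QState) : 0 ≤ weight ψ :=
  Finset.sum_nonneg fun _ _ => by positivity

@[simp] theorem weight_single (b : Basis) (z : ℂ) : weight (Finsupp.single b z) = ‖z‖ ^ 2 :=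
  Finsupp.sum_single_index (by simp)

theorem linear_ext {U V : QState →ₗ[ℂ] QState} {ψ : QState}
    (h : ∀ b ∈ ψ.support, U (Finsupp.single b 1) = V (Finsupp.single b 1)) : U ψ = V ψ := by
  have key : ∀ W : QState →ₗ[ℂ] QState, W ψ = ψ.sum fun b z => z • W (Finsupp.single b 1) := by
    intro W
    conv_lhs => rw [← Finsupp.sum_single ψ]
    rw [map_finsuppSum]
    refine Finsupp.sum_congr fun b _ => ?_
    rw [← map_smul, Finsupp.smul_single, smul_eq_mul, mul_one]
  rw [key, key]
  exact Finsupp.sum_congr fun b hb => by rw [h b hb]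

/-- The operator that permutes (or, in general, maps) basis states. -/
noncomputable abbrev mapOp (g : Basis → Basis) : QState →ₗ[ℂ] QState := Finsupp.lmapDomain ℂ ℂ g

theorem mapOp_single (g : Basis → Basis) (b : Basis) (z : ℂ) :
    mapOp g (Finsupp.single b z) = Finsupp.single (g b) z := by
  simp [mapOp]

theorem weight_mapOp {g : Basis → Basis} (hg : Function.Injective g) (ψ : QState) :
    weight (mapOp g ψ) = weight ψ := by
  simp only [mapOp, Finsupp.lmapDomain_apply, weight]
  exact Finsupp.sum_mapDomain_index_inj hg

theorem linearCombination_eq_mapOp (g : Basis → Basis) :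
    Finsupp.linearCombination ℂ (fun b => Finsupp.single (g b) (1 : ℂ)) = mapOp g := by
  ext b : 1
  ext c
  simp

/-- The basis state with qubit `q` flipped. -/
def flip (q : ℕ) (b : Basis) : Basis := Function.update b q (!b q)

@[simp] theorem flip_flip (q : ℕ) (b : Basis) : flip q (flip q b) = b := by
  simp [flip]

theorem flip_injective (q : ℕ) : Function.Injective (flip q) :=
  Function.LeftInverse.injective (flip_flip q)

@[simp] theorem flip_self (q : ℕ) (b : Basis) : flip q b q = !b q := by simp [flip]

theorem flip_of_ne {q r : ℕ} (h : r ≠ q) (b : Basis) : flip q b r = b r := by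
  simp [flip, Function.update_of_ne h]

/-- The Hadamard gate on qubit `q`. -/
noncomputable def hadamard (q : ℕ) : QState →ₗ[ℂ] QState :=
  Finsupp.linearCombination ℂ fun b =>
      Finsupp.single (Function.update b q false) ((1 / √2 : ℝ) : ℂ) +
      Finsupp.single (Function.update b q true) (if b q then -((1 / √2 : ℝ) : ℂ) else (1 / √2 : ℝ))

theorem hadamard_single (q : ℕ) (b : Basis) (z : ℂ) :
    hadamard q (Finsupp.single b z) =
      Finsupp.single (flip q b) (z * ((1 / √2 : ℝ) : ℂ)) +
      Finsupp.single b (z * (if b q then -((1 / √2 : ℝ) : ℂ) else (1 / √2 : ℝ))) := by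
  rw [hadamard, Finsupp.linearCombination_single, smul_add, Finsupp.smul_single,
    Finsupp.smul_single]
  cases hb : b q
  · have h1 : Function.update b q false = b := by rw [← hb]; exact Function.update_eq_self q b
    have h2 : Function.update b q true = flip q b := by simp [flip, hb]
    simp [h1, h2, add_comm]
  · have h1 : Function.update b q true = b := by rw [← hb]; exact Function.update_eq_self q b
    have h2 : Function.update b q false = flip q b := by simp [flip, hb]
    simp [h1, h2]

theorem hadamard_apply (q : ℕ) (ψ : QState) (b : Basis) :
    hadamard q ψ b = ((1 / √2 : ℝ) : ℂ) * (ψ (flip q b) + (if b q then -1 else 1) * ψ b) := by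
  classical
  induction ψ using Finsupp.induction_linear with
  | zero => simp
  | add f g hf hg => simp only [map_add, Finsupp.add_apply, hf, hg]; ring
  | single c z =>
    have h : flip q c = b ↔ c = flip q b :=
      ⟨fun h => by rw [← h, flip_flip], fun h => by rw [h, flip_flip]⟩
    simp only [hadamard_single, Finsupp.add_apply, Finsupp.single_apply, h]
    have hne : c = b → ¬ c = flip q b := by
      rintro rfl h'
      have := congrFun h' q
      simp at this
    by_cases h1 : c = b
    · have h2 := hne h1
      subst h1
      simp only [h2, if_false, if_true]
      split_ifs <;> ring
    · simp only [h1, if_false]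
      split_ifs <;> ring

theorem inv_sqrt_two_mul_self : ((1 / √2 : ℝ) : ℂ) * ((1 / √2 : ℝ) : ℂ) = 1 / 2 := by
  rw [← Complex.ofReal_mul, div_mul_div_comm, Real.mul_self_sqrt (by norm_num)]
  norm_num

theorem hadamard_hadamard (q : ℕ) (ψ : QState) : hadamard q (hadamard q ψ) = ψ := by
  ext b
  simp only [hadamard_apply, flip_flip, flip_self]
  have h := inv_sqrt_two_mul_self
  cases b q
  · simp only [Bool.not_false, if_true, Bool.false_eq_true, if_false]
    linear_combination (2 * ψ b) * h
  · simp only [Bool.not_true, if_true, Bool.false_eq_true, if_false]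
    linear_combination (2 * ψ b) * h

/-- A Hadamard gate preserves the norm: the basis states are paired by flipping the qubit, and the
parallelogram identity holds for each pair. -/
theorem weight_hadamard (q : ℕ) (ψ : QState) : weight (hadamard q ψ) = weight ψ := by
  classical
  -- a finite set of basis states that contains the support and is closed under flipping `q`
  set s : Finset Basis := ψ.support ∪ ψ.support.image (flip q) with hs
  have hflip : ∀ b, flip q b ∈ s ↔ b ∈ s := by
    have key : ∀ b, b ∈ s → flip q b ∈ s := by
      intro b hb
      simp only [hs, Finset.mem_union, Finset.mem_image] at hb ⊢
      rcases hb with hb | ⟨c, hc, rfl⟩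
      · exact Or.inr ⟨b, hb, rfl⟩
      · left; rwa [flip_flip]
    exact fun b => ⟨fun h => by simpa using key _ h, key b⟩
  have hψ : ψ.support ⊆ s := Finset.subset_union_left
  have hsupp : (hadamard q ψ).support ⊆ s := by
    intro b hb
    by_contra hbs
    have h1 : ψ b = 0 := by
      by_contra h; exact hbs (hψ (Finsupp.mem_support_iff.2 h))
    have h2 : ψ (flip q b) = 0 := by
      by_contra h; exact hbs ((hflip b).1 (hψ (Finsupp.mem_support_iff.2 h)))
    exact Finsupp.mem_support_iff.1 hb (by rw [hadamard_apply, h1, h2]; simp)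
  rw [weight_eq_sum _ s hsupp, weight_eq_sum _ s hψ]
  have hsum : ∀ f : Basis → ℝ, ∑ b ∈ s, f (flip q b) = ∑ b ∈ s, f b := by
    intro f
    refine Finset.sum_nbij' (flip q) (flip q) ?_ ?_ ?_ ?_ ?_
    · exact fun b hb => (hflip b).2 hb
    · exact fun b hb => (hflip b).2 hb
    · exact fun b _ => flip_flip q b
    · exact fun b _ => flip_flip q b
    · exact fun b _ => rfl
  have hpair : ∀ b, ‖hadamard q ψ b‖ ^ 2 + ‖hadamard q ψ (flip q b)‖ ^ 2 =
      ‖ψ b‖ ^ 2 + ‖ψ (flip q b)‖ ^ 2 := by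
    intro b
    have h2 : ‖((1 / √2 : ℝ) : ℂ)‖ ^ 2 = 1 / 2 := by
      rw [Complex.norm_real, Real.norm_eq_abs, sq_abs, div_pow, Real.sq_sqrt (by norm_num)]
      norm_num
    have hp := parallelogram_law_with_norm ℝ (ψ b) (ψ (flip q b))
    simp only [hadamard_apply, flip_flip, flip_self, norm_mul, mul_pow, h2]
    cases b q
    · simp only [Bool.not_false, if_true, Bool.false_eq_true, if_false, one_mul, neg_mul]
      rw [← sub_eq_add_neg, add_comm (ψ (flip q b))]
      nlinarith [hp]
    · simp only [Bool.not_true, if_true, Bool.false_eq_true, if_false, one_mul, neg_mul]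
      rw [← sub_eq_add_neg, ← norm_neg (ψ (flip q b) - ψ b), neg_sub]
      nlinarith [hp]
  have h1 := Finset.sum_congr (rfl : s = s) fun b _ => hpair b
  rw [Finset.sum_add_distrib, Finset.sum_add_distrib, hsum fun b => ‖hadamard q ψ b‖ ^ 2,
    hsum fun b => ‖ψ b‖ ^ 2] at h1
  linarith

/-- Multiplication of the amplitude of every basis state by its own factor. -/
noncomputable def diagOp (d : Basis → ℂ) : QState →ₗ[ℂ] QState :=
  Finsupp.linearCombination ℂ fun b => Finsupp.single b (d b)

theorem diagOp_single (d : Basis → ℂ) (b : Basis) (z : ℂ) :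
    diagOp d (Finsupp.single b z) = Finsupp.single b (z * d b) := by
  simp [diagOp]

theorem diagOp_apply (d : Basis → ℂ) (ψ : QState) (b : Basis) : diagOp d ψ b = d b * ψ b := by
  classical
  induction ψ using Finsupp.induction_linear with
  | zero => simp
  | add f g hf hg => simp only [map_add, Finsupp.add_apply, hf, hg]; ring
  | single c z =>
    rw [diagOp_single, Finsupp.single_apply, Finsupp.single_apply]
    split_ifs with h
    · rw [h]; ring
    · simp

theorem weight_diagOp {d : Basis → ℂ} (hd : ∀ b, ‖d b‖ = 1) (ψ : QState) :
    weight (diagOp d ψ) = weight ψ := by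
  rw [weight_eq_sum (diagOp d ψ) ψ.support, weight_eq_sum ψ ψ.support subset_rfl]
  · exact Finset.sum_congr rfl fun b _ => by rw [diagOp_apply, norm_mul, hd, one_mul]
  · intro b hb
    rw [Finsupp.mem_support_iff, diagOp_apply] at hb
    exact Finsupp.mem_support_iff.2 (right_ne_zero_of_mul hb)

/-- The action of a Toffoli gate on basis states. -/
def toffoliMap (a a' q : ℕ) (b : Basis) : Basis :=
  if a = q ∨ a' = q then b else Function.update b q (Bool.xor (b q) (b a && b a'))

/-- The action of a controlled negation on basis states. -/
def cnotMap (a q : ℕ) (b : Basis) : Basis :=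
  if a = q then b else Function.update b q (Bool.xor (b q) (b a))

theorem toffoliMap_involutive (a a' q : ℕ) : Function.Involutive (toffoliMap a a' q) := by
  intro b
  unfold toffoliMap
  split_ifs with h
  · rfl
  · push Not at h
    simp [Function.update_of_ne h.1, Function.update_of_ne h.2]

theorem cnotMap_involutive (a q : ℕ) : Function.Involutive (cnotMap a q) := by
  intro b
  unfold cnotMap
  split_ifs with h
  · rfl
  · simp [Function.update_of_ne h]

theorem readBits_congr {b b' : Basis} {p w : ℕ} (h : ∀ i < w, b (p + i) = b' (p + i)) :
    readBits b p w = readBits b' p w :=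
  Finset.sum_congr rfl fun i hi => by rw [h i (Finset.mem_range.1 hi)]

theorem queryBasis_of_lt (x : Input n) (o : Oracle) (p : ℕ) (b : Basis) {q : ℕ}
    (hq : q < p + 2 * Nat.size n) : queryBasis x o p b q = b q := by
  simp [queryBasis, Nat.not_le.2 hq]

theorem queryBasis_involutive (x : Input n) (o : Oracle) (p : ℕ) :
    Function.Involutive (queryBasis x o p) := by
  intro b
  have h1 : readBits (queryBasis x o p b) p (Nat.size n) = readBits b p (Nat.size n) :=
    readBits_congr fun i hi => queryBasis_of_lt x o p b (by omega)
  have h2 : readBits (queryBasis x o p b) (p + Nat.size n) (Nat.size n) =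
      readBits b (p + Nat.size n) (Nat.size n) :=
    readBits_congr fun i hi => queryBasis_of_lt x o p b (by omega)
  funext q
  rw [queryBasis, h1, h2]
  simp [queryBasis]

theorem op_X (x : Input n) (q : ℕ) : (Gate.X q).op x = mapOp (flip q) :=
  linearCombination_eq_mapOp _

theorem op_H (x : Input n) (q : ℕ) : (Gate.H q).op x = hadamard q := rfl

theorem op_T (x : Input n) (q : ℕ) : (Gate.T q).op x =
    diagOp fun b => if b q then Complex.exp (Complex.I * Real.pi / 4) else 1 := rfl

theorem op_CNOT (x : Input n) (a q : ℕ) : (Gate.CNOT a q).op x = mapOp (cnotMap a q) :=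
  linearCombination_eq_mapOp _

theorem op_Toffoli (x : Input n) (a a' q : ℕ) :
    (Gate.Toffoli a a' q).op x = mapOp (toffoliMap a a' q) :=
  linearCombination_eq_mapOp _

theorem op_query (x : Input n) (o : Oracle) (p : ℕ) :
    (Gate.query o p).op x = mapOp (queryBasis x o p) :=
  linearCombination_eq_mapOp _

theorem weight_op (x : Input n) (g : Gate) (ψ : QState) : weight (g.op x ψ) = weight ψ := by
  cases g with
  | X q => rw [op_X, weight_mapOp (flip_injective q)]
  | H q => rw [op_H, weight_hadamard]
  | T q =>
    rw [op_T, weight_diagOp]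
    intro b
    split_ifs
    · rw [Complex.norm_exp]; simp
    · simp
  | CNOT a q => rw [op_CNOT, weight_mapOp (cnotMap_involutive a q).injective]
  | Toffoli a a' q => rw [op_Toffoli, weight_mapOp (toffoliMap_involutive a a' q).injective]
  | query o p => rw [op_query, weight_mapOp (queryBasis_involutive x o p).injective]

theorem sum_filter_add (ψ : QState) (q : ℕ) (g : Basis → ℂ → ℝ) :
    (ψ.filter fun b => b q = false).sum g + (ψ.filter fun b => b q = true).sum g = ψ.sum g := by
  classical
  rw [Finsupp.sum_filter_index, Finsupp.sum_filter_index, Finsupp.support_filter,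
    Finsupp.support_filter, Finsupp.sum,
    ← Finset.sum_filter_add_sum_filter_not ψ.support fun b => b q = false]
  simp

theorem weight_exec (x : Input n) (σ : Store) (ψ : QState) (c : Instr) :
    ((c.exec x σ ψ).map fun o => weight o.2).sum = weight ψ := by
  cases c with
  | gate g => simp [Instr.exec, weight_op]
  | measure r q => simpa [Instr.exec, weight] using sum_filter_add ψ (σ q) fun _ z => ‖z‖ ^ 2
  | _ => simp [Instr.exec]

theorem weight_step (x : Input n) (κ : ℕ) (C : Config) :
    ((step x κ C).map fun C' => weight C'.state).sum = weight C.state := by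
  obtain ⟨todo, σ, ψ, t⟩ := C
  rcases todo with _ | ⟨p, rest⟩
  · simp [step]
  · cases p with
    | instr c => simpa [step, Function.comp_def] using weight_exec x σ ψ c
    | _ => simp [step]

theorem sum_map_flatMap {α β : Type*} (l : List α) (f : α → List β) (g : β → ℝ) :
    ((l.flatMap f).map g).sum = (l.map fun a => ((f a).map g).sum).sum := by
  induction l with
  | nil => simp
  | cons a l ih => simp [ih]

theorem weight_branches (x : Input n) (κ : ℕ) (C : Config) (t : ℕ) :
    ((branches x κ C t).map fun C' => weight C'.state).sum = weight C.state := by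
  induction t generalizing C with
  | zero => simp [branches]
  | succ t ih =>
    rw [branches_succ, sum_map_flatMap, ← weight_step x κ C]
    simp only [ih]

theorem Outcomes.weight_sum {S : Machine n} {p : Prog} {σ : Store} {ψ : QState} {N : ℕ}
    {outs : List (Store × QState)} (h : Outcomes S p σ ψ N outs) :
    (outs.map fun o => weight o.2).sum = weight ψ := by
  have h1 := (h.halts 0 N le_rfl).1
  have h2 := congrArg (fun l => (l.map fun y => weight y.2.2).sum) h1
  simp only [List.map_map, Function.comp_def] at h2
  rw [← h2]
  exact weight_branches S.x S.κ _ N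

/-! ### Program logic -/

/-- From the registers `σ`, the program `p` takes at most `N` steps without branching, applies the
operator `U` to the memory, and leaves registers that satisfy `Post`. -/
def Run (S : Machine n) (p : Prog) (σ : Store) (N : ℕ) (U : QState →ₗ[ℂ] QState)
    (Post : Store → Prop) : Prop :=
  ∃ σ', Post σ' ∧ ∀ ψ, Outcomes S p σ ψ N [(σ', U ψ)]

/-- From the registers `σ` and the memory `ψ`, the program `p` takes at most `N` steps, all its
branches satisfy `Q`, and the values of `F` at its branches add up to at most `e`. If `F` is the
weight of the branches on which something goes wrong, then `e` bounds the probability of that. -/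
def Expect (S : Machine n) (p : Prog) (σ : Store) (ψ : QState) (N : ℕ)
    (F : Store → QState → ℝ) (e : ℝ) (Q : Store → QState → Prop) : Prop :=
  ∃ outs, Outcomes S p σ ψ N outs ∧ (∀ o ∈ outs, Q o.1 o.2) ∧
    (outs.map fun o => F o.1 o.2).sum ≤ e

section Run

variable {S : Machine n} {p q : Prog} {σ : Store} {N N' N₁ N₂ r : ℕ}
  {U V : QState →ₗ[ℂ] QState} {P P' : Store → Prop}

theorem Run.mono (h : Run S p σ N U P) (hN : N ≤ N') : Run S p σ N' U P := by
  obtain ⟨σ', h1, h2⟩ := h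
  exact ⟨σ', h1, fun ψ => (h2 ψ).mono hN⟩

theorem Run.post (h : Run S p σ N U P) (hP : ∀ σ', P σ' → P' σ') : Run S p σ N U P' := by
  obtain ⟨σ', h1, h2⟩ := h
  exact ⟨σ', hP _ h1, h2⟩

theorem Run.seq (hp : Run S p σ N₁ U P) (hq : ∀ σ', P σ' → Run S q σ' N₂ V P') :
    Run S (.seq p q) σ (N₁ + N₂ + 1) (V ∘ₗ U) P' := by
  obtain ⟨σ₁, h1, h2⟩ := hp
  obtain ⟨σ₂, h3, h4⟩ := hq σ₁ h1
  refine ⟨σ₂, h3, fun ψ => ?_⟩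
  simpa using (h2 ψ).seq (f := fun o => [(σ₂, V o.2)]) (N₂ := N₂) (q := q) fun o ho => by
    obtain rfl : o = (σ₁, U ψ) := by simpa using ho
    exact h4 _

/-- Purely classical code followed by `q`. -/
theorem Run.seq_id (hp : Run S p σ N₁ .id P) (hq : ∀ σ', P σ' → Run S q σ' N₂ V P') :
    Run S (.seq p q) σ (N₁ + N₂ + 1) V P' :=
  Run.seq hp hq

/-- Purely classical code after `p`. -/
theorem Run.id_seq (hp : Run S p σ N₁ U P) (hq : ∀ σ', P σ' → Run S q σ' N₂ .id P') :
    Run S (.seq p q) σ (N₁ + N₂ + 1) U P' :=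
  Run.seq hp hq

theorem Run.gate (hσ : Bounded S.B σ) (g : Gate) :
    Run S (.instr (.gate g)) σ 1 ((g.resolve σ).op S.x) (fun σ' => σ' = σ) := by
  refine ⟨σ, rfl, fun ψ => Outcomes.instr ?_⟩
  have hs := hσ.size_le
  unfold Machine.unit
  cases g with
  | X q => have := hs q; simp only [Instr.cost, Gate.resolve, Gate.cost]; omega
  | H q => have := hs q; simp only [Instr.cost, Gate.resolve, Gate.cost]; omega
  | T q => have := hs q; simp only [Instr.cost, Gate.resolve, Gate.cost]; omega
  | CNOT a q =>
    have := hs q; have := hs a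
    simp only [Instr.cost, Gate.resolve, Gate.cost]; omega
  | Toffoli a a' q =>
    have := hs q; have := hs a; have := hs a'
    simp only [Instr.cost, Gate.resolve, Gate.cost]; omega
  | query o q =>
    have := hs q
    have ho : o.price S.κ ≤ S.κ + 1 := by cases o <;> simp [Oracle.price]
    simp only [Instr.cost, Gate.resolve, Gate.cost]; omega

theorem Run.ifNonzero (hσ : Bounded S.B σ) (h : Run S (if σ r = 0 then q else p) σ N U P) :
    Run S (.ifNonzero r p q) σ (N + 1) U P := by
  obtain ⟨σ', h1, h2⟩ := h
  exact ⟨σ', h1, fun ψ => (h2 ψ).ifNonzero hσ⟩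

/-- `V i` first, then `V (i + 1)` and so on: `k` operators in all. -/
noncomputable def iter (V : ℕ → QState →ₗ[ℂ] QState) : ℕ → ℕ → QState →ₗ[ℂ] QState
  | _, 0 => .id
  | i, k + 1 => iter V (i + 1) k ∘ₗ V i

/-- `V (k - 1)` first, and `V 0` last. -/
noncomputable def iterDown (V : ℕ → QState →ₗ[ℂ] QState) : ℕ → QState →ₗ[ℂ] QState
  | 0 => .id
  | k + 1 => iterDown V k ∘ₗ V k

theorem iter_succ (V : ℕ → QState →ₗ[ℂ] QState) (i k : ℕ) :
    iter V i (k + 1) = V (i + k) ∘ₗ iter V i k := by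
  induction k generalizing i with
  | zero => rfl
  | succ k ih =>
    rw [iter, ih, iter, LinearMap.comp_assoc]
    congr 2
    omega

theorem iter_eq_iterDown (V : ℕ → QState →ₗ[ℂ] QState) (i k l : ℕ) (h : i + k = l) :
    iter (fun j => V (l - 1 - j)) i k = iterDown V k := by
  induction k generalizing i with
  | zero => rfl
  | succ k ih =>
    rw [iter, iterDown, ih (i + 1) (by omega)]
    congr 2
    omega

/-- A loop of `l` rounds. -/
theorem Run.while {V : ℕ → QState →ₗ[ℂ] QState} {Inv : ℕ → Store → Prop} {l : ℕ}
    (hInv : ∀ i ≤ l, ∀ σ, Inv i σ → Bounded S.B σ ∧ (σ r = 0 ↔ i = l))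
    (hbody : ∀ i < l, ∀ σ, Inv i σ → Run S p σ N (V i) (Inv (i + 1))) (h0 : Inv 0 σ) :
    Run S (.whileNonzero r p) σ (l * (N + 1) + 1) (iter V 0 l) (Inv l) := by
  have key : ∀ k i σ, i + k = l → Inv i σ →
      Run S (.whileNonzero r p) σ (k * (N + 1) + 1) (iter V i k) (Inv l) := by
    intro k
    induction k with
    | zero =>
      intro i σ hi hσ
      obtain ⟨hB, hr⟩ := hInv i (by omega) σ hσ
      obtain rfl : i = l := by omega
      refine ⟨σ, hσ, fun ψ => ?_⟩
      simpa [iter] using Outcomes.while_zero (p := p) (ψ := ψ) (r := r) hB (hr.2 rfl)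
    | succ k ih =>
      intro i σ hi hσ
      obtain ⟨hB, hr⟩ := hInv i (by omega) σ hσ
      obtain ⟨σ₁, h1, h2⟩ := hbody i (by omega) σ hσ
      obtain ⟨σ₂, h3, h4⟩ := ih (i + 1) σ₁ (by omega) h1
      refine ⟨σ₂, h3, fun ψ => ?_⟩
      have := Outcomes.while_succ (r := r) (f := fun o => [(σ₂, iter V (i + 1) k o.2)])
        (N₂ := k * (N + 1) + 1) hB (fun h => by have := hr.1 h; omega) (h2 ψ) fun o ho => by
          obtain rfl : o = (σ₁, V i ψ) := by simpa using ho
          exact h4 _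
      rw [show (k + 1) * (N + 1) + 1 = N + (k * (N + 1) + 1) + 1 by ring]
      simpa [iter] using this
  exact key l 0 σ (by omega) h0

/-- A loop controlled by the register `r`, which counts down from `l`. -/
theorem Run.loop {V : ℕ → QState →ₗ[ℂ] QState} {Inv : ℕ → Store → Prop} {l : ℕ}
    (hInv : ∀ i ≤ l, ∀ σ, Inv i σ → Bounded S.B σ ∧ σ r = l - i)
    (hbody : ∀ i < l, ∀ σ, Inv i σ → Run S p σ N (V i) (Inv (i + 1))) (h0 : Inv 0 σ) :
    Run S (.whileNonzero r p) σ (l * (N + 1) + 1) (iter V 0 l) (Inv l) :=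
  Run.while (fun i hi σ h => ⟨(hInv i hi σ h).1, by rw [(hInv i hi σ h).2]; omega⟩) hbody h0

theorem iter_id (i k : ℕ) : iter (fun _ => .id) i k = .id := by
  induction k generalizing i with
  | zero => rfl
  | succ k ih => rw [iter, ih]; rfl

theorem Run.while_id {Inv : ℕ → Store → Prop} {l : ℕ}
    (hInv : ∀ i ≤ l, ∀ σ, Inv i σ → Bounded S.B σ ∧ (σ r = 0 ↔ i = l))
    (hbody : ∀ i < l, ∀ σ, Inv i σ → Run S p σ N .id (Inv (i + 1))) (h0 : Inv 0 σ) :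
    Run S (.whileNonzero r p) σ (l * (N + 1) + 1) .id (Inv l) := by
  have := Run.while (V := fun _ => .id) hInv hbody h0
  rwa [iter_id] at this

end Run

section Expect

variable {S : Machine n} {p q : Prog} {σ : Store} {ψ : QState} {N N' N₁ N₂ r : ℕ}
  {F F' F₁ : Store → QState → ℝ} {e e' : ℝ} {Q Q' Q₁ : Store → QState → Prop}

theorem sum_map_le {α : Type*} {l : List α} {f g : α → ℝ} (h : ∀ a ∈ l, f a ≤ g a) :
    (l.map f).sum ≤ (l.map g).sum :=
  List.sum_le_sum h

theorem Expect.mono (h : Expect S p σ ψ N F e Q) (hN : N ≤ N') (he : e ≤ e')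
    (hQ : ∀ σ' ψ', Q σ' ψ' → Q' σ' ψ' ∧ F' σ' ψ' ≤ F σ' ψ') : Expect S p σ ψ N' F' e' Q' := by
  obtain ⟨outs, h1, h2, h3⟩ := h
  exact ⟨outs, h1.mono hN, fun o ho => (hQ _ _ (h2 o ho)).1,
    (sum_map_le fun o ho => (hQ _ _ (h2 o ho)).2).trans (h3.trans he)⟩

theorem Expect.seq (hp : Expect S p σ ψ N₁ F₁ e Q₁)
    (hq : ∀ σ' ψ', Q₁ σ' ψ' → Expect S q σ' ψ' N₂ F (F₁ σ' ψ') Q) :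
    Expect S (.seq p q) σ ψ (N₁ + N₂ + 1) F e Q := by
  classical
  obtain ⟨outs, h1, h2, h3⟩ := hp
  choose! g hg1 hg2 hg3 using fun (o : Store × QState) (ho : o ∈ outs) => hq o.1 o.2 (h2 o ho)
  refine ⟨outs.flatMap g, h1.seq hg1, ?_, ?_⟩
  · intro o ho
    obtain ⟨o', ho', ho⟩ := List.mem_flatMap.1 ho
    exact hg2 o' ho' o ho
  · rw [sum_map_flatMap]
    exact (sum_map_le hg3).trans h3

theorem Run.expect {U : QState →ₗ[ℂ] QState} {P : Store → Prop} (h : Run S p σ N U P)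
    (hQ : ∀ σ', P σ' → Q σ' (U ψ) ∧ F σ' (U ψ) ≤ e) : Expect S p σ ψ N F e Q := by
  obtain ⟨σ', h1, h2⟩ := h
  exact ⟨_, h2 ψ, by simpa using (hQ σ' h1).1, by simpa using (hQ σ' h1).2⟩

theorem Run.seq_expect {U : QState →ₗ[ℂ] QState} {P : Store → Prop} (hp : Run S p σ N₁ U P)
    (hq : ∀ σ', P σ' → Expect S q σ' (U ψ) N₂ F e Q) :
    Expect S (.seq p q) σ ψ (N₁ + N₂ + 1) F e Q := by
  obtain ⟨σ', h1, h2⟩ := hp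
  obtain ⟨outs, h3, h4, h5⟩ := hq σ' h1
  refine ⟨outs, ?_, h4, h5⟩
  simpa using (h2 ψ).seq (f := fun _ => outs) (N₂ := N₂) (q := q) fun o ho => by
    obtain rfl : o = (σ', U ψ) := by simpa using ho
    exact h3

theorem Expect.ifNonzero (hσ : Bounded S.B σ)
    (h : Expect S (if σ r = 0 then q else p) σ ψ N F e Q) :
    Expect S (.ifNonzero r p q) σ ψ (N + 1) F e Q := by
  obtain ⟨outs, h1, h2, h3⟩ := h
  exact ⟨outs, h1.ifNonzero hσ, h2, h3⟩

theorem Expect.measure {a : ℕ} (hσ : Bounded S.B σ)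
    (h0 : Q (Function.update σ r 0) (ψ.filter fun b => b (σ a) = false))
    (h1 : Q (Function.update σ r 1) (ψ.filter fun b => b (σ a) = true))
    (hF : F (Function.update σ r 0) (ψ.filter fun b => b (σ a) = false) +
      F (Function.update σ r 1) (ψ.filter fun b => b (σ a) = true) ≤ e) :
    Expect S (.instr (.measure r a)) σ ψ 1 F e Q := by
  refine ⟨_, Outcomes.instr ?_, ?_, ?_⟩
  · have := hσ.size_le a
    unfold Machine.unit
    simp only [Instr.cost]
    omega
  · simp [Instr.exec, h0, h1]
  · simpa [Instr.exec] using hF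

theorem Expect.loop {F : ℕ → Store → QState → ℝ} {Inv : ℕ → Store → QState → Prop} {l : ℕ}
    (hInv : ∀ i ≤ l, ∀ σ ψ, Inv i σ ψ → Bounded S.B σ ∧ σ r = l - i)
    (hbody : ∀ i < l, ∀ σ ψ, Inv i σ ψ → Expect S p σ ψ N (F (i + 1)) (F i σ ψ) (Inv (i + 1)))
    (h0 : Inv 0 σ ψ) :
    Expect S (.whileNonzero r p) σ ψ (l * (N + 1) + 1) (F l) (F 0 σ ψ) (Inv l) := by
  have key : ∀ k i σ ψ, i + k = l → Inv i σ ψ →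
      Expect S (.whileNonzero r p) σ ψ (k * (N + 1) + 1) (F l) (F i σ ψ) (Inv l) := by
    intro k
    induction k with
    | zero =>
      intro i σ ψ hi hσ
      obtain ⟨hB, hr⟩ := hInv i (by omega) σ ψ hσ
      obtain rfl : i = l := by omega
      refine ⟨[(σ, ψ)], ?_, by simpa using hσ, by simp⟩
      simpa using Outcomes.while_zero (p := p) (ψ := ψ) hB (show σ r = 0 by omega)
    | succ k ih =>
      intro i σ ψ hi hσ
      obtain ⟨hB, hr⟩ := hInv i (by omega) σ ψ hσ
      obtain ⟨outs, h1, h2, h3⟩ := hbody i (by omega) σ ψ hσ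
      choose! g hg1 hg2 hg3 using fun (o : Store × QState) (ho : o ∈ outs) =>
        ih (i + 1) o.1 o.2 (by omega) (h2 o ho)
      refine ⟨outs.flatMap g, ?_, ?_, ?_⟩
      · rw [show (k + 1) * (N + 1) + 1 = N + (k * (N + 1) + 1) + 1 by ring]
        exact h1.while_succ hB (by omega) hg1
      · intro o ho
        obtain ⟨o', ho', ho⟩ := List.mem_flatMap.1 ho
        exact hg2 o' ho' o ho
      · rw [sum_map_flatMap]
        exact (sum_map_le hg3).trans h3
  exact key l 0 σ ψ (by omega) h0

theorem Expect.add_weight (h : Expect S p σ ψ N F e Q) (ε : ℝ) :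
    Expect S p σ ψ N (fun σ' ψ' => F σ' ψ' + ε * weight ψ') (e + ε * weight ψ) Q := by
  obtain ⟨outs, h1, h2, h3⟩ := h
  refine ⟨outs, h1, h2, ?_⟩
  rw [List.sum_map_add, List.sum_map_mul_left, h1.weight_sum]
  linarith

end Expect

/-! ### Straight-line classical code -/

/-- A step without effect. -/
def skip : Prog := .instr (.gate (.CNOT 4 4))

/-- Run a list of instructions one after the other. -/
def code : List Instr → Prog
  | [] => skip
  | c :: l => .seq (.instr c) (code l)

/-- The effect of a classical instruction on the registers. -/
def Instr.eval : Instr → Store → Store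
  | .const r a, σ => Function.update σ r a
  | .add r s t, σ => Function.update σ r (σ s + σ t)
  | .sub r s t, σ => Function.update σ r (σ s - σ t)
  | .half r s, σ => Function.update σ r (σ s / 2)
  | _, σ => σ

/-- A classical instruction whose result stays below `2 ^ B`. -/
def Instr.Fits (B : ℕ) (σ : Store) : Instr → Prop
  | .const _ a => a < 2 ^ B
  | .add _ s t => σ s + σ t < 2 ^ B
  | .sub _ _ _ => True
  | .half _ _ => True
  | _ => False

/-- The effect of a list of classical instructions on the registers. -/
def evalCode : List Instr → Store → Store
  | [], σ => σ
  | c :: l, σ => evalCode l (c.eval σ)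

/-- All results in the course of a list of classical instructions stay below `2 ^ B`. -/
def FitsCode (B : ℕ) : List Instr → Store → Prop
  | [], _ => True
  | c :: l, σ => c.Fits B σ ∧ FitsCode B l (c.eval σ)

theorem Run.skip {S : Machine n} {σ : Store} (hσ : Bounded S.B σ) :
    Run S skip σ 1 .id (fun σ' => σ' = σ) := by
  have h := Run.gate hσ (.CNOT 4 4)
  have : ((Gate.CNOT 4 4).resolve σ).op S.x = .id := by
    rw [Gate.resolve, op_CNOT]
    ext b : 1
    ext c
    simp [cnotMap]
  rwa [this] at h

theorem Run.classical {S : Machine n} {σ : Store} {c : Instr} (hσ : Bounded S.B σ)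
    (hc : c.Fits S.B σ) :
    Run S (.instr c) σ 1 .id (fun σ' => σ' = c.eval σ ∧ Bounded S.B σ') := by
  have hs := hσ.size_le
  cases c with
  | const r a =>
    refine ⟨_, ⟨rfl, hσ.update hc⟩, fun ψ => Outcomes.instr ?_⟩
    have : Nat.size a ≤ S.B := Nat.size_le.2 hc
    unfold Machine.unit
    simp only [Instr.cost]; omega
  | add r s t =>
    refine ⟨_, ⟨rfl, hσ.update hc⟩, fun ψ => Outcomes.instr ?_⟩
    have := hs s; have := hs t
    unfold Machine.unit
    simp only [Instr.cost]; omega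
  | sub r s t =>
    refine ⟨_, ⟨rfl, hσ.update ((Nat.sub_le _ _).trans_lt (hσ s))⟩, fun ψ => Outcomes.instr ?_⟩
    have := hs s; have := hs t
    unfold Machine.unit
    simp only [Instr.cost]; omega
  | half r s =>
    refine ⟨_, ⟨rfl, hσ.update ((Nat.div_le_self _ _).trans_lt (hσ s))⟩,
      fun ψ => Outcomes.instr ?_⟩
    have := hs s
    unfold Machine.unit
    simp only [Instr.cost]; omega
  | gate g => exact hc.elim
  | measure r q => exact hc.elim

theorem Run.code {S : Machine n} {σ : Store} {l : List Instr} (hσ : Bounded S.B σ)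
    (hl : FitsCode S.B l σ) :
    Run S (code l) σ (2 * l.length + 1) .id (fun σ' => σ' = evalCode l σ ∧ Bounded S.B σ') := by
  induction l generalizing σ with
  | nil => exact (Run.skip hσ).post fun σ' h => ⟨h, h ▸ hσ⟩
  | cons c l ih =>
    refine ((Run.classical hσ hl.1).seq_id (N₂ := 2 * l.length + 1) (P' := fun σ' =>
      σ' = evalCode (c :: l) σ ∧ Bounded S.B σ') ?_).mono (by simp; omega)
    rintro σ' ⟨rfl, hB⟩
    exact ih hB hl.2

/-- The registers below `k` agree. -/
def Agree (k : ℕ) (σ σ' : Store) : Prop := ∀ r < k, σ' r = σ r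

theorem Agree.refl (k : ℕ) (σ : Store) : Agree k σ σ := fun _ _ => rfl

theorem Agree.trans {k : ℕ} {σ σ' σ'' : Store} (h : Agree k σ σ') (h' : Agree k σ' σ'') :
    Agree k σ σ'' := fun r hr => (h' r hr).trans (h r hr)

theorem Agree.mono {k k' : ℕ} {σ σ' : Store} (h : Agree k σ σ') (hk : k' ≤ k) :
    Agree k' σ σ' := fun r hr => h r (hr.trans_le hk)

theorem Agree.update {k r v : ℕ} {σ σ' : Store} (h : Agree k σ σ') (hr : k ≤ r) :
    Agree k σ (Function.update σ' r v) := fun q hq => by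
  rw [Function.update_of_ne (by omega), h q hq]

/-! ### Reversible circuits: copying, writing and querying -/

/-- Register `3` holds `1` and register `4` holds `0`. -/
def Consts (σ : Store) : Prop := σ 3 = 1 ∧ σ 4 = 0

theorem Consts.of_agree {k : ℕ} {σ σ' : Store} (h : Consts σ) (ha : Agree k σ σ') (hk : 4 < k) :
    Consts σ' :=
  ⟨(ha 3 (by omega)).trans h.1, (ha 4 hk).trans h.2⟩

/-- Add (modulo 2) the `l` qubits that begin at `s` to those that begin at `d`. -/
def copyMap (s d l : ℕ) (b : Basis) : Basis := fun q =>
  Bool.xor (b q) (decide (d ≤ q ∧ q < d + l) && b (s + (q - d)))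

/-- Add (modulo 2) the `l` binary digits of `v` to the qubits that begin at `p`. -/
def writeMap (v p l : ℕ) (b : Basis) : Basis := fun q =>
  Bool.xor (b q) (decide (p ≤ q ∧ q < p + l) && v.testBit (q - p))

theorem copyMap_zero (s d : ℕ) : copyMap s d 0 = id := by
  funext b q
  simp only [copyMap, add_zero, id]
  rw [decide_eq_false (by omega)]
  simp

theorem copyMap_succ (s d l : ℕ) (h : s + (l + 1) ≤ d) (b : Basis) :
    copyMap s d (l + 1) b = cnotMap (s + l) (d + l) (copyMap s d l b) := by
  funext q
  unfold cnotMap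
  rw [if_neg (by omega)]
  by_cases hq : q = d + l
  · subst hq
    rw [Function.update_self]
    simp only [copyMap]
    rw [decide_eq_true (by omega), decide_eq_false (by omega), decide_eq_false (by omega)]
    simp
  · rw [Function.update_of_ne hq]
    simp only [copyMap]
    congr 3
    exact propext ⟨fun h => by omega, fun h => by omega⟩

theorem copyMap_involutive {s d l : ℕ} (h : s + l ≤ d) : Function.Involutive (copyMap s d l) := by
  intro b
  funext q
  simp only [copyMap]
  by_cases hq : d ≤ q ∧ q < d + l
  · rw [decide_eq_true hq, decide_eq_false (p := d ≤ s + (q - d) ∧ s + (q - d) < d + l) (by omega)]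
    simp
  · rw [decide_eq_false hq]
    simp

theorem writeMap_zero (v p : ℕ) : writeMap v p 0 = id := by
  funext b q
  simp only [writeMap, add_zero, id]
  rw [decide_eq_false (by omega)]
  simp

theorem writeMap_succ (v p l : ℕ) (b : Basis) :
    writeMap v p (l + 1) b = (if v.testBit l then flip (p + l) else id) (writeMap v p l b) := by
  funext q
  by_cases hq : q = p + l
  · subst hq
    cases hv : v.testBit l <;> simp [writeMap, hv]
  · have : (p ≤ q ∧ q < p + (l + 1)) = (p ≤ q ∧ q < p + l) :=
      propext ⟨fun h => by omega, fun h => by omega⟩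
    cases hv : v.testBit l
    · simp only [writeMap, this, Bool.false_eq_true, if_false, id]
    · simp only [if_true]
      rw [flip_of_ne hq]
      simp only [writeMap, this]

theorem writeMap_involutive (v p l : ℕ) : Function.Involutive (writeMap v p l) := by
  intro b
  funext q
  simp [writeMap]

theorem mapOp_comp (g h : Basis → Basis) : mapOp g ∘ₗ mapOp h = mapOp (g ∘ h) :=
  (Finsupp.lmapDomain_comp ℂ ℂ h g).symm

theorem mapOp_id : mapOp id = .id := Finsupp.lmapDomain_id ℂ ℂ

theorem iter_copy (s d l : ℕ) (h : s + l ≤ d) :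
    iter (fun i => mapOp (cnotMap (s + i) (d + i))) 0 l = mapOp (copyMap s d l) := by
  induction l with
  | zero => rw [copyMap_zero, mapOp_id]; rfl
  | succ l ih =>
    rw [iter_succ, ih (by omega), mapOp_comp]
    congr 1
    funext b
    rw [copyMap_succ s d l h]
    simp

theorem iter_write (v p l : ℕ) :
    iter (fun i => mapOp (if v.testBit i then flip (p + i) else id)) 0 l =
      mapOp (writeMap v p l) := by
  induction l with
  | zero => rw [writeMap_zero, mapOp_id]; rfl
  | succ l ih =>
    rw [iter_succ, ih, mapOp_comp]
    congr 1
    funext b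
    rw [writeMap_succ v p l]
    simp

/-- The pieces of reversible circuits; the fields are numbers of registers that hold a number to be
written, addresses of qubits, and lengths. -/
inductive Block where
  | copy (s d l : ℕ)
  | write (v p l : ℕ)
  | query (o : Oracle) (p : ℕ)

/-- The action of a block on basis states, for given contents of the registers. -/
def Block.map (x : Input n) (σ : Store) : Block → Basis → Basis
  | .copy s d l => copyMap (σ s) (σ d) (σ l)
  | .write v p l => writeMap (σ v) (σ p) (σ l)
  | .query o p => queryBasis x o (σ p)

/-- The program that executes a block by loops over addresses; the registers from `101` on are
scratch. -/
def Block.prog : Block → Prog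
  | .copy s d l =>
      .seq (code [.add 101 s 4, .add 102 d 4, .add 103 l 4])
        (.whileNonzero 103 (.seq (.instr (.gate (.CNOT 101 102)))
          (code [.add 101 101 3, .add 102 102 3, .sub 103 103 3])))
  | .write v p l =>
      .seq (code [.add 101 v 4, .add 102 p 4, .add 103 l 4])
        (.whileNonzero 103 (.seq (code [.half 104 101, .add 105 104 104, .sub 105 101 105])
          (.seq (.ifNonzero 105 (.instr (.gate (.X 102))) skip)
            (code [.add 101 104 4, .add 102 102 3, .sub 103 103 3]))))
  | .query o p => .instr (.gate (.query o p))

/-- All registers named by the block are below `j`. -/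
def Block.Below (j : ℕ) : Block → Prop
  | .copy s d k => s < j ∧ d < j ∧ k < j
  | .write v p k => v < j ∧ p < j ∧ k < j
  | .query _ p => p < j

/-- The addresses of the block stay below `2 ^ B`, no length exceeds `l`, and a copy goes to higher
addresses. -/
def Block.Ok (B l : ℕ) (σ : Store) : Block → Prop
  | .copy s d k => σ s + σ k ≤ σ d ∧ σ d + σ k < 2 ^ B ∧ σ k ≤ l
  | .write _ p k => σ p + σ k < 2 ^ B ∧ σ k ≤ l
  | .query _ _ => True

theorem Block.Below.mono {j j' : ℕ} {c : Block} (h : c.Below j) (hj : j ≤ j') : c.Below j' := by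
  cases c <;> simp only [Block.Below] at h ⊢ <;> omega

theorem Block.Ok.map_involutive {B l : ℕ} {σ : Store} {c : Block} (h : c.Ok B l σ) (x : Input n) :
    Function.Involutive (c.map x σ) := by
  cases c with
  | copy s d k => exact copyMap_involutive h.1
  | write v p k => exact writeMap_involutive _ _ _
  | query o p => exact queryBasis_involutive x o _

theorem Block.Below.map_congr {j : ℕ} {σ σ' : Store} {c : Block} (h : c.Below j)
    (ha : Agree j σ σ') (x : Input n) : c.map x σ' = c.map x σ := by
  cases c with
  | copy s d k => simp only [Block.map, ha s h.1, ha d h.2.1, ha k h.2.2]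
  | write v p k => simp only [Block.map, ha v h.1, ha p h.2.1, ha k h.2.2]
  | query o p => simp only [Block.map, ha p h]

theorem Block.Ok.congr {j B l : ℕ} {σ σ' : Store} {c : Block} (h : c.Ok B l σ) (hb : c.Below j)
    (ha : Agree j σ σ') : c.Ok B l σ' := by
  cases c with
  | copy s d k =>
    simp only [Block.Ok] at h ⊢
    rwa [ha s hb.1, ha d hb.2.1, ha k hb.2.2]
  | write v p k =>
    simp only [Block.Ok] at h ⊢
    rwa [ha p hb.2.1, ha k hb.2.2]
  | query o p => trivial

theorem Block.run {S : Machine n} {σ : Store} {l : ℕ} {c : Block} (hB : Bounded S.B σ)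
    (hc : Consts σ) (hb : c.Below 100) (h : c.Ok S.B l σ) :
    Run S c.prog σ (20 * l + 10) (mapOp (c.map S.x σ))
      (fun σ' => Bounded S.B σ' ∧ Agree 100 σ σ') := by
  obtain ⟨h3, h4⟩ := hc
  cases c with
  | copy s d k =>
    obtain ⟨h1, h2, h5⟩ := h
    obtain ⟨hs, hd, hk⟩ := hb
    have hss := hB s
    have hdd := hB d
    have hkk := hB k
    refine Run.mono ((Run.code hB ?_).seq_id (fun σ₁ h₁ => ?_)) (N := 7 + (σ k * 10 + 1) + 1) ?_
    · simp [FitsCode, Instr.eval, Instr.Fits, h4,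
        show d ≠ 101 by omega, show k ≠ 101 by omega, show k ≠ 102 by omega]
      omega
    · rw [Block.map, ← iter_copy _ _ _ h1]
      refine (Run.loop (N := 9) (Inv := fun i σ' => Bounded S.B σ' ∧ Agree 100 σ σ' ∧
        σ' 101 = σ s + i ∧ σ' 102 = σ d + i ∧ σ' 103 = σ k - i) ?_ ?_ ?_).post
        fun σ' h => ⟨h.1, h.2.1⟩
      · rintro i hi σ' ⟨hB', -, -, -, h⟩
        exact ⟨hB', h⟩
      · rintro i hi σ' ⟨hB', ha, g1, g2, g3⟩
        have h3' : σ' 3 = 1 := (ha 3 (by omega)).trans h3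
        have := Run.gate hB' (.CNOT 101 102)
        rw [Gate.resolve, op_CNOT, g1, g2] at this
        refine this.id_seq (N₂ := 7) ?_
        rintro _ rfl
        refine (Run.code hB' ?_).post ?_
        · simp [FitsCode, Instr.eval, Instr.Fits, h3', g1, g2]
          omega
        · rintro _ ⟨rfl, hB''⟩
          refine ⟨hB'', ((ha.update (by omega)).update (by omega)).update (by omega), ?_⟩
          simp [evalCode, Instr.eval, h3', g1, g2, g3]
          omega
      · obtain ⟨rfl, hB'⟩ := h₁
        refine ⟨hB', (((Agree.refl _ _).update (by omega)).update (by omega)).update (by omega), ?_⟩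
        simp [evalCode, Instr.eval, h4,
          show d ≠ 101 by omega, show k ≠ 101 by omega, show k ≠ 102 by omega]
    · omega
  | write v p k =>
    obtain ⟨h2, h5⟩ := h
    obtain ⟨hs, hd, hk⟩ := hb
    have hss := hB v
    have hdd := hB p
    have hkk := hB k
    refine Run.mono ((Run.code hB ?_).seq_id (fun σ₁ h₁ => ?_)) (N := 7 + (σ k * 19 + 1) + 1) ?_
    · simp [FitsCode, Instr.eval, Instr.Fits, h4,
        show p ≠ 101 by omega, show k ≠ 101 by omega, show k ≠ 102 by omega]
      omega
    · rw [Block.map, ← iter_write]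
      refine (Run.loop (N := 18) (Inv := fun i σ' => Bounded S.B σ' ∧ Agree 100 σ σ' ∧
        σ' 101 = σ v / 2 ^ i ∧ σ' 102 = σ p + i ∧ σ' 103 = σ k - i) ?_ ?_ ?_).post
        fun σ' h => ⟨h.1, h.2.1⟩
      · rintro i hi σ' ⟨hB', -, -, -, h⟩
        exact ⟨hB', h⟩
      · rintro i hi σ' ⟨hB', ha, g1, g2, g3⟩
        have h3' : σ' 3 = 1 := (ha 3 (by omega)).trans h3
        have h4' : σ' 4 = 0 := (ha 4 (by omega)).trans h4
        have hb := hB' 101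
        rw [g1] at hb
        refine Run.seq_id (Run.code hB' ?_) ?_ (N₁ := 7) (N₂ := 10)
        · simp [FitsCode, Instr.eval, Instr.Fits, g1]
          omega
        · rintro _ ⟨rfl, hB''⟩
          refine Run.id_seq (P := fun σ'' => σ'' = evalCode [.half 104 101, .add 105 104 104,
            .sub 105 101 105] σ') (Run.ifNonzero hB'' (N := 1) ?_) ?_ (N₂ := 7)
          · have e : evalCode [.half 104 101, .add 105 104 104, .sub 105 101 105] σ' 105 =
                ((σ v).testBit i).toNat := by
              simp [evalCode, Instr.eval, g1, Nat.toNat_testBit]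
              omega
            rw [e]
            cases hv : (σ v).testBit i
            · simp only [Bool.toNat_false, if_true, Bool.false_eq_true, if_false]
              rw [mapOp_id]
              exact Run.skip hB''
            · simp only [Bool.toNat_true, if_true, one_ne_zero, if_false]
              have := Run.gate hB'' (.X 102)
              rw [Gate.resolve, op_X] at this
              convert this using 3
              simp [evalCode, Instr.eval, g2]
          · rintro _ rfl
            refine (Run.code hB'' ?_).post ?_
            · simp [FitsCode, evalCode, Instr.eval, Instr.Fits, h3', h4',
                g1, g2]
              omega
            · rintro _ ⟨rfl, hB3⟩
              refine ⟨hB3, (((((ha.update (by omega)).update (by omega)).update (by omega)).update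
                (by omega)).update (by omega)).update (by omega), ?_⟩
              simp [evalCode, Instr.eval, h3', h4', g1, g2, g3,
                Nat.div_div_eq_div_mul, ← pow_succ]
              omega
      · obtain ⟨rfl, hB'⟩ := h₁
        refine ⟨hB', (((Agree.refl _ _).update (by omega)).update (by omega)).update (by omega), ?_⟩
        simp [evalCode, Instr.eval, h4,
          show p ≠ 101 by omega, show k ≠ 101 by omega, show k ≠ 102 by omega]
    · omega
  | query o p =>
    have := Run.gate hB (.query o p)
    rw [Gate.resolve, op_query] at this
    refine (this.mono (by omega)).post ?_
    rintro _ rfl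
    exact ⟨hB, Agree.refl _ _⟩

/-- The action of a list of blocks, the first one first. -/
def blocksMap (x : Input n) (σ : Store) : List Block → Basis → Basis
  | [], b => b
  | c :: l, b => blocksMap x σ l (c.map x σ b)

/-- The program that executes the blocks one after the other. -/
def blocksProg : List Block → Prog
  | [] => skip
  | c :: l => .seq c.prog (blocksProg l)

theorem blocksMap_append (x : Input n) (σ : Store) (l l' : List Block) (b : Basis) :
    blocksMap x σ (l ++ l') b = blocksMap x σ l' (blocksMap x σ l b) := by
  induction l generalizing b with
  | nil => rfl
  | cons c l ih => exact ih _

theorem blocksMap_reverse (x : Input n) {B k : ℕ} {σ : Store} {l : List Block}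
    (h : ∀ c ∈ l, c.Ok B k σ) (b : Basis) :
    blocksMap x σ l.reverse (blocksMap x σ l b) = b := by
  induction l generalizing b with
  | nil => rfl
  | cons c l ih =>
    rw [List.reverse_cons, blocksMap_append]
    simp only [blocksMap]
    rw [ih fun c' hc' => h c' (List.mem_cons_of_mem _ hc')]
    exact (h c List.mem_cons_self).map_involutive x b

theorem blocksMap_congr (x : Input n) {j : ℕ} {σ σ' : Store} {l : List Block}
    (h : ∀ c ∈ l, c.Below j) (ha : Agree j σ σ') : blocksMap x σ' l = blocksMap x σ l := by
  funext b
  induction l generalizing b with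
  | nil => rfl
  | cons c l ih =>
    simp only [blocksMap]
    rw [(h c List.mem_cons_self).map_congr ha, ih fun c' hc' => h c' (List.mem_cons_of_mem _ hc')]

theorem blocks_run {S : Machine n} {σ : Store} {k : ℕ} {l : List Block} (hB : Bounded S.B σ)
    (hc : Consts σ) (hb : ∀ c ∈ l, c.Below 100) (h : ∀ c ∈ l, c.Ok S.B k σ) :
    Run S (blocksProg l) σ (l.length * (20 * k + 11) + 1) (mapOp (blocksMap S.x σ l))
      (fun σ' => Bounded S.B σ' ∧ Agree 100 σ σ') := by
  induction l generalizing σ with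
  | nil =>
    have e : blocksMap S.x σ [] = id := rfl
    rw [e, mapOp_id]
    refine ((Run.skip hB).mono (by simp)).post ?_
    rintro _ rfl
    exact ⟨hB, Agree.refl _ _⟩
  | cons c l ih =>
    have hl : ∀ c' ∈ l, c'.Ok S.B k σ := fun c' hc' => h c' (List.mem_cons_of_mem _ hc')
    have hbl : ∀ c' ∈ l, c'.Below 100 := fun c' hc' => hb c' (List.mem_cons_of_mem _ hc')
    have e : mapOp (blocksMap S.x σ (c :: l)) =
        mapOp (blocksMap S.x σ l) ∘ₗ mapOp (c.map S.x σ) := by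
      rw [mapOp_comp]; rfl
    rw [e]
    refine ((Block.run hB hc (hb c List.mem_cons_self) (h c List.mem_cons_self)).seq
      (N₂ := l.length * (20 * k + 11) + 1) (P' := fun σ' => Bounded S.B σ' ∧ Agree 100 σ σ')
      (V := mapOp (blocksMap S.x σ l)) ?_).mono ?_
    · rintro σ' ⟨hB', ha⟩
      rw [← blocksMap_congr S.x hbl ha]
      exact (ih hB' (hc.of_agree ha (by omega)) hbl
        fun c' hc' => (hl c' hc').congr (hbl c' hc') ha).post
        fun σ'' h'' => ⟨h''.1, ha.trans h''.2⟩
    · rw [List.length_cons, Nat.add_mul]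
      omega

/-! ### Multiply controlled phases -/

/-- Qubit `a + k` receives the conjunction of qubit `a` and of `k` qubits that begin at `c`; the
partial conjunctions are kept in between. -/
def chainUp (c a : ℕ) : ℕ → Basis → Basis
  | 0, b => b
  | k + 1, b => toffoliMap (a + k) (c + k) (a + k + 1) (chainUp c a k b)

/-- The inverse of `chainUp`. -/
def chainDown (c a : ℕ) : ℕ → Basis → Basis
  | 0, b => b
  | k + 1, b => chainDown c a k (toffoliMap (a + k) (c + k) (a + k + 1) b)

theorem chainDown_chainUp (c a k : ℕ) (b : Basis) : chainDown c a k (chainUp c a k b) = b := by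
  induction k with
  | zero => rfl
  | succ k ih =>
    simp only [chainDown, chainUp]
    rw [toffoliMap_involutive, ih]

theorem chainUp_apply {c a k : ℕ} {b : Basis} (hc : c + k ≤ a) (ha : b a = true)
    (h0 : ∀ q, a < q → b q = false) :
    (∀ q, q < a → chainUp c a k b q = b q) ∧ (∀ q, a + k < q → chainUp c a k b q = false) ∧
      (chainUp c a k b (a + k) = true ↔ ∀ i < k, b (c + i) = true) := by
  induction k with
  | zero => exact ⟨fun q _ => rfl, fun q hq => h0 q (by omega), by simpa [chainUp] using ha⟩
  | succ k ih =>
    obtain ⟨h1, h2, h3⟩ := ih (by omega)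
    simp only [chainUp, toffoliMap]
    rw [if_neg (by omega)]
    refine ⟨fun q hq => ?_, fun q hq => ?_, ?_⟩
    · rw [Function.update_of_ne (by omega), h1 q hq]
    · rw [Function.update_of_ne (by omega), h2 q (by omega)]
    · rw [show a + (k + 1) = a + k + 1 by omega, Function.update_self, h2 _ (by omega),
        h1 (c + k) (by omega), Bool.false_xor, Bool.and_eq_true, h3]
      constructor
      · rintro ⟨g1, g2⟩ i hi
        rcases Nat.lt_succ_iff_lt_or_eq.1 hi with hi | rfl
        · exact g1 i hi
        · exact g2
      · exact fun g => ⟨fun i hi => g i (by omega), g k (by omega)⟩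

theorem iter_chainUp (c a k : ℕ) :
    iter (fun i => mapOp (toffoliMap (a + i) (c + i) (a + i + 1))) 0 k =
      mapOp (chainUp c a k) := by
  induction k with
  | zero => exact mapOp_id.symm
  | succ k ih =>
    rw [iter_succ, ih, mapOp_comp, Nat.zero_add]
    rfl

theorem iterDown_chainDown (c a k : ℕ) :
    iterDown (fun i => mapOp (toffoliMap (a + i) (c + i) (a + i + 1))) k =
      mapOp (chainDown c a k) := by
  induction k with
  | zero => exact mapOp_id.symm
  | succ k ih =>
    rw [iterDown, ih, mapOp_comp]
    rfl

/-- The phase gate `diag (1, -1)`. -/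
noncomputable def gateZ (q : ℕ) : QState →ₗ[ℂ] QState := diagOp fun b => if b q then -1 else 1

theorem op_T_four (x : Input n) (q : ℕ) :
    (Gate.T q).op x ∘ₗ (Gate.T q).op x ∘ₗ (Gate.T q).op x ∘ₗ (Gate.T q).op x = gateZ q := by
  rw [op_T, gateZ]
  refine Finsupp.lhom_ext fun b z => ?_
  simp only [LinearMap.comp_apply, diagOp_single]
  congr 1
  split_ifs
  · have h : Complex.exp (Complex.I * Real.pi / 4) ^ 4 = -1 := by
      rw [← Complex.exp_nat_mul, ← Complex.exp_pi_mul_I]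
      congr 1
      push_cast
      ring
    linear_combination z * h
  · ring

/-- The operator that inverts the sign where all of the `l` qubits that begin at `c` are `1`; the
qubits from `a` on are auxiliary. -/
noncomputable def mczOp (c l a : ℕ) : QState →ₗ[ℂ] QState :=
  mapOp (flip a) ∘ₗ mapOp (chainDown c a l) ∘ₗ gateZ (a + l) ∘ₗ mapOp (chainUp c a l) ∘ₗ
    mapOp (flip a)

open Classical in
theorem mczOp_single {c l a : ℕ} (hc : c + l ≤ a) {b : Basis} (hb : ∀ q, a ≤ q → b q = false) :
    mczOp c l a (Finsupp.single b 1) =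
      Finsupp.single b (if ∀ i < l, b (c + i) = true then -1 else 1) := by
  have h := (chainUp_apply (b := flip a b) hc (by simp [hb a le_rfl]) fun q hq => by
    rw [flip_of_ne (by omega), hb q (by omega)]).2.2
  have h' : (∀ i < l, flip a b (c + i) = true) ↔ ∀ i < l, b (c + i) = true :=
    forall₂_congr fun i hi => by rw [flip_of_ne (by omega)]
  rw [h'] at h
  simp only [mczOp, LinearMap.comp_apply, mapOp_single, gateZ, diagOp_single, chainDown_chainUp,
    flip_flip, one_mul, h]

/-- Invert the sign where all of the qubits in a range are `1`. The registers `rc` and `rl` hold the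
begin and the length of the range, and `ra` the place of the auxiliary qubits: the conjunction is
computed by a chain of Toffoli gates, the phase `-1` is `T ^ 4`, and the chain is undone. -/
def mczProg (rc rl ra : ℕ) : Prog :=
  .seq (code [.add 101 ra 4, .add 102 rc 4, .add 103 rl 4, .add 104 ra 3]) <|
  .seq (.instr (.gate (.X 101))) <|
  .seq (.whileNonzero 103 (.seq (.instr (.gate (.Toffoli 101 102 104)))
    (code [.add 101 101 3, .add 102 102 3, .add 104 104 3, .sub 103 103 3]))) <|
  .seq (.seq (.instr (.gate (.T 101))) (.seq (.instr (.gate (.T 101)))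
    (.seq (.instr (.gate (.T 101))) (.instr (.gate (.T 101)))))) <|
  .seq (code [.add 103 rl 4]) <|
  .seq (.whileNonzero 103 (.seq (code [.sub 101 101 3, .sub 102 102 3, .sub 104 104 3,
    .sub 103 103 3]) (.instr (.gate (.Toffoli 101 102 104))))) <|
  .instr (.gate (.X 101))

theorem mczProg_run {S : Machine n} {σ : Store} {rc rl ra c k a l : ℕ} (hB : Bounded S.B σ)
    (hσ : Consts σ) (h1 : rc < 100) (h2 : rl < 100) (h3 : ra < 100) (hc : σ rc = c) (hk : σ rl = k)
    (ha : σ ra = a) (hl : k ≤ l) (hca : c + k ≤ a) (haB : a + k + 1 < 2 ^ S.B) :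
    Run S (mczProg rc rl ra) σ (24 * l + 40) (mczOp c k a)
      (fun σ' => Bounded S.B σ' ∧ Agree 100 σ σ') := by
  obtain ⟨hσ3, hσ4⟩ := hσ
  have hloop : k * 12 + 1 ≤ l * 12 + 1 := by omega
  refine Run.mono (N := 9 + (1 + ((k * (11 + 1) + 1) + (7 + (3 + ((k * (11 + 1) + 1) + 1 + 1) + 1)
    + 1) + 1) + 1) + 1) ?_ (by omega)
  refine (Run.code hB ?_).seq_id fun σ₁ hσ₁ => ?_
  · simp [FitsCode, Instr.eval, Instr.Fits, hσ4, hσ3,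
      show rc ≠ 101 by omega, show rl ≠ 101 by omega, show rl ≠ 102 by omega,
      show ra ≠ 101 by omega, show ra ≠ 102 by omega, show ra ≠ 103 by omega, ha, hk, hc]
    omega
  have hag : Agree 100 σ σ₁ := by
    obtain ⟨rfl, -⟩ := hσ₁
    exact ((((Agree.refl _ _).update (by omega)).update (by omega)).update (by omega)).update
      (by omega)
  have hval : σ₁ 101 = a ∧ σ₁ 102 = c ∧ σ₁ 103 = k ∧ σ₁ 104 = a + 1 := by
    obtain ⟨rfl, -⟩ := hσ₁
    simp [evalCode, Instr.eval, hσ4, hσ3,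
      show rc ≠ 101 by omega, show rl ≠ 101 by omega, show rl ≠ 102 by omega,
      show ra ≠ 101 by omega, show ra ≠ 102 by omega, show ra ≠ 103 by omega, ha, hk, hc]
  have hB₁ := hσ₁.2
  clear hσ₁
  have hX := Run.gate hB₁ (.X 101)
  rw [Gate.resolve, op_X, hval.1] at hX
  refine Run.seq (U := mapOp (flip a)) (V := mapOp (flip a) ∘ₗ mapOp (chainDown c a k) ∘ₗ
    gateZ (a + k) ∘ₗ mapOp (chainUp c a k)) hX ?_
  rintro _ rfl
  refine Run.seq (U := mapOp (chainUp c a k)) (V := mapOp (flip a) ∘ₗ mapOp (chainDown c a k) ∘ₗ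
    gateZ (a + k)) (P := fun σ' => Bounded S.B σ' ∧ Agree 100 σ σ' ∧ σ' 101 = a + k ∧
      σ' 102 = c + k ∧ σ' 104 = a + k + 1 ∧ σ' 103 = k - k) ?_ ?_
  · rw [← iter_chainUp]
    refine Run.loop (Inv := fun i σ' => Bounded S.B σ' ∧ Agree 100 σ σ' ∧ σ' 101 = a + i ∧
      σ' 102 = c + i ∧ σ' 104 = a + i + 1 ∧ σ' 103 = k - i) ?_ ?_ ?_
    · rintro i hi σ' ⟨hB', -, -, -, -, h⟩
      exact ⟨hB', h⟩
    · rintro i hi σ' ⟨hB', ha', g1, g2, g4, g3⟩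
      have h3' : σ' 3 = 1 := (ha' 3 (by omega)).trans hσ3
      have := Run.gate hB' (.Toffoli 101 102 104)
      rw [Gate.resolve, op_Toffoli, g1, g2, g4] at this
      refine this.id_seq (N₂ := 9) ?_
      rintro _ rfl
      refine (Run.code hB' ?_).post ?_
      · simp [FitsCode, Instr.eval, Instr.Fits, h3', g1, g2, g4]
        omega
      · rintro _ ⟨rfl, hB''⟩
        refine ⟨hB'', (((ha'.update (by omega)).update (by omega)).update (by omega)).update
          (by omega), ?_⟩
        simp [evalCode, Instr.eval, h3', g1, g2, g3, g4]
        omega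
    · exact ⟨hB₁, hag, hval.1, hval.2.1, hval.2.2.2, hval.2.2.1⟩
  rintro σ₂ ⟨hB₂, ha₂, g1, g2, g4, -⟩
  refine Run.seq (U := gateZ (a + k)) (V := mapOp (flip a) ∘ₗ mapOp (chainDown c a k))
    (P := fun σ' => σ' = σ₂) ?_ ?_
  · have hT := Run.gate hB₂ (.T 101)
    rw [Gate.resolve, g1] at hT
    rw [← op_T_four S.x]
    refine hT.seq (N₂ := 5) (V := (Gate.T (a + k)).op S.x ∘ₗ (Gate.T (a + k)).op S.x ∘ₗ
      (Gate.T (a + k)).op S.x) ?_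
    rintro _ rfl
    refine hT.seq (N₂ := 3) (V := (Gate.T (a + k)).op S.x ∘ₗ (Gate.T (a + k)).op S.x) ?_
    rintro _ rfl
    refine hT.seq (N₂ := 1) ?_
    rintro _ rfl
    exact hT
  rintro _ rfl
  rename_i σ₂
  have hrl := ha₂ rl h2
  have h4₂ := (ha₂ 4 (by omega)).trans hσ4
  refine (Run.code hB₂ ?_).seq_id fun σ₃ hσ₃ => ?_
  · have := hB₂ rl
    simpa [FitsCode, Instr.eval, Instr.Fits, h4₂] using this
  refine Run.seq (N₁ := k * (11 + 1) + 1) (N₂ := 1) (U := mapOp (chainDown c a k))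
    (V := mapOp (flip a)) (P := fun σ' =>
    Bounded S.B σ' ∧ Agree 100 σ σ' ∧ σ' 101 = a + (k - k) ∧
      σ' 102 = c + (k - k) ∧ σ' 104 = a + (k - k) + 1 ∧ σ' 103 = k - k) ?_ ?_
  · rw [← iterDown_chainDown, ← iter_eq_iterDown _ 0 k k (by omega)]
    refine Run.loop (Inv := fun i σ' => Bounded S.B σ' ∧ Agree 100 σ σ' ∧ σ' 101 = a + (k - i) ∧
      σ' 102 = c + (k - i) ∧ σ' 104 = a + (k - i) + 1 ∧ σ' 103 = k - i) ?_ ?_ ?_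
    · rintro i hi σ' ⟨hB', -, -, -, -, h⟩
      exact ⟨hB', h⟩
    · rintro i hi σ' ⟨hB', ha', g1, g2, g4, g3⟩
      have h3' : σ' 3 = 1 := (ha' 3 (by omega)).trans hσ3
      refine (Run.code hB' ?_).seq_id (N₂ := 1) ?_
      · simp [FitsCode, Instr.Fits]
      · rintro _ ⟨rfl, hB''⟩
        have := Run.gate hB'' (.Toffoli 101 102 104)
        have e : (evalCode [.sub 101 101 3, .sub 102 102 3, .sub 104 104 3, .sub 103 103 3] σ' 101 =
            a + (k - 1 - i)) ∧ (evalCode [.sub 101 101 3, .sub 102 102 3, .sub 104 104 3,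
              .sub 103 103 3] σ' 102 = c + (k - 1 - i)) ∧ (evalCode [.sub 101 101 3,
              .sub 102 102 3, .sub 104 104 3, .sub 103 103 3] σ' 104 = a + (k - 1 - i) + 1) ∧
              evalCode [.sub 101 101 3, .sub 102 102 3, .sub 104 104 3, .sub 103 103 3] σ' 103 =
                k - (i + 1) := by
          simp [evalCode, Instr.eval, h3', g1, g2, g3, g4]
          omega
        rw [Gate.resolve, op_Toffoli, e.1, e.2.1, e.2.2.1] at this
        refine this.post ?_
        rintro _ rfl
        refine ⟨hB'', (((ha'.update (by omega)).update (by omega)).update (by omega)).update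
          (by omega), ?_⟩
        rw [e.1, e.2.1, e.2.2.1, e.2.2.2]
        omega
    · obtain ⟨rfl, hB₃⟩ := hσ₃
      refine ⟨hB₃, ha₂.update (by omega), ?_⟩
      simp [evalCode, Instr.eval, h4₂, g1, g2, g4, hrl, hk]
  rintro σ₄ ⟨hB₄, ha₄, g1, g2, g4, -⟩
  have := Run.gate hB₄ (.X 101)
  rw [Gate.resolve, op_X, g1, Nat.sub_self, Nat.add_zero] at this
  refine this.post ?_
  rintro _ rfl
  exact ⟨hB₄, ha₄⟩

/-- The phase `-1` on those basis states on which a circuit makes the condition qubits true. -/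
def phaseProg (bs : List Block) (rc rl ra : ℕ) : Prog :=
  .seq (blocksProg bs) (.seq (mczProg rc rl ra) (blocksProg bs.reverse))

/-- The operator of `phaseProg`; the condition qubits are the `l` qubits that begin at `c`, and the
qubits from `a` on are auxiliary. -/
noncomputable def phaseOp (x : Input n) (σ : Store) (bs : List Block) (c l a : ℕ) :
    QState →ₗ[ℂ] QState :=
  mapOp (blocksMap x σ bs.reverse) ∘ₗ mczOp c l a ∘ₗ mapOp (blocksMap x σ bs)

open Classical in
theorem phaseOp_single (x : Input n) {σ : Store} {bs : List Block} {c l a B k : ℕ}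
    (h : ∀ d ∈ bs, d.Ok B k σ) (hc : c + l ≤ a) {b : Basis}
    (hb : ∀ q, a ≤ q → blocksMap x σ bs b q = false) :
    phaseOp x σ bs c l a (Finsupp.single b 1) = Finsupp.single b
      (if ∀ i < l, blocksMap x σ bs b (c + i) = true then -1 else 1) := by
  simp only [phaseOp, LinearMap.comp_apply, mapOp_single]
  rw [mczOp_single hc hb, mapOp_single, blocksMap_reverse x h]

theorem phaseProg_run {S : Machine n} {σ : Store} {bs : List Block} {rc rl ra c k a l : ℕ}
    (hB : Bounded S.B σ) (hσ : Consts σ) (hb : ∀ d ∈ bs, d.Below 100)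
    (hbs : ∀ d ∈ bs, d.Ok S.B l σ)
    (h1 : rc < 100) (h2 : rl < 100) (h3 : ra < 100) (hc : σ rc = c) (hk : σ rl = k)
    (ha : σ ra = a) (hl : k ≤ l) (hca : c + k ≤ a) (haB : a + k + 1 < 2 ^ S.B) :
    Run S (phaseProg bs rc rl ra) σ ((2 * bs.length + 2) * (20 * l + 11) + 30)
      (phaseOp S.x σ bs c k a) (fun σ' => Bounded S.B σ' ∧ Agree 100 σ σ') := by
  refine ((blocks_run hB hσ hb hbs).seq (N₂ := 24 * l + 40 + (bs.length * (20 * l + 11) + 1) + 1)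
    (V := mapOp (blocksMap S.x σ bs.reverse) ∘ₗ mczOp c k a) ?_).mono ?_
  · rintro σ₁ ⟨hB₁, ha₁⟩
    refine (mczProg_run hB₁ (hσ.of_agree ha₁ (by omega)) h1 h2 h3 ((ha₁ _ h1).trans hc)
      ((ha₁ _ h2).trans hk) ((ha₁ _ h3).trans ha) hl hca haB).seq ?_
    rintro σ₂ ⟨hB₂, ha₂⟩
    have ha₂ := ha₁.trans ha₂
    have hr : ∀ d ∈ bs.reverse, d.Ok S.B l σ := fun d hd => hbs d (List.mem_reverse.1 hd)
    have hbr : ∀ d ∈ bs.reverse, d.Below 100 := fun d hd => hb d (List.mem_reverse.1 hd)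
    have := blocks_run (l := bs.reverse) hB₂ (hσ.of_agree ha₂ (by omega)) hbr
      fun d hd => (hr d hd).congr (hbr d hd) ha₂
    rw [blocksMap_congr S.x hbr ha₂, List.length_reverse] at this
    exact this.post fun σ' h => ⟨h.1, ha₂.trans h.2⟩
  · ring_nf
    omega

/-! ### Hadamard gates and measurements on many qubits -/

/-- Hadamard gates on the qubits below the number in register `r`, from below. -/
def hadamardUp (r : ℕ) : Prog :=
  .seq (code [.add 101 4 4, .add 103 r 4]) (.whileNonzero 103
    (.seq (.instr (.gate (.H 101))) (code [.add 101 101 3, .sub 103 103 3])))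

/-- Hadamard gates on the qubits below the number in register `r`, from above. -/
def hadamardDown (r : ℕ) : Prog :=
  .seq (code [.add 101 r 4]) (.whileNonzero 101
    (.seq (code [.sub 101 101 3]) (.instr (.gate (.H 101)))))

theorem hadamardUp_run {S : Machine n} {σ : Store} {r m l : ℕ} (hB : Bounded S.B σ)
    (hσ : Consts σ) (hr : r < 100) (hm : σ r = m) (hl : m ≤ l) :
    Run S (hadamardUp r) σ (20 * l + 10) (iter hadamard 0 m)
      (fun σ' => Bounded S.B σ' ∧ Agree 100 σ σ') := by
  obtain ⟨hσ3, hσ4⟩ := hσ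
  have hmB := hB r
  refine Run.mono (N := 5 + (m * (7 + 1) + 1) + 1) ?_ (by omega)
  refine (Run.code hB ?_).seq_id ?_
  · simp [FitsCode, Instr.eval, Instr.Fits, hσ4, show r ≠ 101 by omega]
    omega
  · rintro _ ⟨rfl, hB₁⟩
    refine (Run.loop (Inv := fun i σ' => Bounded S.B σ' ∧ Agree 100 σ σ' ∧ σ' 101 = i ∧
      σ' 103 = m - i) ?_ ?_ ?_).post fun σ' h => ⟨h.1, h.2.1⟩
    · rintro i hi σ' ⟨hB', -, -, h⟩
      exact ⟨hB', h⟩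
    · rintro i hi σ' ⟨hB', ha', g1, g3⟩
      have h3' : σ' 3 = 1 := (ha' 3 (by omega)).trans hσ3
      have := Run.gate hB' (.H 101)
      rw [Gate.resolve, op_H, g1] at this
      refine this.id_seq (N₂ := 5) ?_
      rintro _ rfl
      refine (Run.code hB' ?_).post ?_
      · simp [FitsCode, Instr.Fits, h3', g1]
        omega
      · rintro _ ⟨rfl, hB''⟩
        refine ⟨hB'', (ha'.update (by omega)).update (by omega), ?_⟩
        simp [evalCode, Instr.eval, h3', g1, g3]
        omega
    · refine ⟨hB₁, ((Agree.refl _ _).update (by omega)).update (by omega), ?_⟩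
      simp [evalCode, Instr.eval, hσ4, show r ≠ 101 by omega, hm]

theorem hadamardDown_run {S : Machine n} {σ : Store} {r m l : ℕ} (hB : Bounded S.B σ)
    (hσ : Consts σ) (hm : σ r = m) (hl : m ≤ l) :
    Run S (hadamardDown r) σ (20 * l + 10) (iterDown hadamard m)
      (fun σ' => Bounded S.B σ' ∧ Agree 100 σ σ') := by
  obtain ⟨hσ3, hσ4⟩ := hσ
  have hmB := hB r
  refine Run.mono (N := 3 + (m * (5 + 1) + 1) + 1) ?_ (by omega)
  refine (Run.code hB ?_).seq_id ?_
  · simpa [FitsCode, Instr.eval, Instr.Fits, hσ4] using hmB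
  · rintro _ ⟨rfl, hB₁⟩
    rw [← iter_eq_iterDown _ 0 m m (by omega)]
    refine (Run.loop (Inv := fun i σ' => Bounded S.B σ' ∧ Agree 100 σ σ' ∧ σ' 101 = m - i)
      ?_ ?_ ?_).post fun σ' h => ⟨h.1, h.2.1⟩
    · rintro i hi σ' ⟨hB', -, h⟩
      exact ⟨hB', h⟩
    · rintro i hi σ' ⟨hB', ha', g1⟩
      have h3' : σ' 3 = 1 := (ha' 3 (by omega)).trans hσ3
      refine (Run.code hB' ?_).seq_id (N₂ := 1) ?_
      · simp [FitsCode, Instr.Fits]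
      · rintro _ ⟨rfl, hB''⟩
        have := Run.gate hB'' (.H 101)
        have e : evalCode [.sub 101 101 3] σ' 101 = m - 1 - i := by
          simp [evalCode, Instr.eval, h3', g1]
          omega
        rw [Gate.resolve, op_H, e] at this
        refine this.post ?_
        rintro _ rfl
        exact ⟨hB'', ha'.update (by omega), by rw [e]; omega⟩
    · exact ⟨hB₁, (Agree.refl _ _).update (by omega), by simp [evalCode, Instr.eval, hσ4, hm]⟩

/-- Measure as many qubits as register `rl` says, beginning at the address in register `rp`, and
store the number in register `ry`. -/
def measureProg (rp rl ry : ℕ) : Prog :=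
  .seq (code [.add 101 rp rl, .add 103 rl 4, .add ry 4 4]) (.whileNonzero 103
    (.seq (code [.sub 101 101 3, .sub 103 103 3, .add ry ry ry])
      (.seq (.instr (.measure 102 101)) (code [.add ry ry 102]))))

theorem readBits_succ (b : Basis) (p l : ℕ) :
    readBits b p (l + 1) = (b p).toNat + 2 * readBits b (p + 1) l := by
  unfold readBits
  rw [Finset.sum_range_succ', Finset.mul_sum, add_comm]
  congr 1
  · simp
  · refine Finset.sum_congr rfl fun i _ => ?_
    rw [show p + (i + 1) = p + 1 + i by omega, pow_succ]
    ring

/-- Measuring `k` qubits splits the state according to the measured number, so the sum of the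
contributions of the basis states, each with the value of `g` at its number, is not changed. -/
theorem measureProg_expect {S : Machine n} {σ : Store} {ψ : QState} {rp rl ry p k l : ℕ}
    (hB : Bounded S.B σ) (hσ : Consts σ) (h2 : rl < 100) (h3 : ry < 100) (h5 : 4 < ry)
    (hp : σ rp = p) (hk : σ rl = k) (hl : k ≤ l) (hpB : p + k < 2 ^ S.B) (hkB : k ≤ S.B) (g : ℕ → ℝ) :
    Expect S (measureProg rp rl ry) σ ψ (20 * l + 10)
      (fun σ' ψ' => g (σ' ry) * weight ψ')
      (ψ.sum fun b z => g (readBits b p k) * ‖z‖ ^ 2)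
      (fun σ' ψ' => Bounded S.B σ' ∧ (∀ r < 100, r ≠ ry → σ' r = σ r) ∧ σ' ry < 2 ^ k ∧
        ψ'.support ⊆ ψ.support ∧ ∀ b ∈ ψ'.support, readBits b p k = σ' ry) := by
  classical
  obtain ⟨hσ3, hσ4⟩ := hσ
  have hkB' := hB rl
  refine Expect.mono (N := 7 + (k * (7 + (1 + 3 + 1) + 1 + 1) + 1) + 1) (e := ψ.sum fun b z =>
    g (readBits b p k) * ‖z‖ ^ 2) (F := fun _ ψ' => ψ'.sum fun b z => g (readBits b p k) * ‖z‖ ^ 2)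
    (Q := fun σ' ψ' => Bounded S.B σ' ∧ (∀ r < 100, r ≠ ry → σ' r = σ r) ∧ σ' ry < 2 ^ k ∧
        ψ'.support ⊆ ψ.support ∧ (∀ b ∈ ψ'.support, readBits b (p + (k - k)) k = σ' ry) ∧
        σ' 101 = p + (k - k) ∧ σ' 103 = k - k) ?_ (by omega) le_rfl ?_
  · refine (Run.code hB ?_).seq_expect ?_
    · simp [FitsCode, Instr.eval, Instr.Fits, hσ4, show rl ≠ 101 by omega, hp, hk]
      omega
    rintro _ ⟨rfl, hB₁⟩
    refine Expect.loop (F := fun _ _ ψ' => ψ'.sum fun b z => g (readBits b p k) * ‖z‖ ^ 2)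
      (Inv := fun i σ' ψ' => Bounded S.B σ' ∧ (∀ r < 100, r ≠ ry → σ' r = σ r) ∧
        σ' ry < 2 ^ i ∧ ψ'.support ⊆ ψ.support ∧
        (∀ b ∈ ψ'.support, readBits b (p + (k - i)) i = σ' ry) ∧
        σ' 101 = p + (k - i) ∧ σ' 103 = k - i) ?_ ?_ ?_
    · rintro i hi σ' ψ' h
      exact ⟨h.1, h.2.2.2.2.2.2⟩
    · rintro i hi σ' ψ' ⟨hB', ha', hy, hsup, hread, g1, g3⟩
      have h3' : σ' 3 = 1 := (ha' 3 (by omega) (by omega)).trans hσ3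
      have hpow : 2 ^ (i + 1) ≤ 2 ^ S.B := Nat.pow_le_pow_right (by omega) (by omega)
      rw [pow_succ] at hpow
      refine (Run.code hB' ?_).seq_expect ?_
      · simp [FitsCode, Instr.eval, Instr.Fits, show ry ≠ 103 by omega, show ry ≠ 101 by omega]
        omega
      rintro σ₁ ⟨hσ₁, hB₂⟩
      have e1 : σ₁ 101 = p + (k - (i + 1)) := by
        rw [hσ₁]; simp [evalCode, Instr.eval, h3', g1, show (101 : ℕ) ≠ ry by omega]; omega
      have e2 : σ₁ 103 = k - (i + 1) := by
        rw [hσ₁]; simp [evalCode, Instr.eval, h3', g3, show (103 : ℕ) ≠ ry by omega]; omega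
      have e3 : σ₁ ry = 2 * σ' ry := by
        rw [hσ₁]
        simp [evalCode, Instr.eval, show ry ≠ 103 by omega, show ry ≠ 101 by omega]
        omega
      have e4 : ∀ r < 100, r ≠ ry → σ₁ r = σ r := by
        intro r hr hr'
        rw [hσ₁, ← ha' r hr hr']
        simp [evalCode, Instr.eval, hr', show r ≠ 103 by omega, show r ≠ 101 by omega]
      clear hσ₁
      -- the branch on which the measured qubit is `v`
      have hread' : ∀ v : Bool, ∀ b ∈ (ψ'.filter fun b => b (σ₁ 101) = v).support,
          readBits b (p + (k - (i + 1))) (i + 1) = 2 * σ' ry + v.toNat := by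
        intro v b hb
        rw [Finsupp.support_filter, Finset.mem_filter] at hb
        rw [readBits_succ, ← e1, hb.2, e1, show p + (k - (i + 1)) + 1 = p + (k - i) by omega,
          hread b hb.1]
        omega
      have hsup' : ∀ v : Bool, (ψ'.filter fun b => b (σ₁ 101) = v).support ⊆ ψ.support := by
        intro v
        rw [Finsupp.support_filter]
        exact (Finset.filter_subset _ _).trans hsup
      rw [LinearMap.id_apply]
      refine (Expect.measure (Q := fun σ₂ ψ₂ => Bounded S.B σ₂ ∧ (∀ r, r ≠ 102 → σ₂ r = σ₁ r) ∧
        σ₂ 102 ≤ 1 ∧ ψ₂.support ⊆ ψ.support ∧ (∀ b ∈ ψ₂.support,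
          readBits b (p + (k - (i + 1))) (i + 1) = 2 * σ' ry + σ₂ 102))
        (F := fun _ ψ' => ψ'.sum fun b z => g (readBits b p k) * ‖z‖ ^ 2) hB₂ ?_ ?_ ?_).seq
        (N₂ := 3) ?_
      · exact ⟨hB₂.update (by positivity), fun r hr => Function.update_of_ne hr _ _, by simp,
          hsup' false, by simpa using hread' false⟩
      · exact ⟨hB₂.update (by omega), fun r hr => Function.update_of_ne hr _ _, by simp,
          hsup' true, by simpa using hread' true⟩
      · exact (sum_filter_add ψ' _ _).le
      · rintro σ₂ ψ₂ ⟨hB₃, f1, f2, f3, f4⟩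
        have f5 : σ₂ ry = 2 * σ' ry := by rw [f1 ry (by omega), e3]
        refine (Run.code hB₃ ?_).expect ?_
        · simp [FitsCode, Instr.Fits, f5]
          omega
        · rintro σ₃ ⟨rfl, hB₄⟩
          refine ⟨⟨hB₄, fun r hr hr' => ?_, ?_, f3, ?_, ?_, ?_⟩, le_rfl⟩
          · simp [evalCode, Instr.eval, hr']
            rw [f1 r (by omega), e4 r hr hr']
          · simp [evalCode, Instr.eval, f5]
            rw [pow_succ]; omega
          · intro b hb
            rw [f4 b hb]
            simp [evalCode, Instr.eval, f5]
          · simp [evalCode, Instr.eval, show (101 : ℕ) ≠ ry by omega]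
            rw [f1 101 (by omega), e1]
          · simp [evalCode, Instr.eval, show (103 : ℕ) ≠ ry by omega]
            rw [f1 103 (by omega), e2]
    · refine ⟨hB₁, fun r hr hr' => ?_, ?_, subset_rfl, ?_, ?_, ?_⟩
      · simp [evalCode, Instr.eval, hr', show r ≠ 103 by omega, show r ≠ 101 by omega]
      · simp [evalCode, Instr.eval, hσ4]
      · simp [evalCode, Instr.eval, hσ4, readBits]
      · simp [evalCode, Instr.eval, hσ4, hp, hk, show (101 : ℕ) ≠ ry by omega]
      · simp [evalCode, Instr.eval, hσ4, hk, show (103 : ℕ) ≠ ry by omega,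
          show rl ≠ 101 by omega]
  · rintro σ' ψ' ⟨q1, q2, q3, q4, q5, -⟩
    simp only [Nat.sub_self, Nat.add_zero] at q5
    refine ⟨⟨q1, q2, q3, q4, q5⟩, le_of_eq ?_⟩
    rw [weight, Finsupp.sum, Finsupp.sum, Finset.mul_sum]
    exact Finset.sum_congr rfl fun b hb => by rw [q5 b hb]

/-! ### Numbers in quantum registers -/

theorem readBits_lt (b : Basis) (p w : ℕ) : readBits b p w < 2 ^ w := by
  induction w generalizing p with
  | zero => simp [readBits]
  | succ w ih =>
    have := ih (p + 1)
    rw [readBits_succ, pow_succ]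
    cases b p <;> simp <;> omega

theorem testBit_readBits (b : Basis) (p w i : ℕ) (hi : i < w) :
    (readBits b p w).testBit i = b (p + i) := by
  induction w generalizing p i with
  | zero => omega
  | succ w ih =>
    rw [readBits_succ]
    cases i with
    | zero => cases b p <;> simp [Nat.testBit_zero]
    | succ i =>
      have : ((b p).toNat + 2 * readBits b (p + 1) w) / 2 = readBits b (p + 1) w := by
        have := Bool.toNat_lt (b p)
        omega
      rw [Nat.testBit_succ, this, ih _ _ (by omega)]
      congr 1
      omega

theorem readBits_eq {b : Basis} {p w v : ℕ} (h : ∀ i < w, b (p + i) = v.testBit i)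
    (hv : v < 2 ^ w) : readBits b p w = v := by
  refine Nat.eq_of_testBit_eq fun i => ?_
  by_cases hi : i < w
  · rw [testBit_readBits _ _ _ _ hi, h i hi]
  · have hp : 2 ^ w ≤ 2 ^ i := Nat.pow_le_pow_right (by omega) (by omega)
    rw [Nat.testBit_eq_false_of_lt (hv.trans_le hp),
      Nat.testBit_eq_false_of_lt ((readBits_lt b p w).trans_le hp)]

theorem readBits_testBit {m y : ℕ} (hy : y < 2 ^ m) : readBits (Nat.testBit y) 0 m = y :=
  readBits_eq (fun i _ => by rw [Nat.zero_add]) hy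

theorem testBit_of_le {m y q : ℕ} (hy : y < 2 ^ m) (hq : m ≤ q) : y.testBit q = false :=
  Nat.testBit_eq_false_of_lt (hy.trans_le (Nat.pow_le_pow_right (by omega) hq))

theorem testBit_injective : Function.Injective (Nat.testBit : ℕ → Basis) :=
  fun _ _ h => Nat.eq_of_testBit_eq fun i => congrFun h i

theorem eq_testBit_readBits {b : Basis} {m : ℕ} (hb : ∀ q, m ≤ q → b q = false) :
    b = Nat.testBit (readBits b 0 m) := by
  funext q
  by_cases hq : q < m
  · rw [testBit_readBits _ _ _ _ hq, Nat.zero_add]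
  · rw [hb q (by omega), testBit_of_le (readBits_lt b 0 m) (by omega)]

/-! ### The state space of a quantum search -/

/-- The superposition of the numbers below `2 ^ m` with amplitudes `φ`; all qubits from `m` on
are `0`. -/
noncomputable def superpos (m : ℕ) (φ : ℕ → ℂ) : QState :=
  ∑ y ∈ Finset.range (2 ^ m), Finsupp.single (Nat.testBit y) (φ y)

theorem superpos_sum (m : ℕ) (φ : ℕ → ℂ) (g : ℕ → ℝ) :
    (superpos m φ).sum (fun b z => g (readBits b 0 m) * ‖z‖ ^ 2) =
      ∑ y ∈ Finset.range (2 ^ m), g y * ‖φ y‖ ^ 2 := by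
  classical
  have hval : ∀ y ∈ Finset.range (2 ^ m), superpos m φ (Nat.testBit y) = φ y := by
    intro y hy
    rw [superpos, Finset.sum_apply', Finset.sum_eq_single y]
    · simp
    · intro z _ hz
      exact Finsupp.single_eq_of_ne fun h => hz (testBit_injective h).symm
    · exact fun h => (h hy).elim
  have hsupp : (superpos m φ).support ⊆ (Finset.range (2 ^ m)).image Nat.testBit := by
    refine (Finsupp.support_finsetSum).trans ?_
    intro b hb
    obtain ⟨y, hy, hb⟩ := Finset.mem_biUnion.1 hb
    have := Finsupp.support_single_subset hb
    rw [Finset.mem_singleton] at this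
    exact Finset.mem_image.2 ⟨y, hy, this.symm⟩
  rw [Finsupp.sum_of_support_subset _ hsupp _ (by simp),
    Finset.sum_image (testBit_injective.injOn)]
  refine Finset.sum_congr rfl fun y hy => ?_
  rw [hval y hy, readBits_testBit (Finset.mem_range.1 hy)]

theorem smul_superpos (m : ℕ) (φ : ℕ → ℂ) (α : ℂ) :
    α • superpos m φ = superpos m fun y => α * φ y := by
  simp [superpos, Finset.smul_sum]

theorem superpos_support {m : ℕ} {φ : ℕ → ℂ} {b : Basis} (hb : b ∈ (superpos m φ).support) :
    ∀ q, m ≤ q → b q = false := by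
  classical
  obtain ⟨y, hy, hb⟩ := Finset.mem_biUnion.1 (Finsupp.support_finsetSum hb)
  have := Finsupp.support_single_subset hb
  rw [Finset.mem_singleton] at this
  subst this
  exact fun q hq => testBit_of_le (Finset.mem_range.1 hy) hq

theorem linear_superpos (U : QState →ₗ[ℂ] QState) (m : ℕ) (φ : ℕ → ℂ) :
    U (superpos m φ) = ∑ y ∈ Finset.range (2 ^ m), φ y • U (Finsupp.single (Nat.testBit y) 1) := by
  rw [superpos, map_sum]
  refine Finset.sum_congr rfl fun y _ => ?_
  rw [← map_smul, Finsupp.smul_single, smul_eq_mul, mul_one]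

theorem testBit_two_pow_add {m y : ℕ} (hy : y < 2 ^ m) :
    flip m (Nat.testBit y) = Nat.testBit (2 ^ m + y) := by
  funext q
  by_cases hq : q = m
  · subst hq
    simp [Nat.testBit_two_pow_add_eq]
  · rw [flip_of_ne hq]
    rcases lt_or_gt_of_ne hq with h | h
    · rw [Nat.testBit_two_pow_add_gt h]
    · rw [testBit_of_le hy h.le, testBit_of_le (m := m + 1) (by rw [pow_succ]; omega) h]

/-- Hadamard gates on all qubits of a register that holds `0` give the uniform superposition. -/
theorem hadamards_zero (m : ℕ) :
    iter hadamard 0 m (Finsupp.single (Nat.testBit 0) 1) =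
      superpos m fun _ => ((1 / √2 : ℝ) : ℂ) ^ m := by
  induction m with
  | zero => simp [iter, superpos]
  | succ m ih =>
    rw [iter_succ, LinearMap.comp_apply, ih, Nat.zero_add, linear_superpos, superpos, pow_succ 2 m,
      mul_two, Finset.sum_range_add, ← Finset.sum_add_distrib]
    refine Finset.sum_congr rfl fun y hy => ?_
    have hy := Finset.mem_range.1 hy
    rw [hadamard_single, testBit_two_pow_add hy, testBit_of_le hy le_rfl]
    simp only [one_mul, Bool.false_eq_true, if_false, smul_add, Finsupp.smul_single, smul_eq_mul,
      ← pow_succ]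
    rw [add_comm]

open Classical in
/-- The amplitude of `0` after Hadamard gates on all qubits of a register is proportional to the
sum of the amplitudes. -/
theorem hadamards_apply_zero (m : ℕ) (b : Basis) :
    iterDown hadamard m (Finsupp.single b 1) (Nat.testBit 0) =
      if ∀ q, m ≤ q → b q = false then ((1 / √2 : ℝ) : ℂ) ^ m else 0 := by
  induction m generalizing b with
  | zero =>
    simp only [iterDown, LinearMap.id_apply, Finsupp.single_apply, pow_zero]
    refine if_congr ?_ rfl rfl
    constructor
    · rintro rfl; simp
    · intro h; funext q; rw [h q (Nat.zero_le _)]; simp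
  | succ m ih =>
    rw [iterDown, LinearMap.comp_apply, hadamard_single, map_add, Finsupp.add_apply]
    have h : ∀ (c : Basis) (z : ℂ), iterDown hadamard m (Finsupp.single c z) (Nat.testBit 0) =
        z * if ∀ q, m ≤ q → c q = false then ((1 / √2 : ℝ) : ℂ) ^ m else 0 := by
      intro c z
      rw [← ih c, ← smul_eq_mul, ← Finsupp.smul_apply, ← map_smul, Finsupp.smul_single, smul_eq_mul,
        mul_one]
    rw [h, h]
    cases hb : b m
    · rw [if_neg (show ¬ ∀ q, m ≤ q → flip m b q = false from fun h' => by
        have := h' m le_rfl; simp [hb] at this)]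
      have e : (∀ q, m ≤ q → b q = false) ↔ ∀ q, m + 1 ≤ q → b q = false := by
        refine ⟨fun h q hq => h q (by omega), fun h q hq => ?_⟩
        rcases Nat.eq_or_lt_of_le hq with rfl | hq
        · exact hb
        · exact h q hq
      simp only [e, Bool.false_eq_true, if_false]
      split_ifs <;> simp [pow_succ, mul_comm]
    · rw [if_neg (show ¬ ∀ q, m ≤ q → b q = false from fun h' => by
        have := h' m le_rfl; simp [hb] at this)]
      have e : (∀ q, m ≤ q → flip m b q = false) ↔ ∀ q, m + 1 ≤ q → b q = false := by
        refine ⟨fun h q hq => ?_, fun h q hq => ?_⟩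
        · rw [← flip_of_ne (show q ≠ m by omega) b]; exact h q (by omega)
        · rcases Nat.eq_or_lt_of_le hq with rfl | hq
          · simp [hb]
          · rw [flip_of_ne (by omega)]; exact h q hq
      simp only [e]
      split_ifs <;> simp [pow_succ, mul_comm]

theorem hadamards_cancel (m : ℕ) (ψ : QState) :
    iter hadamard 0 m (iterDown hadamard m ψ) = ψ := by
  induction m generalizing ψ with
  | zero => rfl
  | succ m ih =>
    rw [iter_succ, iterDown, LinearMap.comp_apply, LinearMap.comp_apply, ih, Nat.zero_add,
      hadamard_hadamard]

theorem hadamards_support {k : ℕ} {ψ : QState} (m : ℕ) (hm : m ≤ k)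
    (h : ∀ b ∈ ψ.support, ∀ q, k ≤ q → b q = false) :
    ∀ b ∈ (iterDown hadamard m ψ).support, ∀ q, k ≤ q → b q = false := by
  induction m generalizing ψ with
  | zero => exact h
  | succ m ih =>
    refine ih (by omega) fun b hb q hq => ?_
    rw [Finsupp.mem_support_iff, hadamard_apply] at hb
    by_cases h1 : ψ b = 0
    · have h2 : ψ (flip m b) ≠ 0 := fun h2 => hb (by simp [h1, h2])
      rw [← flip_of_ne (show q ≠ m by omega) b]
      exact h _ (Finsupp.mem_support_iff.2 h2) q hq
    · exact h _ (Finsupp.mem_support_iff.2 h1) q hq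

theorem hadamard_const_sq (m : ℕ) :
    ((1 / √2 : ℝ) : ℂ) ^ m * ((1 / √2 : ℝ) : ℂ) ^ m = 1 / 2 ^ m := by
  rw [← mul_pow, inv_sqrt_two_mul_self, div_pow, one_pow]

/-- The inversion about the mean (up to a sign), built from an operator `Z` that inverts the sign
of the state `0`. -/
theorem diffusion_superpos {m : ℕ} {Z : QState →ₗ[ℂ] QState}
    (hZ : ∀ y < 2 ^ m, Z (Finsupp.single (Nat.testBit y) 1) =
      Finsupp.single (Nat.testBit y) (if y = 0 then -1 else 1)) (φ : ℕ → ℂ) :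
    iter hadamard 0 m (Z (iterDown hadamard m (superpos m φ))) =
      superpos m fun y => φ y - 2 * ((∑ z ∈ Finset.range (2 ^ m), φ z) / 2 ^ m) := by
  classical
  set χ := iterDown hadamard m (superpos m φ) with hχ
  have h0 : χ (Nat.testBit 0) =
      ((1 / √2 : ℝ) : ℂ) ^ m * ∑ z ∈ Finset.range (2 ^ m), φ z := by
    rw [hχ, linear_superpos, Finset.sum_apply', Finset.mul_sum]
    refine Finset.sum_congr rfl fun y hy => ?_
    rw [Finsupp.smul_apply, hadamards_apply_zero,
      if_pos fun q hq => testBit_of_le (Finset.mem_range.1 hy) hq, smul_eq_mul, mul_comm]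
  have hZχ : Z χ = χ - (2 * χ (Nat.testBit 0)) • Finsupp.single (Nat.testBit 0) 1 := by
    have := linear_ext (ψ := χ) (U := Z) (V := .id - (2 : ℂ) •
      (Finsupp.lsingle (Nat.testBit 0) ∘ₗ Finsupp.lapply (Nat.testBit 0))) ?_
    · rw [this]
      simp
    · intro b hb
      have hb' := eq_testBit_readBits (hadamards_support m le_rfl (fun b hb => superpos_support hb)
        b hb)
      rw [hb', hZ _ (readBits_lt _ _ _)]
      by_cases hy : readBits b 0 m = 0
      · simp only [hy, if_true, LinearMap.sub_apply, LinearMap.id_apply, LinearMap.smul_apply,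
          LinearMap.comp_apply, Finsupp.lapply_apply, Finsupp.single_eq_same,
          Finsupp.lsingle_apply, Finsupp.smul_single, smul_eq_mul, ← Finsupp.single_sub]
        norm_num
      · have hne : (Nat.testBit (readBits b 0 m) : Basis) ≠ Nat.testBit 0 :=
          fun h => hy (testBit_injective h)
        simp [hy, Finsupp.single_eq_of_ne hne.symm]
  rw [hZχ, map_sub, map_smul, hχ, hadamards_cancel, ← hχ, h0, hadamards_zero, smul_superpos,
    superpos, superpos, superpos, ← Finset.sum_sub_distrib]
  refine Finset.sum_congr rfl fun y _ => ?_
  rw [← Finsupp.single_sub]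
  congr 1
  linear_combination (-2 * ∑ z ∈ Finset.range (2 ^ m), φ z) * hadamard_const_sq m

/-! ### Amplitude amplification -/

/-- The amplitudes of the solutions and of the other numbers after `j` iterations, relative to the
initial amplitude, if the solutions are a fraction `s` of all numbers. -/
noncomputable def amplitudes (s : ℝ) : ℕ → ℝ × ℝ
  | 0 => (1, 1)
  | j + 1 =>
    let μ := -s * (amplitudes s j).1 + (1 - s) * (amplitudes s j).2
    (-(amplitudes s j).1 - 2 * μ, (amplitudes s j).2 - 2 * μ)

theorem amplitudes_norm (s : ℝ) (j : ℕ) :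
    s * (amplitudes s j).1 ^ 2 + (1 - s) * (amplitudes s j).2 ^ 2 = 1 := by
  induction j with
  | zero => simp [amplitudes]
  | succ j ih =>
    simp only [amplitudes]
    linear_combination ih

theorem amplitudes_sin_cos (θ : ℝ) (j : ℕ) :
    Real.sin θ * (amplitudes (Real.sin θ ^ 2) j).1 = (-1) ^ j * Real.sin ((2 * j + 1) * θ) ∧
      Real.cos θ * (amplitudes (Real.sin θ ^ 2) j).2 = (-1) ^ j * Real.cos ((2 * j + 1) * θ) := by
  induction j with
  | zero => simp [amplitudes]
  | succ j ih =>
    obtain ⟨h1, h2⟩ := ih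
    have e : (2 * ((j + 1 : ℕ) : ℝ) + 1) * θ = (2 * j + 1) * θ + 2 * θ := by push_cast; ring
    have hc : 1 - Real.sin θ ^ 2 = Real.cos θ ^ 2 := by
      linarith [Real.sin_sq_add_cos_sq θ]
    have hs : Real.sin θ ^ 2 = 1 - Real.cos θ ^ 2 := by linarith
    rw [e, Real.sin_add, Real.cos_add, Real.sin_two_mul, Real.cos_two_mul, pow_succ (-1 : ℝ) j]
    simp only [amplitudes, hc]
    constructor
    · linear_combination (2 * Real.sin θ ^ 2 - 1) * h1 - 2 * Real.sin θ * Real.cos θ * h2 +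
        2 * (-1) ^ j * Real.sin ((2 * j + 1) * θ) * hs
    · linear_combination (2 * Real.sin θ * Real.cos θ) * h1 + (1 - 2 * Real.cos θ ^ 2) * h2

open Classical in
/-- The state after `j` iterations of quantum search for a number below `2 ^ m` that satisfies
`f`. -/
theorem search_state {m : ℕ} {f : ℕ → Prop} {P Z : QState →ₗ[ℂ] QState}
    (hP : ∀ y < 2 ^ m, P (Finsupp.single (Nat.testBit y) 1) =
      Finsupp.single (Nat.testBit y) (if f y then -1 else 1))
    (hZ : ∀ y < 2 ^ m, Z (Finsupp.single (Nat.testBit y) 1) =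
      Finsupp.single (Nat.testBit y) (if y = 0 then -1 else 1)) {s : ℝ}
    (hs : s = ((Finset.range (2 ^ m)).filter f).card / 2 ^ m) (j : ℕ) :
    iter (fun _ => iter hadamard 0 m ∘ₗ Z ∘ₗ iterDown hadamard m ∘ₗ P) 0 j
        (iter hadamard 0 m (Finsupp.single (Nat.testBit 0) 1)) =
      superpos m fun y => ((1 / √2 : ℝ) : ℂ) ^ m *
        (if f y then ((amplitudes s j).1 : ℂ) else ((amplitudes s j).2 : ℂ)) := by
  induction j with
  | zero => simp [iter, hadamards_zero, amplitudes]
  | succ j ih =>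
    rw [iter_succ, LinearMap.comp_apply, ih]
    simp only [LinearMap.comp_apply]
    have e : P (superpos m fun y => ((1 / √2 : ℝ) : ℂ) ^ m *
        (if f y then ((amplitudes s j).1 : ℂ) else ((amplitudes s j).2 : ℂ))) =
        superpos m fun y => ((1 / √2 : ℝ) : ℂ) ^ m *
        (if f y then (-(amplitudes s j).1 : ℂ) else ((amplitudes s j).2 : ℂ)) := by
      rw [linear_superpos, superpos]
      refine Finset.sum_congr rfl fun y hy => ?_
      rw [hP y (Finset.mem_range.1 hy), Finsupp.smul_single]
      congr 1
      split_ifs <;> simp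
    rw [e, diffusion_superpos hZ]
    have hcard : (((Finset.range (2 ^ m)).filter fun y => ¬ f y).card : ℂ) =
        2 ^ m - ((Finset.range (2 ^ m)).filter f).card := by
      have := Finset.card_filter_add_card_filter_not (s := Finset.range (2 ^ m)) f
      rw [Finset.card_range] at this
      rw [eq_sub_iff_add_eq, add_comm]
      exact_mod_cast this
    have hs' : (((Finset.range (2 ^ m)).filter f).card : ℂ) = s * 2 ^ m := by
      rw [hs]
      push_cast
      field_simp
    congr 1
    funext y
    rw [← Finset.mul_sum, Finset.sum_ite, Finset.sum_const, Finset.sum_const, nsmul_eq_mul,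
      nsmul_eq_mul, hcard, hs']
    have h2 : (2 : ℂ) ^ m ≠ 0 := pow_ne_zero _ two_ne_zero
    simp only [amplitudes]
    split_ifs
    · push_cast
      field_simp
    · push_cast
      field_simp

open Classical in
/-- The probability that a measurement after `j` iterations yields a number that does not
satisfy `f`. -/
theorem search_failure {m : ℕ} (f : ℕ → Prop) {s : ℝ}
    (hs : s = ((Finset.range (2 ^ m)).filter f).card / 2 ^ m) (j : ℕ) (α : ℂ) (p : ℝ) :
    ∑ y ∈ Finset.range (2 ^ m), (if f y then 0 else p) * ‖α * (((1 / √2 : ℝ) : ℂ) ^ m *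
        (if f y then ((amplitudes s j).1 : ℂ) else ((amplitudes s j).2 : ℂ)))‖ ^ 2 =
      (1 - s) * (amplitudes s j).2 ^ 2 * p * ‖α‖ ^ 2 := by
  have h1 : ∀ y, (if f y then 0 else p) * ‖α * (((1 / √2 : ℝ) : ℂ) ^ m *
      (if f y then ((amplitudes s j).1 : ℂ) else ((amplitudes s j).2 : ℂ)))‖ ^ 2 =
      if ¬ f y then p * ‖α‖ ^ 2 * (1 / 2 ^ m) * (amplitudes s j).2 ^ 2 else 0 := by
    intro y
    have h2 : (‖((1 / √2 : ℝ) : ℂ)‖ ^ m) ^ 2 = 1 / 2 ^ m := by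
      rw [← pow_mul, mul_comm, pow_mul, Complex.norm_real, Real.norm_eq_abs, sq_abs, div_pow,
        Real.sq_sqrt (by norm_num), div_pow]
      norm_num
    by_cases hf : f y
    · simp [hf]
    · simp only [hf, if_false, not_false_eq_true, if_true]
      rw [norm_mul, norm_mul, norm_pow, mul_pow, mul_pow, h2, Complex.norm_real, Real.norm_eq_abs,
        sq_abs]
      ring
  rw [Finset.sum_congr rfl fun y _ => h1 y, ← Finset.sum_filter, Finset.sum_const, nsmul_eq_mul]
  have hcard : (((Finset.range (2 ^ m)).filter fun y => ¬ f y).card : ℝ) = (1 - s) * 2 ^ m := by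
    have := Finset.card_filter_add_card_filter_not (s := Finset.range (2 ^ m)) f
    rw [Finset.card_range] at this
    rw [hs, sub_mul, one_mul, div_mul_cancel₀ _ (by positivity), eq_sub_iff_add_eq, add_comm]
    exact_mod_cast this
  rw [hcard]
  field_simp

/-- The angles `(2 ^ (i + 1) - 1) * θ` grow at most by a factor of `3`, so one of them lies between
`π / 6` and `π / 2`; after the corresponding number of iterations the search succeeds with
probability at least `1 / 4`. -/
theorem exists_good_iterations {m : ℕ} {s : ℝ} (hs : 1 / 2 ^ m ≤ s) (hs1 : s ≤ 1) :
    ∃ i ≤ m / 2, (1 - s) * (amplitudes s (2 ^ i - 1)).2 ^ 2 ≤ 3 / 4 := by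
  have hs0 : 0 < s := lt_of_lt_of_le (by positivity) hs
  obtain ⟨θ, hθ⟩ : ∃ θ, θ = Real.arcsin √s := ⟨_, rfl⟩
  have hsin : Real.sin θ = √s := by
    rw [hθ, Real.sin_arcsin] <;> [linarith [Real.sqrt_nonneg s]; exact Real.sqrt_le_one.2 hs1]
  have hsq : s = Real.sin θ ^ 2 := by rw [hsin, Real.sq_sqrt hs0.le]
  have hθ0 : 0 ≤ θ := by rw [hθ]; exact Real.arcsin_nonneg.2 (Real.sqrt_nonneg s)
  have hθ2 : θ ≤ Real.pi / 2 := by rw [hθ]; exact Real.arcsin_le_pi_div_two _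
  have hθs : √s ≤ θ := by rw [← hsin]; exact Real.sin_le hθ0
  have hlast : Real.pi / 6 < ((2 : ℝ) ^ (m / 2 + 1) - 1) * θ := by
    have h1 : (2 : ℝ) ^ (m / 2) * √s ≤ ((2 : ℝ) ^ (m / 2 + 1) - 1) * θ := by
      have : (1 : ℝ) ≤ 2 ^ (m / 2) := one_le_pow₀ (by norm_num)
      refine mul_le_mul ?_ hθs (Real.sqrt_nonneg s) ?_
      · rw [pow_succ]; linarith
      · rw [pow_succ]; linarith
    refine lt_of_lt_of_le ?_ h1
    have h2 : (1 : ℝ) / 2 ≤ (2 ^ (m / 2) * √s) ^ 2 := by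
      rw [mul_pow, Real.sq_sqrt hs0.le, ← pow_mul]
      have h3 : (2 : ℝ) ^ m ≤ 2 * 2 ^ (m / 2 * 2) := by
        rw [← pow_succ']
        exact pow_le_pow_right₀ (by norm_num) (by omega)
      calc (1 : ℝ) / 2 ≤ 2 ^ (m / 2 * 2) * (1 / 2 ^ m) := by
            rw [mul_one_div, div_le_div_iff₀ (by norm_num) (by positivity)]; linarith
        _ ≤ _ := by gcongr
    have h4 : Real.pi / 6 < 0.6 := by linarith [Real.pi_lt_d2]
    refine h4.trans_le ?_
    by_contra! h5
    have : 0 ≤ (2 : ℝ) ^ (m / 2) * √s := by positivity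
    nlinarith
  have hex : ∃ i, Real.pi / 6 < ((2 : ℝ) ^ (i + 1) - 1) * θ := ⟨m / 2, hlast⟩
  classical
  have hi := Nat.find_spec hex
  have hmin := fun k => Nat.find_min hex (m := k)
  set i := Nat.find hex with hidef
  have him : i ≤ m / 2 := Nat.find_min' hex hlast
  refine ⟨i, him, ?_⟩
  have hup : ((2 : ℝ) ^ (i + 1) - 1) * θ ≤ Real.pi / 2 := by
    rcases Nat.eq_zero_or_pos i with h0 | h0
    · rw [h0]; norm_num; exact hθ2
    · obtain ⟨k, hk⟩ : ∃ k, i = k + 1 := ⟨i - 1, by omega⟩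
      have := not_lt.1 (hmin k (by omega))
      rw [hk]
      have h2 : (1 : ℝ) ≤ 2 ^ k := one_le_pow₀ (by norm_num)
      have h3 : ((2 : ℝ) ^ (k + 1 + 1) - 1) * θ ≤ 3 * (((2 : ℝ) ^ (k + 1) - 1) * θ) := by
        rw [← mul_assoc]
        refine mul_le_mul_of_nonneg_right ?_ hθ0
        rw [pow_succ, pow_succ]
        linarith
      linarith
  have hang : (2 * ((2 ^ i - 1 : ℕ) : ℝ) + 1) * θ = ((2 : ℝ) ^ (i + 1) - 1) * θ := by
    rw [Nat.cast_sub Nat.one_le_two_pow, pow_succ]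
    push_cast
    ring
  have hcos := (amplitudes_sin_cos θ (2 ^ i - 1)).2
  rw [hang, ← hsq] at hcos
  have hc : 1 - s = Real.cos θ ^ 2 := by rw [hsq]; linarith [Real.sin_sq_add_cos_sq θ]
  rw [hc, ← mul_pow, hcos, mul_pow, ← pow_mul, mul_comm (2 ^ i - 1) 2, pow_mul]
  have h1 : Real.cos (((2 : ℝ) ^ (i + 1) - 1) * θ) ≤ Real.cos (Real.pi / 6) :=
    Real.cos_le_cos_of_nonneg_of_le_pi (by positivity) (by linarith [Real.pi_pos]) hi.le
  have h2 : 0 ≤ Real.cos (((2 : ℝ) ^ (i + 1) - 1) * θ) :=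
    Real.cos_nonneg_of_mem_Icc ⟨by linarith [Real.pi_pos], hup⟩
  have h3 : Real.cos (Real.pi / 6) ^ 2 = 3 / 4 := by
    rw [Real.cos_pi_div_six, div_pow, Real.sq_sqrt (by norm_num)]; norm_num
  norm_num
  nlinarith

/-! ### Programs between clean quantum memories -/

/-- The basis state in which all qubits are `0`. -/
def blank : Basis := fun _ => false

theorem testBit_zero_eq_blank : Nat.testBit 0 = blank := by
  funext i
  simp [blank]

/-- Started and ended with a blank quantum memory, the program takes at most `N` steps, every branch
satisfies `Q`, and the expectation of `F` over the final registers is at most `v`. -/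
def CleanExpect (S : Machine n) (p : Prog) (σ : Store) (N : ℕ) (F : Store → ℝ) (v : ℝ)
    (Q : Store → Prop) : Prop :=
  ∀ α : ℂ, Expect S p σ (Finsupp.single blank α) N (fun σ' ψ' => F σ' * weight ψ') (v * ‖α‖ ^ 2)
    (fun σ' ψ' => Q σ' ∧ ∃ β, ψ' = Finsupp.single blank β)

section CleanExpect

variable {S : Machine n} {p q : Prog} {σ : Store} {N N' N₁ N₂ r : ℕ} {F F' F₁ : Store → ℝ}
  {v v' : ℝ} {Q Q' Q₁ P : Store → Prop}

theorem CleanExpect.mono (h : CleanExpect S p σ N F v Q) (hN : N ≤ N') (hv : v ≤ v')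
    (hQ : ∀ σ', Q σ' → Q' σ' ∧ F' σ' ≤ F σ') : CleanExpect S p σ N' F' v' Q' := fun α =>
  (h α).mono hN (mul_le_mul_of_nonneg_right hv (by positivity)) fun σ' ψ' ⟨h1, h2⟩ =>
    ⟨⟨(hQ σ' h1).1, h2⟩, mul_le_mul_of_nonneg_right (hQ σ' h1).2 (weight_nonneg _)⟩

theorem CleanExpect.seq (hp : CleanExpect S p σ N₁ F₁ v Q₁)
    (hq : ∀ σ', Q₁ σ' → CleanExpect S q σ' N₂ F (F₁ σ') Q) :
    CleanExpect S (.seq p q) σ (N₁ + N₂ + 1) F v Q := fun α =>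
  (hp α).seq fun σ' ψ' ⟨h1, β, h2⟩ => by
    subst h2
    simpa using hq σ' h1 β

theorem Run.clean_seq (hp : Run S p σ N₁ .id P)
    (hq : ∀ σ', P σ' → CleanExpect S q σ' N₂ F v Q) :
    CleanExpect S (.seq p q) σ (N₁ + N₂ + 1) F v Q := fun α =>
  hp.seq_expect fun σ' h => hq σ' h α

theorem Run.clean (hp : Run S p σ N .id P) (hQ : ∀ σ', P σ' → Q σ' ∧ F σ' ≤ v) :
    CleanExpect S p σ N F v Q := fun α =>
  hp.expect fun σ' h => ⟨⟨(hQ σ' h).1, α, rfl⟩, by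
    simpa using mul_le_mul_of_nonneg_right (hQ σ' h).2 (by positivity)⟩

theorem CleanExpect.ifNonzero (hσ : Bounded S.B σ)
    (h : CleanExpect S (if σ r = 0 then q else p) σ N F v Q) :
    CleanExpect S (.ifNonzero r p q) σ (N + 1) F v Q := fun α => Expect.ifNonzero hσ (h α)

theorem CleanExpect.loop {F : ℕ → Store → ℝ} {Inv : ℕ → Store → Prop} {l : ℕ}
    (hInv : ∀ i ≤ l, ∀ σ, Inv i σ → Bounded S.B σ ∧ σ r = l - i)
    (hbody : ∀ i < l, ∀ σ, Inv i σ → CleanExpect S p σ N (F (i + 1)) (F i σ) (Inv (i + 1)))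
    (h0 : Inv 0 σ) :
    CleanExpect S (.whileNonzero r p) σ (l * (N + 1) + 1) (F l) (F 0 σ) (Inv l) := fun α => by
  have := Expect.loop (S := S) (p := p) (r := r) (N := N) (σ := σ) (ψ := Finsupp.single blank α)
    (F := fun i σ ψ => F i σ * weight ψ) (l := l)
    (Inv := fun i σ ψ => Inv i σ ∧ ∃ β, ψ = Finsupp.single blank β)
    (fun i hi σ ψ h => hInv i hi σ h.1) (fun i hi σ ψ ⟨h1, β, h2⟩ => by
      subst h2
      simpa using hbody i hi σ h1 β) ⟨h0, α, rfl⟩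
  simpa using this

theorem CleanExpect.add_const (h : CleanExpect S p σ N F v Q) (ε : ℝ) :
    CleanExpect S p σ N (fun σ' => F σ' + ε) (v + ε) Q := fun α => by
  have := (h α).add_weight ε
  simpa [add_mul] using this

end CleanExpect

/-! ### Quantum search -/

theorem measureProg_basis {S : Machine n} {σ : Store} {b : Basis} {z : ℂ} {rp rl ry p k l : ℕ}
    (hB : Bounded S.B σ) (hσ : Consts σ) (h2 : rl < 100) (h3 : ry < 100) (h5 : 4 < ry)
    (hp : σ rp = p) (hk : σ rl = k) (hl : k ≤ l) (hpB : p + k < 2 ^ S.B) (hkB : k ≤ S.B) (C : ℝ) :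
    Expect S (measureProg rp rl ry) σ (Finsupp.single b z) (20 * l + 10)
      (fun _ ψ' => C * weight ψ') (C * ‖z‖ ^ 2)
      (fun σ' ψ' => Bounded S.B σ' ∧ (∀ r < 100, r ≠ ry → σ' r = σ r) ∧ σ' ry < 2 ^ k ∧
        ∃ z', ψ' = Finsupp.single b z' ∧ (z' ≠ 0 → z ≠ 0 ∧ σ' ry = readBits b p k)) := by
  have h := measureProg_expect (ψ := Finsupp.single b z) hB hσ h2 h3 h5 hp hk hl hpB hkB fun _ => C
  rw [Finsupp.sum_single_index (by simp)] at h
  refine h.mono le_rfl le_rfl ?_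
  rintro σ' ψ' ⟨g1, g2, g3, g4, g5⟩
  refine ⟨⟨g1, g2, g3, ψ' b, ?_, ?_⟩, le_rfl⟩
  · exact Finsupp.support_subset_singleton.1 (g4.trans Finsupp.support_single_subset)
  · intro hz
    have hb := Finsupp.mem_support_iff.2 hz
    refine ⟨?_, (g5 b hb).symm⟩
    rintro rfl
    simpa using g4 hb

/-- One round of quantum search: prepare the uniform superposition of the numbers below `2 ^ m`,
iterate as often as register `83` says, measure, and verify the measured number with the circuit
`bs`. If it is a solution, set register `80` and put two numbers computed by the circuit in the
registers `81` and `82`. Finally the quantum memory is blank again.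
Registers: `8` and `9` hold `m` and `2 ^ m - 1`; `10`, `11` and `12` the place of the condition
qubits, their number `k`, and `2 ^ k - 1`; `13` and `14` the places of the two results; `48` the
place from which on auxiliary qubits are available. -/
def trial (bs : List Block) : Prog :=
  .seq (hadamardUp 8) <|
  .seq (code [.add 90 83 4]) <|
  .seq (.whileNonzero 90 <|
    .seq (phaseProg bs 10 11 48) <| .seq (hadamardDown 8) <|
    .seq (phaseProg [.write 9 4 8] 4 8 48) <| .seq (hadamardUp 8) (code [.sub 90 90 3])) <|
  .seq (measureProg 4 8 91) <|
  .seq (blocksProg bs) <|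
  .seq (measureProg 10 11 92) <| .seq (measureProg 13 5 93) <| .seq (measureProg 14 5 94) <|
  .seq (blocksProg bs.reverse) <|
  .seq (Block.write 91 4 8).prog <|
  .seq (code [.sub 95 12 92]) <|
  .ifNonzero 95 skip (code [.add 80 3 4, .add 81 93 4, .add 82 94 4])

/-- The circuit `bs` decides the predicate `f` on the numbers `y < 2 ^ m` by means of `k` condition
qubits, and computes the `w`-bit numbers `r₁ y` and `r₂ y`; its parameters are in the registers
below `80`. -/
structure Decides (S : Machine n) (bs : List Block) (l m k w : ℕ) (f : ℕ → Prop) (r₁ r₂ : ℕ → ℕ)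
    (σ : Store) : Prop where
  consts : Consts σ
  below : ∀ d ∈ bs, d.Below 80
  ok : ∀ d ∈ bs, d.Ok S.B l σ
  reg_w : σ 5 = w
  reg_m : σ 8 = m
  reg_full : σ 9 = 2 ^ m - 1
  reg_k : σ 11 = k
  reg_kfull : σ 12 = 2 ^ k - 1
  m_le : m ≤ l
  k_le : k ≤ l
  w_le : w ≤ l
  l_lt : l + 2 ≤ S.B
  m_le_anc : m ≤ σ 48
  cond_le : σ 10 + k ≤ σ 48
  anc_lt : σ 48 + l + 1 < 2 ^ S.B
  out₁_le : σ 13 + w < 2 ^ S.B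
  out₂_le : σ 14 + w < 2 ^ S.B
  circuit : ∀ y < 2 ^ m,
    (∀ q, σ 48 ≤ q → blocksMap S.x σ bs (Nat.testBit y) q = false) ∧
      ((∀ i < k, blocksMap S.x σ bs (Nat.testBit y) (σ 10 + i) = true) ↔ f y) ∧
      readBits (blocksMap S.x σ bs (Nat.testBit y)) (σ 13) w = r₁ y ∧
      readBits (blocksMap S.x σ bs (Nat.testBit y)) (σ 14) w = r₂ y

theorem Decides.of_agree {S : Machine n} {bs : List Block} {l m k w : ℕ} {f : ℕ → Prop}
    {r₁ r₂ : ℕ → ℕ} {σ σ' : Store} (h : Decides S bs l m k w f r₁ r₂ σ) (ha : Agree 80 σ σ') :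
    Decides S bs l m k w f r₁ r₂ σ' where
  consts := h.consts.of_agree ha (by omega)
  below := h.below
  ok := fun d hd => (h.ok d hd).congr (h.below d hd) ha
  reg_w := (ha 5 (by omega)).trans h.reg_w
  reg_m := (ha 8 (by omega)).trans h.reg_m
  reg_full := (ha 9 (by omega)).trans h.reg_full
  reg_k := (ha 11 (by omega)).trans h.reg_k
  reg_kfull := (ha 12 (by omega)).trans h.reg_kfull
  m_le := h.m_le
  k_le := h.k_le
  w_le := h.w_le
  l_lt := h.l_lt
  m_le_anc := by rw [ha 48 (by omega)]; exact h.m_le_anc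
  cond_le := by rw [ha 48 (by omega), ha 10 (by omega)]; exact h.cond_le
  anc_lt := by rw [ha 48 (by omega)]; exact h.anc_lt
  out₁_le := by rw [ha 13 (by omega)]; exact h.out₁_le
  out₂_le := by rw [ha 14 (by omega)]; exact h.out₂_le
  circuit := by
    rw [ha 48 (by omega), ha 10 (by omega), ha 13 (by omega), ha 14 (by omega),
      blocksMap_congr S.x h.below ha]
    exact h.circuit

/-- The registers `81` and `82` hold the results for a solution. -/
def ValidResult (m : ℕ) (f : ℕ → Prop) (r₁ r₂ : ℕ → ℕ) (σ : Store) : Prop :=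
  ∃ y < 2 ^ m, f y ∧ σ 81 = r₁ y ∧ σ 82 = r₂ y

open Classical in
/-- The failure probability to be reckoned with: `p` if no solution has been found so far. -/
noncomputable def risk (m : ℕ) (f : ℕ → Prop) (r₁ r₂ : ℕ → ℕ) (p : ℝ) (σ : Store) : ℝ :=
  if σ 80 = 0 then p else if ValidResult m f r₁ r₂ σ then 0 else 1

/-- What is left unchanged by a round of search, together with bounds on its results. -/
def RoundPost (B w : ℕ) (σ σ' : Store) : Prop :=
  Bounded B σ' ∧ (∀ r < 90, r ≠ 80 → r ≠ 81 → r ≠ 82 → σ' r = σ r) ∧ σ' 80 ≤ 1 ∧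
    σ' 81 < 2 ^ w ∧ σ' 82 < 2 ^ w

open Classical in
theorem fraction_eq {m : ℕ} (f : ℕ → Prop) :
    ∃ s : ℝ, s = ((Finset.range (2 ^ m)).filter f).card / 2 ^ m ∧ 0 ≤ s ∧ s ≤ 1 := by
  refine ⟨_, rfl, by positivity, ?_⟩
  rw [div_le_one (by positivity)]
  have := (Finset.card_filter_le (Finset.range (2 ^ m)) f).trans_eq (Finset.card_range _)
  exact_mod_cast this

theorem phaseOp_congr (x : Input n) {j : ℕ} {σ σ' : Store} {bs : List Block}
    (h : ∀ d ∈ bs, d.Below j) (ha : Agree j σ σ') (c l a : ℕ) :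
    phaseOp x σ' bs c l a = phaseOp x σ bs c l a := by
  rw [phaseOp, phaseOp, blocksMap_congr x h ha,
    blocksMap_congr x (fun d hd => h d (List.mem_reverse.1 hd)) ha]

/-- The circuit that turns the zero of an `m`-bit register into ones. -/
theorem write_full_below : ∀ d ∈ [Block.write 9 4 8], d.Below 80 := by
  simp [Block.Below]

theorem Decides.write_full_ok {S : Machine n} {bs : List Block} {l m k w : ℕ} {f : ℕ → Prop}
    {r₁ r₂ : ℕ → ℕ} {σ : Store} (hD : Decides S bs l m k w f r₁ r₂ σ) :
    ∀ d ∈ [Block.write 9 4 8], d.Ok S.B l σ := by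
  have h1 := hD.m_le
  have h2 := hD.anc_lt
  have h3 := hD.m_le_anc
  simp only [List.mem_singleton, forall_eq, Block.Ok, hD.consts.2, hD.reg_m]
  omega

/-- The iterations in a round of search. -/
theorem iterations_run {S : Machine n} {bs : List Block} {l m k w j : ℕ} {f : ℕ → Prop}
    {r₁ r₂ : ℕ → ℕ} {σ : Store} (hB : Bounded S.B σ) (hD : Decides S bs l m k w f r₁ r₂ σ)
    (hj : σ 90 = j) :
    Run S (.whileNonzero 90 <|
      .seq (phaseProg bs 10 11 48) <| .seq (hadamardDown 8) <|
      .seq (phaseProg [.write 9 4 8] 4 8 48) <| .seq (hadamardUp 8) (code [.sub 90 90 3]))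
      σ (j * ((2 * bs.length + 10) * (20 * l + 20) + 1) + 1)
      (iter (fun _ => iter hadamard 0 m ∘ₗ phaseOp S.x σ [.write 9 4 8] 0 m (σ 48) ∘ₗ
        iterDown hadamard m ∘ₗ phaseOp S.x σ bs (σ 10) k (σ 48)) 0 j)
      (fun σ' => Bounded S.B σ' ∧ Agree 90 σ σ') := by
  refine (Run.loop (Inv := fun i σ' => Bounded S.B σ' ∧ Agree 90 σ σ' ∧ σ' 90 = j - i)
    ?_ ?_ ?_).post fun σ' h => ⟨h.1, h.2.1⟩
  · rintro i hi σ' ⟨hB', -, h⟩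
    exact ⟨hB', h⟩
  · rintro i hi σ₁ ⟨hB₁, ha₁, g1⟩
    have h80 : Agree 80 σ σ₁ := ha₁.mono (by omega)
    refine Run.mono (N := ((2 * bs.length + 2) * (20 * l + 11) + 30) + ((20 * l + 10) +
      (((2 * 1 + 2) * (20 * l + 11) + 30) + ((20 * l + 10) + 3 + 1) + 1) + 1) + 1) ?_
      (by ring_nf; omega)
    have hD₁ := hD.of_agree h80
    rw [← LinearMap.comp_assoc, ← LinearMap.comp_assoc]
    refine Run.seq (U := phaseOp S.x σ bs (σ 10) k (σ 48)) (V := (iter hadamard 0 m ∘ₗ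
      phaseOp S.x σ [.write 9 4 8] 0 m (σ 48)) ∘ₗ iterDown hadamard m)
      (P := fun σ' => Bounded S.B σ' ∧ Agree 100 σ₁ σ') ?_ ?_
    · rw [← phaseOp_congr S.x hD.below h80]
      refine phaseProg_run hB₁ hD₁.consts (fun d hd => (hD.below d hd).mono (by omega)) hD₁.ok
        (by omega) (by omega) (by omega) (h80 10 (by omega)) hD₁.reg_k (h80 48 (by omega)) hD.k_le
        hD.cond_le ?_
      have := hD.anc_lt; have := hD.k_le; omega
    rintro σ₂ ⟨hB₂, ha₂⟩
    have h80₂ : Agree 80 σ σ₂ := h80.trans (ha₂.mono (by omega))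
    have hD₂ := hD.of_agree h80₂
    refine Run.seq (V := iter hadamard 0 m ∘ₗ phaseOp S.x σ [.write 9 4 8] 0 m (σ 48))
      (hadamardDown_run hB₂ hD₂.consts hD₂.reg_m hD.m_le) ?_
    rintro σ₃ ⟨hB₃, ha₃⟩
    have ha₃ := ha₂.trans ha₃
    have h80₃ : Agree 80 σ σ₃ := h80.trans (ha₃.mono (by omega))
    have hD₃ := hD.of_agree h80₃
    refine Run.seq (U := phaseOp S.x σ [.write 9 4 8] 0 m (σ 48)) (V := iter hadamard 0 m)
      (P := fun σ' => Bounded S.B σ' ∧ Agree 100 σ₃ σ') ?_ ?_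
    · rw [← phaseOp_congr S.x write_full_below h80₃]
      refine phaseProg_run (bs := [.write 9 4 8]) hB₃ hD₃.consts
        (fun d hd => (write_full_below d hd).mono (by omega)) hD₃.write_full_ok
        (by omega) (by omega) (by omega) hD₃.consts.2 hD₃.reg_m (h80₃ 48 (by omega)) hD.m_le
        (by rw [Nat.zero_add]; exact hD.m_le_anc) ?_
      have := hD.anc_lt; have := hD.m_le; omega
    rintro σ₄ ⟨hB₄, ha₄⟩
    have ha₄ := ha₃.trans ha₄
    have hD₄ := hD.of_agree (h80.trans (ha₄.mono (by omega)))
    refine (hadamardUp_run hB₄ hD₄.consts (by omega) hD₄.reg_m hD.m_le).id_seq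
      (N₂ := 3) ?_
    rintro σ₅ ⟨hB₅, ha₅⟩
    have ha₅ := ha₄.trans ha₅
    refine (Run.code hB₅ ?_).post ?_
    · simp [FitsCode, Instr.Fits]
    · rintro _ ⟨rfl, hB₆⟩
      refine ⟨hB₆, (ha₁.trans (ha₅.mono (by omega))).update (by omega), ?_⟩
      have h3 : σ₅ 3 = 1 := (ha₅ 3 (by omega)).trans hD₁.consts.1
      have h90 : σ₅ 90 = σ₁ 90 := ha₅ 90 (by omega)
      simp [evalCode, Instr.eval, h3, h90, g1]
      omega
  · exact ⟨hB, Agree.refl _ _, by omega⟩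

open Classical in
theorem Decides.phase {S : Machine n} {bs : List Block} {l m k w : ℕ} {f : ℕ → Prop}
    {r₁ r₂ : ℕ → ℕ} {σ : Store} (hD : Decides S bs l m k w f r₁ r₂ σ) {y : ℕ} (hy : y < 2 ^ m) :
    phaseOp S.x σ bs (σ 10) k (σ 48) (Finsupp.single (Nat.testBit y) 1) =
      Finsupp.single (Nat.testBit y) (if f y then -1 else 1) := by
  obtain ⟨h1, h2, -⟩ := hD.circuit y hy
  rw [phaseOp_single S.x hD.ok hD.cond_le h1]
  simp only [h2]

theorem writeMap_zero_range (v m y : ℕ) (hv : v < 2 ^ m) :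
    writeMap v 0 m (Nat.testBit y) = Nat.testBit (y ^^^ v) := by
  funext q
  rw [Nat.testBit_xor]
  by_cases hq : q < m
  · simp [writeMap, hq]
  · simp [writeMap, hq, testBit_of_le hv (Nat.not_lt.1 hq)]

theorem Decides.phase_zero {S : Machine n} {bs : List Block} {l m k w : ℕ} {f : ℕ → Prop}
    {r₁ r₂ : ℕ → ℕ} {σ : Store} (hD : Decides S bs l m k w f r₁ r₂ σ) {y : ℕ} (hy : y < 2 ^ m) :
    phaseOp S.x σ [.write 9 4 8] 0 m (σ 48) (Finsupp.single (Nat.testBit y) 1) =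
      Finsupp.single (Nat.testBit y) (if y = 0 then -1 else 1) := by
  classical
  have hfull : 2 ^ m - 1 < 2 ^ m := Nat.sub_lt (by positivity) one_pos
  have e : blocksMap S.x σ [.write 9 4 8] (Nat.testBit y) =
      Nat.testBit (y ^^^ (2 ^ m - 1)) := by
    simp only [blocksMap, Block.map, hD.consts.2, hD.reg_m, hD.reg_full]
    exact writeMap_zero_range _ m y hfull
  rw [phaseOp_single S.x hD.write_full_ok (by rw [Nat.zero_add]; exact hD.m_le_anc)]
  · rw [e]
    congr 1
    refine if_congr ?_ rfl rfl
    constructor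
    · intro h
      refine Nat.eq_of_testBit_eq fun i => ?_
      by_cases hi : i < m
      · have := h i hi
        rw [Nat.zero_add, Nat.testBit_xor, Nat.testBit_two_pow_sub_one] at this
        simpa [hi] using this
      · rw [testBit_of_le hy (Nat.not_lt.1 hi), Nat.zero_testBit]
    · rintro rfl i hi
      rw [Nat.zero_add, Nat.testBit_xor, Nat.testBit_two_pow_sub_one]
      simp [hi]
  · intro q hq
    rw [e]
    exact testBit_of_le (Nat.xor_lt_two_pow hy hfull) (hD.m_le_anc.trans hq)

theorem readBits_eq_full {b : Basis} {p k : ℕ} :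
    readBits b p k = 2 ^ k - 1 ↔ ∀ i < k, b (p + i) = true := by
  constructor
  · intro h i hi
    rw [← testBit_readBits b p k i hi, h, Nat.testBit_two_pow_sub_one]
    simp [hi]
  · intro h
    refine readBits_eq (fun i hi => ?_) (Nat.sub_lt (by positivity) one_pos)
    rw [h i hi, Nat.testBit_two_pow_sub_one]
    simp [hi]

/-- A round of search succeeds as often as amplitude amplification says. -/
theorem trial_expect {S : Machine n} {bs : List Block} {l m k w j : ℕ} {f : ℕ → Prop}
    {r₁ r₂ : ℕ → ℕ} {σ : Store} (hB : Bounded S.B σ) (hD : Decides S bs l m k w f r₁ r₂ σ)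
    (h80 : σ 80 = 0) (h81 : σ 81 < 2 ^ w) (h82 : σ 82 < 2 ^ w) (hj : σ 83 = j) {s : ℝ}
    (hs : s = (@Finset.filter _ f (Classical.decPred f) (Finset.range (2 ^ m))).card / 2 ^ m)
    (p : ℝ) :
    CleanExpect S (trial bs) σ ((j + 3) * ((2 * bs.length + 20) * (20 * l + 20)))
      (risk m f r₁ r₂ p) ((1 - s) * (amplitudes s j).2 ^ 2 * p) (RoundPost S.B w σ) := by
  classical
  intro α
  have hs' : s = ((Finset.range (2 ^ m)).filter f).card / 2 ^ m := by
    rw [hs]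
  have hlB := hD.l_lt
  have hml := hD.m_le
  have hkl := hD.k_le
  have hwl := hD.w_le
  have hm2 : m < 2 ^ S.B := (show m < S.B by omega).trans Nat.lt_two_pow_self
  have hcB : σ 10 + k < 2 ^ S.B := by have := hD.cond_le; have := hD.anc_lt; omega
  refine Expect.mono (N := (20 * l + 10) + (3 + ((j * ((2 * bs.length + 10) * (20 * l + 20) + 1)
    + 1) + ((20 * l + 10) + ((bs.length * (20 * l + 11) + 1) + ((20 * l + 10) + ((20 * l + 10) +
    ((20 * l + 10) + ((bs.length * (20 * l + 11) + 1) + ((20 * l + 10) + (3 + (7 + 1) + 1) + 1) + 1)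
    + 1) + 1) + 1) + 1) + 1) + 1) + 1) + 1) ?_ (by ring_nf; omega) le_rfl (fun σ' ψ' h => ⟨h, le_rfl⟩)
  refine (hadamardUp_run hB hD.consts (by omega) hD.reg_m hD.m_le).seq_expect ?_
  rintro σ₁ ⟨hB₁, ha₁⟩
  have hD₁ := hD.of_agree (ha₁.mono (by omega))
  refine (Run.code hB₁ ?_).seq_expect ?_
  · have := hB₁ 83
    simpa [FitsCode, Instr.Fits, hD₁.consts.2] using this
  rintro σ₁' ⟨hσ₁', hB₁'⟩
  have ha₁' : Agree 90 σ σ₁' := by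
    rw [hσ₁']; exact (ha₁.mono (by omega)).update (by omega)
  have hj' : σ₁' 90 = j := by
    rw [hσ₁', ← hj, ← ha₁ 83 (by omega)]
    simp [evalCode, Instr.eval, hD₁.consts.2]
  have h80₁ : Agree 80 σ σ₁' := ha₁'.mono (by omega)
  have hD₁' := hD.of_agree h80₁
  refine (iterations_run hB₁' hD₁' hj').seq_expect ?_
  rintro σ₂ ⟨hB₂, ha₂⟩
  have ha₂ := ha₁'.trans ha₂
  have hD₂ := hD.of_agree (ha₂.mono (by omega))
  have hstate : (iter (fun _ => iter hadamard 0 m ∘ₗ phaseOp S.x σ₁' [.write 9 4 8] 0 m (σ₁' 48) ∘ₗ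
        iterDown hadamard m ∘ₗ phaseOp S.x σ₁' bs (σ₁' 10) k (σ₁' 48)) 0 j :
        QState →ₗ[ℂ] QState)
      ((LinearMap.id : QState →ₗ[ℂ] QState) (iter hadamard 0 m (Finsupp.single blank α))) =
      superpos m fun y => α * (((1 / √2 : ℝ) : ℂ) ^ m *
        (if f y then ((amplitudes s j).1 : ℂ) else ((amplitudes s j).2 : ℂ))) := by
    have e : (Finsupp.single blank α : QState) = α • Finsupp.single (Nat.testBit 0) 1 := by
      rw [testBit_zero_eq_blank]; simp
    rw [LinearMap.id_apply, e, map_smul, map_smul, search_state (fun y hy => hD₁'.phase hy)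
      (fun y hy => hD₁'.phase_zero hy) hs', smul_superpos]
  rw [hstate]
  have hmeas := measureProg_expect (ψ := superpos m fun y => α * (((1 / √2 : ℝ) : ℂ) ^ m *
      (if f y then ((amplitudes s j).1 : ℂ) else ((amplitudes s j).2 : ℂ)))) (ry := 91) hB₂
    hD₂.consts (by omega) (by omega) (by omega) hD₂.consts.2 hD₂.reg_m hml (by omega) (by omega)
    (fun y => if f y then 0 else p)
  rw [superpos_sum m _ (fun y => if f y then 0 else p), search_failure f hs'] at hmeas
  refine hmeas.seq ?_
  rintro σ₃ ψ₃ ⟨hB₃, ha₃, hY, hsup, hread⟩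
  -- after the measurement the memory is in a basis state
  obtain ⟨Y, hYdef⟩ : ∃ Y, Y = σ₃ 91 := ⟨_, rfl⟩
  rw [← hYdef] at hY hread ⊢
  obtain ⟨z, rfl⟩ : ∃ z, ψ₃ = Finsupp.single (Nat.testBit Y) z := by
    refine ⟨ψ₃ (Nat.testBit Y), Finsupp.support_subset_singleton.1 fun b hb => ?_⟩
    rw [Finset.mem_singleton, ← hread b hb]
    exact eq_testBit_readBits (superpos_support (hsup hb))
  rw [weight_single]
  have ha₃ : ∀ r < 90, σ₃ r = σ r := fun r hr => by
    rw [ha₃ r (by omega) (by omega), ha₂ r hr]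
  have hD₃ := hD.of_agree (fun r hr => ha₃ r (by omega))
  obtain ⟨-, hcirc2, hcirc3, hcirc4⟩ := hD₃.circuit Y hY
  refine (blocks_run hB₃ hD₃.consts (fun d hd => (hD₃.below d hd).mono (by omega))
    hD₃.ok).seq_expect ?_
  rintro σ₄ ⟨hB₄, ha₄⟩
  rw [mapOp_single]
  obtain ⟨b, hb⟩ : ∃ b, b = blocksMap S.x σ₃ bs (Nat.testBit Y) := ⟨_, rfl⟩
  rw [← hb] at hcirc2 hcirc3 hcirc4 ⊢
  have ha₄' : ∀ r < 90, σ₄ r = σ r := fun r hr => by rw [ha₄ r (by omega), ha₃ r hr]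
  have hD₄ := hD.of_agree (fun r hr => ha₄' r (by omega))
  refine (measureProg_basis (ry := 92) hB₄ hD₄.consts (by omega) (by omega) (by omega)
    (ha₄' 10 (by omega)) hD₄.reg_k hkl hcB (by omega) _).seq ?_
  rintro σ₅ _ ⟨hB₅, ha₅, hV, z₅, rfl, hz₅⟩
  rw [weight_single]
  have ha₅' : ∀ r < 90, σ₅ r = σ r := fun r hr => by rw [ha₅ r (by omega) (by omega), ha₄' r hr]
  have hD₅ := hD.of_agree (fun r hr => ha₅' r (by omega))
  refine (measureProg_basis (ry := 93) hB₅ hD₅.consts (by omega) (by omega) (by omega)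
    (ha₅' 13 (by omega)) hD₅.reg_w hwl hD.out₁_le (by omega) _).seq ?_
  rintro σ₆ _ ⟨hB₆, ha₆, hO₁, z₆, h6, hz₆⟩
  rw [h6, weight_single]
  have ha₆' : ∀ r < 90, σ₆ r = σ r := fun r hr => by rw [ha₆ r (by omega) (by omega), ha₅' r hr]
  have hD₆ := hD.of_agree (fun r hr => ha₆' r (by omega))
  refine (measureProg_basis (ry := 94) hB₆ hD₆.consts (by omega) (by omega) (by omega)
    (ha₆' 14 (by omega)) hD₆.reg_w hwl hD.out₂_le (by omega) _).seq ?_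
  rintro σ₇ _ ⟨hB₇, ha₇, hO₂, z₇, rfl, hz₇⟩
  rw [weight_single]
  have ha₇' : ∀ r < 90, σ₇ r = σ r := fun r hr => by rw [ha₇ r (by omega) (by omega), ha₆' r hr]
  have hD₇ := hD.of_agree (fun r hr => ha₇' r (by omega))
  have hY₇ : σ₇ 91 = Y := by
    rw [ha₇ 91 (by omega) (by omega), ha₆ 91 (by omega) (by omega), ha₅ 91 (by omega) (by omega),
      ha₄ 91 (by omega), hYdef]
  have hV₇ : σ₇ 92 < 2 ^ k := by rwa [ha₇ 92 (by omega) (by omega), ha₆ 92 (by omega) (by omega)]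
  have hO₁₇ : σ₇ 93 < 2 ^ w := by rwa [ha₇ 93 (by omega) (by omega)]
  have hres : z₇ ≠ 0 → (σ₇ 92 = 2 ^ k - 1 ↔ f Y) ∧ σ₇ 93 = r₁ Y ∧ σ₇ 94 = r₂ Y := by
    intro h7
    obtain ⟨h6, e7⟩ := hz₇ h7
    obtain ⟨h5, e6⟩ := hz₆ h6
    obtain ⟨h4, e5⟩ := hz₅ h5
    have e92 : σ₇ 92 = readBits b (σ 10) k := by
      rw [ha₇ 92 (by omega) (by omega), ha₆ 92 (by omega) (by omega), e5]
    refine ⟨?_, ?_, ?_⟩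
    · rw [e92, readBits_eq_full, ← hcirc2, ha₃ 10 (by omega)]
    · rw [ha₇ 93 (by omega) (by omega), e6, ← hcirc3, ha₃ 13 (by omega)]
    · rw [e7, ← hcirc4, ha₃ 14 (by omega)]
  have hbr : ∀ d ∈ bs.reverse, d.Below 80 := fun d hd => hD.below d (List.mem_reverse.1 hd)
  have hrun := blocks_run (l := bs.reverse) hB₇ hD₇.consts
    (fun d hd => (hbr d hd).mono (by omega)) fun d hd => hD₇.ok d (List.mem_reverse.1 hd)
  rw [List.length_reverse] at hrun
  refine hrun.seq_expect ?_
  rintro σ₈ ⟨hB₈, ha₈⟩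
  have h73 : Agree 80 σ₃ σ₇ := fun r hr => by rw [ha₇' r (by omega), ha₃ r (by omega)]
  rw [mapOp_single, blocksMap_congr S.x hbr h73, hb, blocksMap_reverse S.x hD₃.ok]
  have hD₈ := hD₇.of_agree (ha₈.mono (by omega))
  refine (Block.run (c := .write 91 4 8) (l := l) hB₈ hD₈.consts
    (by simp only [Block.Below]; omega) ?_).seq_expect
    (N₂ := 3 + (7 + 1) + 1) ?_
  · simp only [Block.Ok, hD₈.consts.2, hD₈.reg_m]
    omega
  rintro σ₉ ⟨hB₉, ha₉⟩
  have ha₉ := ha₈.trans ha₉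
  have hclean : (Block.write 91 4 8).map S.x σ₈ (Nat.testBit Y) = blank := by
    simp only [Block.map, hD₈.consts.2, hD₈.reg_m, ha₈ 91 (by omega), hY₇]
    rw [writeMap_zero_range Y m Y hY, Nat.xor_self, testBit_zero_eq_blank]
  rw [mapOp_single, hclean]
  have hD₉ := hD₇.of_agree (ha₉.mono (by omega))
  refine (Run.code hB₉ ?_).seq_expect ?_
  · simp [FitsCode, Instr.Fits]
  rintro σ₁₀ ⟨hσ₁₀, hB₁₀⟩
  have h95 : σ₁₀ 95 = 0 ↔ σ₇ 92 = 2 ^ k - 1 := by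
    rw [hσ₁₀]
    simp only [evalCode, Instr.eval, Function.update_self, hD₉.reg_kfull, ha₉ 92 (by omega)]
    omega
  have hc : ∀ r < 95, σ₁₀ r = σ₇ r := by
    intro r hr
    rw [hσ₁₀, ← ha₉ r (by omega)]
    simp [evalCode, Instr.eval, show r ≠ 95 by omega]
  have hfr : ∀ r < 90, σ₁₀ r = σ r := fun r hr => by rw [hc r (by omega), ha₇' r hr]
  clear hσ₁₀
  have h3 : σ₁₀ 3 = 1 := by rw [hfr 3 (by omega)]; exact hD.consts.1
  have h4 : σ₁₀ 4 = 0 := by rw [hfr 4 (by omega)]; exact hD.consts.2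
  refine Expect.ifNonzero hB₁₀ ?_
  by_cases hif : σ₁₀ 95 = 0
  · rw [if_pos hif]
    refine (Run.code hB₁₀ ?_).expect ?_
    · have := hB₁₀ 93
      have := hB₁₀ 94
      have := Nat.one_lt_two_pow (show S.B ≠ 0 by omega)
      simp [FitsCode, Instr.eval, Instr.Fits, h3, h4]
      omega
    · rintro σ' ⟨rfl, hB'⟩
      simp only [LinearMap.id_apply, weight_single]
      refine ⟨⟨⟨hB', ?_, ?_, ?_, ?_⟩, z₇, rfl⟩, ?_⟩
      · intro r hr g0 g1 g2
        simp [evalCode, Instr.eval, g0, g1, g2, hfr r hr]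
      · simp [evalCode, Instr.eval, h3, h4]
      · simpa [evalCode, Instr.eval, h4, hc] using hO₁₇
      · simpa [evalCode, Instr.eval, h4, hc] using hO₂
      · by_cases hz : z₇ = 0
        · simp [hz]
        · obtain ⟨g1, g2, g3⟩ := hres hz
          have hfY := g1.1 (h95.1 hif)
          have hv : ValidResult m f r₁ r₂ (evalCode [.add 80 3 4, .add 81 93 4, .add 82 94 4]
              σ₁₀) := by
            refine ⟨Y, hY, hfY, ?_, ?_⟩
            · simp [evalCode, Instr.eval, h4, hc, g2]
            · simp [evalCode, Instr.eval, h4, hc, g3]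
          have hne : evalCode [.add 80 3 4, .add 81 93 4, .add 82 94 4] σ₁₀ 80 ≠ 0 := by
            simp [evalCode, Instr.eval, h3, h4]
          simp [risk, hne, hv, hfY]
  · rw [if_neg hif]
    refine ((Run.skip hB₁₀).mono (by omega)).expect ?_
    rintro _ rfl
    simp only [LinearMap.id_apply, weight_single]
    refine ⟨⟨⟨hB₁₀, fun r hr _ _ _ => hfr r hr, ?_, ?_, ?_⟩, z₇, rfl⟩, ?_⟩
    · rw [hfr 80 (by omega), h80]; omega
    · rw [hfr 81 (by omega)]; exact h81
    · rw [hfr 82 (by omega)]; exact h82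
    · by_cases hz : z₇ = 0
      · simp [hz]
      · have hfY : ¬ f Y := fun h => hif (h95.2 ((hres hz).1.2 h))
        simp [risk, hfr 80 (by omega), h80, hfY]

/-- Quantum search with an unknown number of solutions: rounds with `0, 1, 3, 7, …` iterations, each
repeated as often as register `7` says. -/
def search (bs : List Block) : Prog :=
  .seq (code [.add 80 4 4, .add 81 4 4, .add 82 4 4, .add 83 4 4, .half 84 8, .add 84 84 3]) <|
  .whileNonzero 84 <|
    .seq (code [.add 85 7 4]) <|
    .seq (.whileNonzero 85 (.seq (.ifNonzero 80 skip (trial bs)) (code [.sub 85 85 3])))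
      (code [.add 83 83 83, .add 83 83 3, .sub 84 84 3])

/-- A bound for the number of steps of a search, for circuits of `b` blocks. -/
def searchSteps (b R l m : ℕ) : ℕ :=
  20 + (m / 2 + 1) * (R * ((2 ^ (m / 2) + 3) * ((2 * b + 20) * (20 * l + 20)) + 6) + 20)

open Classical in
/-- The indicator function of the failure of a property. -/
noncomputable def miss (P : Prop) : ℝ := if P then 0 else 1

theorem miss_nonneg (P : Prop) : 0 ≤ miss P := by
  unfold miss; split_ifs <;> norm_num

theorem miss_le_one (P : Prop) : miss P ≤ 1 := by
  unfold miss; split_ifs <;> norm_num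

theorem miss_of {P : Prop} (h : P) : miss P = 0 := if_pos h

theorem miss_of_not {P : Prop} (h : ¬ P) : miss P = 1 := if_neg h

theorem miss_le {P Q : Prop} (h : P → Q) : miss Q ≤ miss P := by
  by_cases hP : P
  · rw [miss_of (h hP)]; exact miss_nonneg P
  · rw [miss_of_not hP]; exact miss_le_one Q

theorem miss_le_add {P Q T : Prop} (h : P → Q → T) : miss T ≤ miss P + miss Q := by
  by_cases hP : P
  · have := miss_le (h hP)
    have := miss_nonneg P
    linarith
  · rw [miss_of_not hP]
    have := miss_le_one T
    have := miss_nonneg Q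
    linarith

/-- Register `80` tells correctly whether there is a solution, and if it says so, the registers `81`
and `82` hold the results for a solution. -/
def GoodResult (m : ℕ) (f : ℕ → Prop) (r₁ r₂ : ℕ → ℕ) (σ : Store) : Prop :=
  (σ 80 ≠ 0 → ValidResult m f r₁ r₂ σ) ∧ (σ 80 = 0 → ∀ y < 2 ^ m, ¬ f y)

/-- What is left unchanged by a search, together with bounds on its results. -/
def SearchPost (B w : ℕ) (σ σ' : Store) : Prop :=
  Bounded B σ' ∧ Agree 80 σ σ' ∧ σ' 80 ≤ 1 ∧ σ' 81 < 2 ^ w ∧ σ' 82 < 2 ^ w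

theorem risk_congr {m : ℕ} {f : ℕ → Prop} {r₁ r₂ : ℕ → ℕ} {p : ℝ} {σ σ' : Store}
    (h₀ : σ' 80 = σ 80) (h₁ : σ' 81 = σ 81) (h₂ : σ' 82 = σ 82) :
    risk m f r₁ r₂ p σ' = risk m f r₁ r₂ p σ := by
  have hv : ValidResult m f r₁ r₂ σ' = ValidResult m f r₁ r₂ σ := by
    simp only [ValidResult, h₁, h₂]
  rw [risk, risk, h₀]
  split_ifs <;> simp_all

/-- A search fails with probability at most `(3 / 4) ^ R`: among the numbers `0, 1, 3, 7, …` of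
iterations there is one for which each of its `R` rounds fails with probability at most `3 / 4`. -/
theorem search_expect {S : Machine n} {bs : List Block} {l m k w R : ℕ} {f : ℕ → Prop}
    {r₁ r₂ : ℕ → ℕ} {σ : Store} (hB : Bounded S.B σ) (hD : Decides S bs l m k w f r₁ r₂ σ)
    (hR : σ 7 = R) :
    CleanExpect S (search bs) σ (searchSteps bs.length R l m)
      (fun σ' => miss (GoodResult m f r₁ r₂ σ')) ((3 / 4) ^ R)
      (SearchPost S.B w σ) := by
  classical
  obtain ⟨s, hs, hs0, hs1⟩ := fraction_eq (m := m) f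
  set len := m / 2 + 1 with hlen
  obtain ⟨q, hq⟩ : ∃ q : ℕ → ℝ, ∀ i, q i = (1 - s) * (amplitudes s (2 ^ i - 1)).2 ^ 2 :=
    ⟨_, fun _ => rfl⟩
  have hq0 : ∀ i, 0 ≤ q i := fun i => by
    rw [hq]; exact mul_nonneg (by linarith) (sq_nonneg _)
  have hq1 : ∀ i, q i ≤ 1 := fun i => by
    have := amplitudes_norm s (2 ^ i - 1)
    have h0 : 0 ≤ s * (amplitudes s (2 ^ i - 1)).1 ^ 2 := mul_nonneg hs0 (sq_nonneg _)
    rw [hq]; linarith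
  -- the failure probability to be reckoned with at the end, and before the rounds of type `i`
  obtain ⟨e, he⟩ : ∃ e : ℝ, e = if ∃ y < 2 ^ m, f y then 1 else 0 := ⟨_, rfl⟩
  obtain ⟨P, hP⟩ : ∃ P : ℕ → ℝ, ∀ i, P i = (∏ i' ∈ Finset.Ico i len, q i' ^ R) * e :=
    ⟨_, fun _ => rfl⟩
  have hPsucc : ∀ i < len, P i = q i ^ R * P (i + 1) := fun i hi => by
    rw [hP, hP, Finset.prod_eq_prod_Ico_succ_bot hi, mul_assoc]
  have hPlen : P len = e := by rw [hP]; simp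
  have hP0 : P 0 ≤ (3 / 4) ^ R := by
    rw [hP, he]
    split_ifs with hsol
    · obtain ⟨y, hy, hfy⟩ := hsol
      have hs2 : 1 / 2 ^ m ≤ s := by
        rw [hs]
        gcongr
        have : 0 < ((Finset.range (2 ^ m)).filter f).card :=
          Finset.card_pos.2 ⟨y, by simp [hy, hfy]⟩
        exact_mod_cast this
      obtain ⟨i, hi, hgood⟩ := exists_good_iterations hs2 hs1
      rw [mul_one, ← Finset.mul_prod_erase (Finset.Ico 0 len) (fun i' => q i' ^ R)
        (show i ∈ Finset.Ico 0 len by simp; omega)]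
      have h1 : ∏ i' ∈ (Finset.Ico 0 len).erase i, q i' ^ R ≤ 1 :=
        Finset.prod_le_one (fun i' _ => pow_nonneg (hq0 i') _)
          fun i' _ => pow_le_one₀ (hq0 i') (hq1 i')
      have h2 : q i ^ R ≤ (3 / 4) ^ R := pow_le_pow_left₀ (hq0 i) (by rw [hq]; exact hgood) R
      calc _ ≤ q i ^ R * 1 := mul_le_mul_of_nonneg_left h1 (pow_nonneg (hq0 i) _)
        _ ≤ _ := by rw [mul_one]; exact h2
    · rw [mul_zero]; positivity
  have hBm : m + 2 ≤ S.B := by have := hD.m_le; have := hD.l_lt; omega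
  have hpowB : ∀ i ≤ len, 2 ^ i ≤ 2 ^ S.B := fun i hi =>
    Nat.pow_le_pow_right (by omega) (by omega)
  have hpowm : ∀ i < len, 2 ^ i ≤ 2 ^ (m / 2) := fun i hi =>
    Nat.pow_le_pow_right (by omega) (by omega)
  have h3 := hD.consts.1
  have h4 := hD.consts.2
  obtain ⟨Nt, hNt⟩ : ∃ Nt, Nt = (2 ^ (m / 2) + 3) * ((2 * bs.length + 20) * (20 * l + 20)) :=
    ⟨_, rfl⟩
  refine CleanExpect.mono (N := 13 + (len * ((3 + ((R * (((Nt + 1) + 3 + 1) + 1) + 1) + 7 + 1) + 1)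
    + 1) + 1) + 1) (F := risk m f r₁ r₂ e) (v := P 0) (Q := SearchPost S.B w σ) ?_ ?_ hP0 ?_
  · have hlenB : len < 2 ^ S.B := (show len < S.B by omega).trans Nat.lt_two_pow_self
    refine (Run.code hB ?_).clean_seq ?_
    · simp [FitsCode, Instr.eval, Instr.Fits, h3, h4, hD.reg_m]
      omega
    rintro σ₁ ⟨hσ₁, hB₁⟩
    have hag : Agree 80 σ σ₁ := by
      rw [hσ₁]
      exact ((((((Agree.refl _ _).update (by omega)).update (by omega)).update (by omega)).update
        (by omega)).update (by omega)).update (by omega)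
    have hvals : σ₁ 80 = 0 ∧ σ₁ 81 = 0 ∧ σ₁ 82 = 0 ∧ σ₁ 83 = 0 ∧ σ₁ 84 = len := by
      rw [hσ₁]
      simp [evalCode, Instr.eval, h3, h4, hD.reg_m, hlen]
    obtain ⟨g0, g1, g2, g3, g4⟩ := hvals
    clear hσ₁
    have hloop := CleanExpect.loop (S := S) (r := 84) (σ := σ₁) (l := len)
      (p := .seq (code [.add 85 7 4]) <|
        .seq (.whileNonzero 85 (.seq (.ifNonzero 80 skip (trial bs)) (code [.sub 85 85 3])))
        (code [.add 83 83 83, .add 83 83 3, .sub 84 84 3]))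
      (N := 3 + ((R * (((Nt + 1) + 3 + 1) + 1) + 1) + 7 + 1) + 1)
      (F := fun i => risk m f r₁ r₂ (P i))
      (Inv := fun i σ' => SearchPost S.B w σ σ' ∧ σ' 83 = 2 ^ i - 1 ∧ σ' 84 = len - i) ?_ ?_ ?_
    · rw [hPlen] at hloop
      refine hloop.mono le_rfl ?_ ?_
      · simp [risk, g0]
      · exact fun σ' h => ⟨h.1, le_rfl⟩
    · rintro i hi σ' ⟨h, -, h'⟩
      exact ⟨h.1, h'⟩
    · rintro i hi σ₂ ⟨⟨hB₂, ha₂, b0, b1, b2⟩, c3, c4⟩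
      have h4₂ := (ha₂ 4 (by omega)).trans h4
      refine (Run.code hB₂ ?_).clean_seq ?_
      · have := hB₂ 7
        simpa [FitsCode, Instr.Fits, h4₂] using this
      rintro σ₃ ⟨hσ₃, hB₃⟩
      have hag₃ : ∀ r < 85, σ₃ r = σ₂ r := by
        intro r hr
        rw [hσ₃]
        simp [evalCode, Instr.eval, show r ≠ 85 by omega]
      have hv₃ : σ₃ 85 = R := by
        rw [hσ₃, ← hR, ← ha₂ 7 (by omega)]
        simp [evalCode, Instr.eval, h4₂]
      have hrisk₃ : ∀ p, risk m f r₁ r₂ p σ₃ = risk m f r₁ r₂ p σ₂ := fun p =>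
        risk_congr (hag₃ 80 (by omega)) (hag₃ 81 (by omega)) (hag₃ 82 (by omega))
      clear hσ₃
      have hinner := CleanExpect.loop (S := S) (r := 85) (σ := σ₃) (l := R)
        (p := .seq (.ifNonzero 80 skip (trial bs)) (code [.sub 85 85 3]))
        (N := (Nt + 1) + 3 + 1)
        (F := fun t => risk m f r₁ r₂ (q i ^ (R - t) * P (i + 1)))
        (Inv := fun t σ' => SearchPost S.B w σ σ' ∧ σ' 83 = 2 ^ i - 1 ∧ σ' 84 = len - i ∧
          σ' 85 = R - t) ?_ ?_ ?_
      · simp only [Nat.sub_self, pow_zero, one_mul, Nat.sub_zero] at hinner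
        rw [← hPsucc i hi, hrisk₃] at hinner
        refine hinner.seq (N₂ := 7) ?_
        rintro σ₄ ⟨⟨hB₄, ha₄, d0, d1, d2⟩, e3, e4, -⟩
        have h3₄ := (ha₄ 3 (by omega)).trans h3
        have hpb := hpowB (i + 1) (by omega)
        rw [pow_succ] at hpb
        have hpos : 0 < 2 ^ i := by positivity
        refine (Run.code hB₄ ?_).clean ?_
        · simp [FitsCode, Instr.eval, Instr.Fits, h3₄, e3]
          omega
        · rintro σ' ⟨rfl, hB'⟩
          refine ⟨⟨⟨hB', ((ha₄.update (by omega)).update (by omega)).update (by omega), ?_⟩,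
            ?_, ?_⟩, le_of_eq ?_⟩
          · simpa [evalCode, Instr.eval] using ⟨d0, d1, d2⟩
          · simp [evalCode, Instr.eval, h3₄, e3]
            rw [pow_succ]; omega
          · simp [evalCode, Instr.eval, h3₄, e4]
            omega
          · apply risk_congr <;> simp [evalCode, Instr.eval]
      · rintro t ht σ' ⟨h, -, -, h'⟩
        exact ⟨h.1, h'⟩
      · rintro t ht σ₄ ⟨⟨hB₄, ha₄, d0, d1, d2⟩, e3, e4, e5⟩
        have hpt : q i ^ (R - t) * P (i + 1) = q i * (q i ^ (R - (t + 1)) * P (i + 1)) := by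
          rw [show R - t = R - (t + 1) + 1 by omega, pow_succ]; ring
        refine CleanExpect.seq (N₁ := Nt + 1) (N₂ := 3)
          (F₁ := risk m f r₁ r₂ (q i ^ (R - (t + 1)) * P (i + 1)))
          (Q₁ := fun σ' => SearchPost S.B w σ σ' ∧ σ' 83 = 2 ^ i - 1 ∧ σ' 84 = len - i ∧
            σ' 85 = R - t) ?_ ?_
        · refine CleanExpect.ifNonzero hB₄ ?_
          by_cases h80 : σ₄ 80 = 0
          · rw [if_pos h80]
            refine (trial_expect hB₄ (hD.of_agree ha₄) h80 d1 d2 e3 (s := s) (by rw [hs])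
              (q i ^ (R - (t + 1)) * P (i + 1))).mono ?_ ?_ ?_
            · rw [hNt]
              exact Nat.mul_le_mul_right _
                (Nat.add_le_add_right ((Nat.sub_le _ _).trans (hpowm i hi)) 3)
            · rw [risk, if_pos h80, hpt, hq i]
            · rintro σ' ⟨hB', hfr, k0, k1, k2⟩
              refine ⟨⟨⟨hB', fun r hr => ?_, k0, k1, k2⟩, ?_, ?_, ?_⟩, le_rfl⟩
              · rw [hfr r (by omega) (by omega) (by omega) (by omega), ha₄ r hr]
              · rw [hfr 83 (by omega) (by omega) (by omega) (by omega), e3]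
              · rw [hfr 84 (by omega) (by omega) (by omega) (by omega), e4]
              · rw [hfr 85 (by omega) (by omega) (by omega) (by omega), e5]
          · rw [if_neg h80]
            refine ((Run.skip hB₄).mono (N' := Nt) ?_).clean ?_
            · rw [hNt]
              exact Nat.one_le_iff_ne_zero.2 (by positivity)
            · rintro σ' rfl
              exact ⟨⟨⟨hB₄, ha₄, d0, d1, d2⟩, e3, e4, e5⟩, by simp [risk, h80]⟩
        · rintro σ₅ ⟨⟨hB₅, ha₅, d0, d1, d2⟩, e3, e4, e5⟩
          have h3₅ := (ha₅ 3 (by omega)).trans h3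
          refine (Run.code hB₅ ?_).clean ?_
          · simp [FitsCode, Instr.Fits]
          · rintro σ' ⟨rfl, hB'⟩
            refine ⟨⟨⟨hB', ha₅.update (by omega), ?_⟩, ?_, ?_, ?_⟩, le_of_eq ?_⟩
            · simpa [evalCode, Instr.eval] using ⟨d0, d1, d2⟩
            · simp [evalCode, Instr.eval, e3]
            · simp [evalCode, Instr.eval, e4]
            · simp [evalCode, Instr.eval, h3₅, e5]; omega
            · apply risk_congr <;> simp [evalCode, Instr.eval]
      · refine ⟨⟨hB₃, fun r hr => by rw [hag₃ r (by omega), ha₂ r hr], ?_⟩, ?_, ?_, hv₃⟩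
        · rw [hag₃ 80 (by omega), hag₃ 81 (by omega), hag₃ 82 (by omega)]
          exact ⟨b0, b1, b2⟩
        · rw [hag₃ 83 (by omega), c3]
        · rw [hag₃ 84 (by omega), c4]
    · refine ⟨⟨hB₁, hag, by omega, ?_, ?_⟩, by omega, by omega⟩
      · rw [g1]; positivity
      · rw [g2]; positivity
  · rw [searchSteps, ← hNt, ← hlen]
    ring_nf
    omega
  · rintro σ' h
    refine ⟨h, ?_⟩
    simp only [risk, he]
    by_cases h80 : σ' 80 = 0
    · rw [if_pos h80]
      by_cases hsol : ∃ y < 2 ^ m, f y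
      · rw [if_pos hsol]
        exact miss_le_one _
      · rw [if_neg hsol]
        exact (miss_of ⟨fun h => absurd h80 h, fun _ y hy hf => hsol ⟨y, hy, hf⟩⟩).le
    · rw [if_neg h80]
      by_cases hv : ValidResult m f r₁ r₂ σ'
      · rw [if_pos hv]
        exact (miss_of ⟨fun _ => hv, fun h => absurd h h80⟩).le
      · rw [if_neg hv]
        exact miss_le_one _

/-! ### Evaluation of circuits -/

/-- The `l` qubits that begin at `p` hold the lowest binary digits of `v`. -/
def Holds (b : Basis) (p l v : ℕ) : Prop := ∀ i < l, b (p + i) = v.testBit i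

/-- The qubits from `p` on are `0`. -/
def Fresh (b : Basis) (p : ℕ) : Prop := ∀ q, p ≤ q → b q = false

/-- The qubits below `p` agree. -/
def Same (p : ℕ) (b b' : Basis) : Prop := ∀ q < p, b' q = b q

theorem Fresh.mono {b : Basis} {p p' : ℕ} (h : Fresh b p) (hp : p ≤ p') : Fresh b p' :=
  fun q hq => h q (hp.trans hq)

theorem Holds.same {b b' : Basis} {p l v d : ℕ} (h : Holds b p l v) (hb : Same d b b')
    (hd : p + l ≤ d) : Holds b' p l v := fun i hi => by rw [hb _ (by omega), h i hi]

theorem Holds.mono {b : Basis} {p l l' v : ℕ} (h : Holds b p l v) (hl : l' ≤ l) :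
    Holds b p l' v := fun i hi => h i (by omega)

theorem Holds.mod {b : Basis} {p l v : ℕ} (h : Holds b p l v) :
    Holds b p l (v % 2 ^ l) := fun i hi => by
  rw [h i hi, Nat.testBit_mod_two_pow]
  simp [hi]

theorem Holds.extend {b : Basis} {p l v : ℕ} (h : Holds b p l v) (hb : Fresh b (p + l)) (l' : ℕ) :
    Holds b p l' (v % 2 ^ l) := fun i _ => by
  rw [Nat.testBit_mod_two_pow]
  by_cases hi : i < l
  · simp [hi, h i hi]
  · simp [hi, hb (p + i) (by omega)]

theorem Fresh.holds {b : Basis} {p : ℕ} (h : Fresh b p) (l : ℕ) : Holds b p l 0 := fun i _ => by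
  rw [h _ (by omega), Nat.zero_testBit]

theorem Holds.readBits {b : Basis} {p l v : ℕ} (h : Holds b p l v) (hv : v < 2 ^ l) :
    readBits b p l = v := readBits_eq h hv

theorem Block.copy_spec {x : Input n} {σ : Store} {s d l ps pd k v : ℕ} {b : Basis}
    (hs : σ s = ps) (hd : σ d = pd) (hl : σ l = k) (h : ps + k ≤ pd) (hf : Fresh b pd)
    (hv : Holds b ps k v) :
    ∃ b', Block.map x σ (.copy s d l) b = b' ∧ Same pd b b' ∧ Holds b' pd k v ∧
      Fresh b' (pd + k) := by
  subst hs hd hl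
  refine ⟨_, rfl, fun q hq => ?_, fun i hi => ?_, fun q hq => ?_⟩
  · simp [Block.map, copyMap, Nat.not_le.2 hq]
  · simp [Block.map, copyMap, hf (σ d + i) (by omega), hi, hv i hi]
  · simp [Block.map, copyMap, hf q (by omega)]
    intros; omega

theorem Block.write_spec {x : Input n} {σ : Store} {r d l pd k v : ℕ} {b : Basis}
    (hr : σ r = v) (hd : σ d = pd) (hl : σ l = k) (hf : Fresh b pd) :
    ∃ b', Block.map x σ (.write r d l) b = b' ∧ Same pd b b' ∧ Holds b' pd k v ∧
      Fresh b' (pd + k) := by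
  subst hr hd hl
  refine ⟨_, rfl, fun q hq => ?_, fun i hi => ?_, fun q hq => ?_⟩
  · simp [Block.map, writeMap, Nat.not_le.2 hq]
  · simp [Block.map, writeMap, hf (σ d + i) (by omega), hi]
  · simp [Block.map, writeMap, hf q (by omega)]
    intros; omega

theorem Oracle.answer_lt (x : Input n) (o : Oracle) (u v : ℕ) :
    o.answer x u v < 2 ^ (Nat.size n + 1) := by
  have hn : n < 2 ^ Nat.size n := Nat.lt_size_self n
  have hb : ∀ c : Bool, c.toNat < 2 ^ (Nat.size n + 1) := fun c => by
    have := Bool.toNat_le c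
    have := Nat.one_le_two_pow (n := Nat.size n)
    rw [pow_succ]
    omega
  have he : ∀ M : Matrix (Fin n) (Fin n) Bool, entry M u v < 2 ^ (Nat.size n + 1) := fun M => by
    unfold entry
    split_ifs
    · exact hb _
    · positivity
  have hs : 2 ^ (Nat.size n + 1) = 2 ^ Nat.size n * 2 := pow_succ _ _
  have ho : ∀ a : Option ℕ, (∀ i ∈ a, i ≤ n) → encodeAnswer n a < 2 ^ (Nat.size n + 1) := by
    rintro (_ | a) ha
    · simp only [encodeAnswer]; omega
    · have := ha a rfl
      simp only [encodeAnswer]; omega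
  cases o with
  | matA => exact he _
  | matB => exact he _
  | connection => exact hb _
  | degree =>
    refine ho _ fun i hi => ?_
    unfold getDegree at hi
    split_ifs at hi
    · simp at hi
      rw [← hi]
      exact (Finset.card_le_univ _).trans_eq (Fintype.card_fin n)
    · simp at hi
  | vertI =>
    refine ho _ fun i hi => ?_
    simp only [getVertI, Option.mem_def, Option.map_eq_some_iff] at hi
    obtain ⟨a, -, rfl⟩ := hi
    exact a.2.le
  | vertJ =>
    refine ho _ fun i hi => ?_
    unfold getVertJ at hi
    split_ifs at hi
    · simp only [Option.mem_def, Option.map_eq_some_iff] at hi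
      obtain ⟨a, -, rfl⟩ := hi
      exact a.2.le
    · simp at hi

theorem Block.query_spec {x : Input n} {σ : Store} {o : Oracle} {r p w u v : ℕ} {b : Basis}
    (hw : w = Nat.size n) (hr : σ r = p) (hu : u < 2 ^ w) (hv : v < 2 ^ w) (h₁ : Holds b p w u)
    (h₂ : Holds b (p + w) w v) (hf : Fresh b (p + 2 * w)) :
    ∃ b', Block.map x σ (.query o r) b = b' ∧ Same (p + 2 * w) b b' ∧
      Holds b' (p + 2 * w) (w + 1) (o.answer x u v) ∧ Fresh b' (p + 3 * w + 1) := by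
  subst hw hr
  have e₁ := h₁.readBits hu
  have e₂ := h₂.readBits hv
  refine ⟨_, rfl, fun q hq => queryBasis_of_lt x o _ b hq, fun i hi => ?_, fun q hq => ?_⟩
  · simp [Block.map, queryBasis, e₁, e₂, hf (σ r + 2 * Nat.size n + i) (by omega)]
  · simp only [Block.map, queryBasis, e₁, e₂, hf q (by omega)]
    rw [testBit_of_le (Oracle.answer_lt x o u v) (by omega)]
    simp

/-! ### The circuits of the algorithm -/

/-- The fixed contents of registers: the input, constants, the number `R` of repetitions in a search,
and the multiples of the word length `w = Nat.size n`, which serve as addresses of qubits.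
The circuits have their input in the qubits below `2 w`, the blocks of the oracles begin at `4 w`,
`8 w`, `12 w`, `16 w` and `20 w`, the conditions are at `24 w`, and the qubits from `28 w` on are
auxiliary. The other registers below `80` are the parameters of `Decides` (`8` to `14`), the degree
found so far (`15`), the power `2 ^ t`, the digit `t` and the degree to be tested in the search for
the degree (`16` to `18`), the complement of the latter (`19`), the chosen vertex (`55`), the bit
lengths of the ranks (`56` and `57`), the number of vertices not connected to the chosen one (`58`),
and scratch (`59` to `64`). -/
structure Layout (x : Input n) (L R w : ℕ) (σ : Store) : Prop where
  size_eq : w = Nat.size n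
  pos : 0 < n
  reg_n : σ 0 = n
  reg_L : σ 1 = L
  reg_k : σ 2 = x.k
  reg_one : σ 3 = 1
  reg_zero : σ 4 = 0
  reg_w : σ 5 = w
  reg_pow : σ 6 = 2 ^ w
  reg_R : σ 7 = R
  reg_mul : ∀ i ≤ 32, σ (20 + i) = i * w
  reg_53 : σ 53 = 24 * w + 1
  reg_54 : σ 54 = 24 * w + 2

/-- The registers that are fixed by `Layout` agree. -/
def Frame (σ σ' : Store) : Prop := ∀ r, (r < 8 ∨ 20 ≤ r ∧ r < 55) → σ' r = σ r

theorem Layout.frame {x : Input n} {L R w : ℕ} {σ σ' : Store} (h : Layout x L R w σ)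
    (hf : Frame σ σ') : Layout x L R w σ' where
  size_eq := h.size_eq
  pos := h.pos
  reg_n := (hf _ (by omega)).trans h.reg_n
  reg_L := (hf _ (by omega)).trans h.reg_L
  reg_k := (hf _ (by omega)).trans h.reg_k
  reg_one := (hf _ (by omega)).trans h.reg_one
  reg_zero := (hf _ (by omega)).trans h.reg_zero
  reg_w := (hf _ (by omega)).trans h.reg_w
  reg_pow := (hf _ (by omega)).trans h.reg_pow
  reg_R := (hf _ (by omega)).trans h.reg_R
  reg_mul := fun i hi => (hf _ (by omega)).trans (h.reg_mul i hi)
  reg_53 := (hf _ (by omega)).trans h.reg_53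
  reg_54 := (hf _ (by omega)).trans h.reg_54

theorem Layout.mul {x : Input n} {L R w : ℕ} {σ : Store} (h : Layout x L R w σ) (r i : ℕ)
    (hr : r = 20 + i) (hi : i ≤ 32) : σ r = i * w := hr ▸ h.reg_mul i hi

theorem Layout.w_pos {x : Input n} {L R w : ℕ} {σ : Store} (h : Layout x L R w σ) : 1 ≤ w := by
  rw [h.size_eq]
  exact Nat.size_pos.2 h.pos

theorem Layout.n_lt {x : Input n} {L R w : ℕ} {σ : Store} (h : Layout x L R w σ) : n < 2 ^ w := by
  rw [h.size_eq]
  exact Nat.lt_size_self n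

/-- The row `u` of the first matrix is marked. -/
def Marked (x : Input n) (u : ℕ) : Prop := Oracle.matA.answer x u x.k = 1

/-- The degree of `u`, and an error value if there is no such vertex. -/
def deg (x : Input n) (u : ℕ) : ℕ := Oracle.degree.answer x u 0

/-- The condition for a collision in terms of the answers of the oracles. -/
def Collides (x : Input n) (i j : ℕ) : Prop :=
  Oracle.matA.answer x i x.k = 1 ∧ Oracle.matB.answer x x.k j = 1 ∧
    Oracle.connection.answer x i j = 1

/-- The circuit that compares the higher digits of the degree of a marked vertex, whose number is in
the first `w` qubits, with the complement of those of a given number. The last block adds the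
complement to the degree, so that the digits become `1` where they agree; the bit next to the highest
digit tells whether the vertex is marked, and so the condition is one range of qubits. -/
def degreeCircuit : List Block :=
  [.copy 20 24 5, .write 2 25 5, .query .matA 24, .copy 20 28 5, .query .degree 28,
    .copy 30 44 5, .copy 26 45 3, .write 19 44 5]

/-- The circuit that checks whether the numbers at `6 w` and `10 w` are a collision. -/
def collisionCircuit : List Block :=
  [.copy 26 32 5, .write 2 33 5, .query .matA 32, .write 2 36 5, .copy 30 37 5, .query .matB 36,
    .copy 26 40 5, .copy 30 41 5, .query .connection 40, .copy 34 44 3, .copy 38 53 3,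
    .copy 42 54 3]

/-- The circuit for the collisions of a given vertex. -/
def neighbourCircuit : List Block := .write 55 26 5 :: .copy 20 30 5 :: collisionCircuit

/-- The circuit for the collisions of a vertex of low degree with a vertex not connected to a given
one, both given by their ranks. Where a rank is too large, the error bit of the answer lies outside
the `w` qubits that are read, and the vertex `0` is taken instead; this does no harm, since the
conditions for a collision are checked in any case. -/
def rankCircuit : List Block :=
  .copy 20 24 56 :: .write 15 25 5 :: .query .vertI 24 :: .copy 56 28 57 :: .write 55 29 5 ::
    .query .vertJ 28 :: collisionCircuit

theorem matrix_answer_lt {x : Input n} {o : Oracle} (h : o = .matA ∨ o = .matB ∨ o = .connection)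
    (u v : ℕ) : o.answer x u v < 2 := by
  have hb : ∀ c : Bool, c.toNat < 2 := fun c => by have := Bool.toNat_le c; omega
  rcases h with rfl | rfl | rfl
  · simp only [Oracle.answer, entry]
    split_ifs <;> simp [hb]
  · simp only [Oracle.answer, entry]
    split_ifs <;> simp [hb]
  · exact hb _

theorem testBit_zero_of_lt_two {a : ℕ} (h : a < 2) : a.testBit 0 = true ↔ a = 1 := by
  interval_cases a <;> simp

section Circuits

variable {x : Input n} {L R w : ℕ} {σ : Store}

/-- Each block writes to qubits that have been blank, in ascending order, except for the last one. -/
theorem degreeCircuit_spec (hL : Layout x L R w σ) {y : ℕ} (hy : y < 2 ^ w) {c : ℕ}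
    (hc : σ 19 = c) : ∃ b, blocksMap x σ degreeCircuit (Nat.testBit y) = b ∧ Fresh b (28 * w) ∧
      Holds b 0 w y ∧ (∀ i < w, b (24 * w + i) = Bool.xor ((deg x y).testBit i) (c.testBit i)) ∧
      (b (25 * w) = true ↔ Marked x y) := by
  have hw := hL.w_pos
  have r20 := hL.mul 20 0 rfl (by omega)
  have r24 := hL.mul 24 4 rfl (by omega)
  have r25 := hL.mul 25 5 rfl (by omega)
  have r26 := hL.mul 26 6 rfl (by omega)
  have r28 := hL.mul 28 8 rfl (by omega)
  have r30 := hL.mul 30 10 rfl (by omega)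
  have r44 := hL.mul 44 24 rfl (by omega)
  have r45 := hL.mul 45 25 rfl (by omega)
  have hk : (x.k : ℕ) < 2 ^ w := x.k.2.trans hL.n_lt
  have hy₀ : Holds (Nat.testBit y) (0 * w) w y := fun i _ => by rw [Nat.zero_mul, Nat.zero_add]
  have hf₀ : Fresh (Nat.testBit y) w := fun q hq => testBit_of_le hy hq
  generalize Nat.testBit y = b₀ at hy₀ hf₀
  simp only [degreeCircuit, blocksMap]
  obtain ⟨b₁, e₁, s₁, h₁, f₁⟩ := Block.copy_spec (x := x) r20 r24 hL.reg_w (by omega)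
    (hf₀.mono (by omega)) hy₀
  rw [e₁]
  have y₁ := hy₀.same s₁ (by omega)
  obtain ⟨b₂, e₂, s₂, h₂, f₂⟩ := Block.write_spec (x := x) hL.reg_k r25 hL.reg_w
    (f₁.mono (by omega))
  rw [e₂]
  obtain ⟨b₃, e₃, s₃, h₃, f₃⟩ := Block.query_spec (x := x) (o := .matA) hL.size_eq r24 hy hk
    (h₁.same s₂ (by omega)) (by convert h₂ using 1; omega) (f₂.mono (by omega))
  rw [e₃]
  have y₃ := (y₁.same s₂ (by omega)).same s₃ (by omega)
  obtain ⟨b₄, e₄, s₄, h₄, f₄⟩ := Block.copy_spec (x := x) r20 r28 hL.reg_w (by omega)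
    (f₃.mono (by omega)) y₃
  rw [e₄]
  obtain ⟨b₅, e₅, s₅, h₅, f₅⟩ := Block.query_spec (x := x) (o := .degree) (v := 0) hL.size_eq r28 hy
    (by positivity) h₄ ((f₄.mono (by omega)).holds _) (f₄.mono (by omega))
  rw [e₅]
  obtain ⟨b₆, e₆, s₆, h₆, f₆⟩ := Block.copy_spec (x := x) (v := deg x y) r30 r44 hL.reg_w (by omega)
    (f₅.mono (by omega)) (by
      convert (show Holds _ _ _ (deg x y) from h₅.mono (Nat.le_succ w)) using 1; omega)
  rw [e₆]
  have m₆ := (((h₃.mono (l' := 1) (by omega)).same s₄ (by omega)).same s₅ (by omega)).same s₆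
    (by omega)
  obtain ⟨b₇, e₇, s₇, h₇, f₇⟩ := Block.copy_spec (x := x) r26 r45 hL.reg_one (by omega)
    (f₆.mono (by omega)) (by convert m₆ using 1; omega)
  rw [e₇]
  have y₇ := (((y₃.same s₄ (by omega)).same s₅ (by omega)).same s₆ (by omega)).same s₇ (by omega)
  have d₇ := h₆.same s₇ (by omega)
  refine ⟨_, rfl, fun q hq => ?_, fun i hi => ?_, fun i hi => ?_, ?_⟩
  · simp [Block.map, writeMap, r44, hL.reg_w, f₇ q (by omega)]
    intros; omega
  · have := y₇ i hi
    rw [Nat.zero_mul, Nat.zero_add] at this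
    simp only [Block.map, writeMap, r44, hL.reg_w, Nat.zero_add, this]
    rw [decide_eq_false (by omega), Bool.false_and, Bool.xor_false]
  · simp [Block.map, writeMap, r44, hL.reg_w, d₇ i hi, hi, hc]
  · have := h₇ 0 (by omega)
    rw [Nat.add_zero] at this
    simp only [Block.map, writeMap, r44, hL.reg_w, this]
    rw [decide_eq_false (by omega), Bool.false_and, Bool.xor_false,
      testBit_zero_of_lt_two (matrix_answer_lt (by simp) _ _), Marked]

theorem collisionCircuit_spec (hL : Layout x L R w σ) {b₀ : Basis} {i j : ℕ}
    (hi : i < 2 ^ w) (hj : j < 2 ^ w) (hi₀ : Holds b₀ (6 * w) w i) (hj₀ : Holds b₀ (10 * w) w j)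
    (hf₀ : Fresh b₀ (12 * w)) :
    ∃ b, blocksMap x σ collisionCircuit b₀ = b ∧ Fresh b (28 * w) ∧
      Holds b (6 * w) w i ∧ Holds b (10 * w) w j ∧
      ((∀ r < 3, b (24 * w + r) = true) ↔ Collides x i j) := by
  have hw := hL.w_pos
  have r26 := hL.mul 26 6 rfl (by omega)
  have r30 := hL.mul 30 10 rfl (by omega)
  have r32 := hL.mul 32 12 rfl (by omega)
  have r33 := hL.mul 33 13 rfl (by omega)
  have r34 := hL.mul 34 14 rfl (by omega)
  have r36 := hL.mul 36 16 rfl (by omega)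
  have r37 := hL.mul 37 17 rfl (by omega)
  have r38 := hL.mul 38 18 rfl (by omega)
  have r40 := hL.mul 40 20 rfl (by omega)
  have r41 := hL.mul 41 21 rfl (by omega)
  have r42 := hL.mul 42 22 rfl (by omega)
  have r44 := hL.mul 44 24 rfl (by omega)
  have hk : (x.k : ℕ) < 2 ^ w := x.k.2.trans hL.n_lt
  simp only [collisionCircuit, blocksMap]
  obtain ⟨b₁, e₁, s₁, h₁, f₁⟩ := Block.copy_spec (x := x) r26 r32 hL.reg_w (by omega) hf₀ hi₀
  rw [e₁]
  obtain ⟨b₂, e₂, s₂, h₂, f₂⟩ := Block.write_spec (x := x) hL.reg_k r33 hL.reg_w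
    (f₁.mono (by omega))
  rw [e₂]
  obtain ⟨b₃, e₃, s₃, h₃, f₃⟩ := Block.query_spec (x := x) (o := .matA) hL.size_eq r32 hi hk
    (h₁.same s₂ (by omega)) (by convert h₂ using 1; omega) (f₂.mono (by omega))
  rw [e₃]
  obtain ⟨b₄, e₄, s₄, h₄, f₄⟩ := Block.write_spec (x := x) hL.reg_k r36 hL.reg_w
    (f₃.mono (by omega))
  rw [e₄]
  have j₄ := (((hj₀.same s₁ (by omega)).same s₂ (by omega)).same s₃ (by omega)).same s₄ (by omega)
  obtain ⟨b₅, e₅, s₅, h₅, f₅⟩ := Block.copy_spec (x := x) r30 r37 hL.reg_w (by omega)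
    (f₄.mono (by omega)) j₄
  rw [e₅]
  obtain ⟨b₆, e₆, s₆, h₆, f₆⟩ := Block.query_spec (x := x) (o := .matB) hL.size_eq r36 hk hj
    (h₄.same s₅ (by omega)) (by convert h₅ using 1; omega) (f₅.mono (by omega))
  rw [e₆]
  have i₆ := (((((hi₀.same s₁ (by omega)).same s₂ (by omega)).same s₃ (by omega)).same s₄
    (by omega)).same s₅ (by omega)).same s₆ (by omega)
  obtain ⟨b₇, e₇, s₇, h₇, f₇⟩ := Block.copy_spec (x := x) r26 r40 hL.reg_w (by omega)
    (f₆.mono (by omega)) i₆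
  rw [e₇]
  have j₇ := ((j₄.same s₅ (by omega)).same s₆ (by omega)).same s₇ (by omega)
  obtain ⟨b₈, e₈, s₈, h₈, f₈⟩ := Block.copy_spec (x := x) r30 r41 hL.reg_w (by omega)
    (f₇.mono (by omega)) j₇
  rw [e₈]
  obtain ⟨b₉, e₉, s₉, h₉, f₉⟩ := Block.query_spec (x := x) (o := .connection) hL.size_eq r40 hi hj
    (h₇.same s₈ (by omega)) (by convert h₈ using 1; omega) (f₈.mono (by omega))
  rw [e₉]
  have m₉ := ((((((h₃.mono (l' := 1) (by omega)).same s₄ (by omega)).same s₅ (by omega)).same s₆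
    (by omega)).same s₇ (by omega)).same s₈ (by omega)).same s₉ (by omega)
  obtain ⟨b', e', s', h', f'⟩ := Block.copy_spec (x := x) r34 r44 hL.reg_one (by omega)
    (f₉.mono (by omega)) (by convert m₉ using 1; omega)
  rw [e']
  have n' := ((((h₆.mono (l' := 1) (by omega)).same s₇ (by omega)).same s₈ (by omega)).same s₉
    (by omega)).same s' (by omega)
  obtain ⟨b'', e'', s'', h'', f''⟩ := Block.copy_spec (x := x) r38 hL.reg_53 hL.reg_one (by omega)
    (f'.mono (by omega)) (by convert n' using 1; omega)
  rw [e'']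
  have c'' := ((h₉.mono (l' := 1) (by omega)).same s' (by omega)).same s'' (by omega)
  obtain ⟨b, e, s, h, f⟩ := Block.copy_spec (x := x) r42 hL.reg_54 hL.reg_one (by omega)
    (f''.mono (by omega)) (by convert c'' using 1; omega)
  rw [e]
  refine ⟨b, rfl, f.mono (by omega), ?_, ?_, ?_⟩
  · exact (((((i₆.same s₇ (by omega)).same s₈ (by omega)).same s₉ (by omega)).same s'
      (by omega)).same s'' (by omega)).same s (by omega)
  · exact ((((j₇.same s₈ (by omega)).same s₉ (by omega)).same s' (by omega)).same s''
      (by omega)).same s (by omega)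
  · have q₀ := ((h'.same s'' (by omega)).same s (by omega)) 0 (by omega)
    have q₁ := (h''.same s (by omega)) 0 (by omega)
    have q₂ := h 0 (by omega)
    rw [Nat.add_zero] at q₀ q₁ q₂
    rw [Collides, ← testBit_zero_of_lt_two (matrix_answer_lt (by simp) _ _),
      ← testBit_zero_of_lt_two (matrix_answer_lt (o := .matB) (by simp) _ _),
      ← testBit_zero_of_lt_two (matrix_answer_lt (o := .connection) (by simp) _ _), ← q₀, ← q₁,
      ← q₂]
    refine ⟨fun hr => ⟨hr 0 (by omega), hr 1 (by omega), hr 2 (by omega)⟩, ?_⟩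
    rintro ⟨g₀, g₁, g₂⟩ r hr
    interval_cases r
    exacts [g₀, g₁, g₂]

theorem neighbourCircuit_spec (hL : Layout x L R w σ) {u y : ℕ} (hu : σ 55 = u) (hu' : u < 2 ^ w)
    (hy : y < 2 ^ w) :
    ∃ b, blocksMap x σ neighbourCircuit (Nat.testBit y) = b ∧ Fresh b (28 * w) ∧
      Holds b (6 * w) w u ∧ Holds b (10 * w) w y ∧
      ((∀ r < 3, b (24 * w + r) = true) ↔ Collides x u y) := by
  have hw := hL.w_pos
  have r20 := hL.mul 20 0 rfl (by omega)
  have r26 := hL.mul 26 6 rfl (by omega)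
  have r30 := hL.mul 30 10 rfl (by omega)
  have hy₀ : Holds (Nat.testBit y) (0 * w) w y := fun i _ => by rw [Nat.zero_mul, Nat.zero_add]
  have hf₀ : Fresh (Nat.testBit y) w := fun q hq => testBit_of_le hy hq
  generalize Nat.testBit y = b₀ at hy₀ hf₀
  simp only [neighbourCircuit, blocksMap]
  obtain ⟨b₁, e₁, s₁, h₁, f₁⟩ := Block.write_spec (x := x) hu r26 hL.reg_w (hf₀.mono (by omega))
  rw [e₁]
  obtain ⟨b₂, e₂, s₂, h₂, f₂⟩ := Block.copy_spec (x := x) r20 r30 hL.reg_w (by omega)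
    (f₁.mono (by omega)) (hy₀.same s₁ (by omega))
  rw [e₂]
  exact collisionCircuit_spec hL hu' hy (h₁.same s₂ (by omega)) h₂ (f₂.mono (by omega))

theorem rankCircuit_spec (hL : Layout x L R w σ) {u d a c y : ℕ} (hu : σ 55 = u)
    (hu' : u < 2 ^ w) (hd : σ 15 = d) (hd' : d < 2 ^ w) (ha : σ 56 = a) (ha' : a ≤ w)
    (hc : σ 57 = c) (hc' : c ≤ w) (hy : y < 2 ^ (a + c)) :
    ∃ b, blocksMap x σ rankCircuit (Nat.testBit y) = b ∧ Fresh b (28 * w) ∧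
      Holds b (6 * w) w (Oracle.vertI.answer x (y % 2 ^ a) d % 2 ^ w) ∧
      Holds b (10 * w) w (Oracle.vertJ.answer x (y / 2 ^ a) u % 2 ^ w) ∧
      ((∀ r < 3, b (24 * w + r) = true) ↔
        Collides x (Oracle.vertI.answer x (y % 2 ^ a) d % 2 ^ w)
          (Oracle.vertJ.answer x (y / 2 ^ a) u % 2 ^ w)) := by
  have hw := hL.w_pos
  have r20 := hL.mul 20 0 rfl (by omega)
  have r24 := hL.mul 24 4 rfl (by omega)
  have r25 := hL.mul 25 5 rfl (by omega)
  have r28 := hL.mul 28 8 rfl (by omega)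
  have r29 := hL.mul 29 9 rfl (by omega)
  have hy₀ : Holds (Nat.testBit y) (0 * w) a y := fun i _ => by rw [Nat.zero_mul, Nat.zero_add]
  have hz₀ : Holds (Nat.testBit y) a c (y / 2 ^ a) := fun i _ => by
    rw [Nat.testBit_div_two_pow, Nat.add_comm]
  have hf₀ : Fresh (Nat.testBit y) (a + c) := fun q hq => testBit_of_le hy hq
  have hlo : y % 2 ^ a < 2 ^ w :=
    (Nat.mod_lt _ (by positivity)).trans_le (Nat.pow_le_pow_right (by omega) ha')
  have hhi : y / 2 ^ a < 2 ^ c := by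
    rw [Nat.div_lt_iff_lt_mul (by positivity), ← pow_add, Nat.add_comm c]
    exact hy
  have hhi' : y / 2 ^ a < 2 ^ w := hhi.trans_le (Nat.pow_le_pow_right (by omega) hc')
  have hmod : y / 2 ^ a % 2 ^ c = y / 2 ^ a := Nat.mod_eq_of_lt hhi
  generalize Nat.testBit y = b₀ at hy₀ hz₀ hf₀
  simp only [rankCircuit, blocksMap]
  obtain ⟨b₁, e₁, s₁, h₁, f₁⟩ := Block.copy_spec (x := x) r20 r24 ha (by omega)
    (hf₀.mono (by omega)) hy₀
  rw [e₁]
  obtain ⟨b₂, e₂, s₂, h₂, f₂⟩ := Block.write_spec (x := x) hd r25 hL.reg_w (f₁.mono (by omega))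
  rw [e₂]
  obtain ⟨b₃, e₃, s₃, h₃, f₃⟩ := Block.query_spec (x := x) (o := .vertI) hL.size_eq r24 hlo hd'
    (Holds.same ((h₁.extend f₁) w) s₂ (by omega)) (by convert h₂ using 1; omega)
    (f₂.mono (by omega))
  rw [e₃]
  obtain ⟨b₄, e₄, s₄, h₄, f₄⟩ := Block.copy_spec (x := x) ha r28 hc (by omega)
    (f₃.mono (by omega)) (((hz₀.same s₁ (by omega)).same s₂ (by omega)).same s₃ (by omega))
  rw [e₄]
  obtain ⟨b₅, e₅, s₅, h₅, f₅⟩ := Block.write_spec (x := x) hu r29 hL.reg_w (f₄.mono (by omega))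
  rw [e₅]
  have z₅ := Holds.same ((h₄.extend f₄) w) s₅ (by omega)
  rw [hmod] at z₅
  obtain ⟨b₆, e₆, s₆, h₆, f₆⟩ := Block.query_spec (x := x) (o := .vertJ) hL.size_eq r28 hhi' hu'
    z₅ (by convert h₅ using 1; omega) (f₅.mono (by omega))
  rw [e₆]
  have i₆ := (((h₃.mono (Nat.le_succ w)).same s₄ (by omega)).same s₅ (by omega)).same s₆ (by omega)
  refine collisionCircuit_spec hL (Nat.mod_lt _ (by positivity)) (Nat.mod_lt _ (by positivity))
    ?_ ?_ (f₆.mono (by omega))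
  · convert i₆.mod using 1
    omega
  · convert (h₆.mono (Nat.le_succ w)).mod using 1
    omega

end Circuits

/-! ### Degrees, collisions and ranks -/

section Combinatorics

variable {x : Input n} {L D a c u : ℕ}

theorem entry_eq_one {M : Matrix (Fin n) (Fin n) Bool} {i j : ℕ} :
    entry M i j = 1 ↔ ∃ (hi : i < n) (hj : j < n), M ⟨i, hi⟩ ⟨j, hj⟩ = true := by
  unfold entry
  split_ifs with h
  · simp only [h.1, h.2, exists_true_left]
    cases M ⟨i, h.1⟩ ⟨j, h.2⟩ <;> simp
  · simp only [false_iff]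
    rintro ⟨hi, hj, -⟩
    exact h ⟨hi, hj⟩

theorem Marked.lt (h : Marked x u) : u < n := (entry_eq_one.1 h).1

theorem marked_val {i : Fin n} : Marked x i ↔ x.A i x.k = true := by
  refine (entry_eq_one (M := x.A)).trans ⟨fun ⟨_, _, h⟩ => h, fun h => ⟨i.2, x.k.2, h⟩⟩

theorem deg_val (i : Fin n) : deg x i = degree x.E i := by
  simp [deg, Oracle.answer, getDegree, encodeAnswer]

theorem degree_le (E : Finset (Fin n × Fin n)) (i : Fin n) : degree E i ≤ n :=
  (Finset.card_le_univ _).trans_eq (Fintype.card_fin n)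

theorem Marked.deg_le (h : Marked x u) : deg x u ≤ n :=
  (deg_val (x := x) ⟨u, h.lt⟩).trans_le (degree_le _ _)

theorem Collides.marked {j : ℕ} (h : Collides x u j) : Marked x u := h.1

theorem collides_val {i j : Fin n} : Collides x i j ↔ x.IsCollision i j := by
  have h₁ : Oracle.matB.answer x x.k j = 1 ↔ x.B x.k j = true :=
    (entry_eq_one (M := x.B)).trans ⟨fun ⟨_, _, h⟩ => h, fun h => ⟨x.k.2, j.2, h⟩⟩
  have h₂ : Oracle.connection.answer x i j = 1 ↔ (i, j) ∈ x.E := by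
    simp only [Oracle.answer, checkConnection]
    rw [dif_pos ⟨i.2, j.2⟩]
    by_cases h : (i, j) ∈ x.E <;> simp [h]
  have h₀ : Oracle.matA.answer x i x.k = 1 ↔ x.A i x.k = true := marked_val
  rw [Collides, Input.IsCollision, h₀, h₁, h₂]
  tauto

theorem Collides.exists {i j : ℕ} (h : Collides x i j) :
    ∃ i' j' : Fin n, x.IsCollision i' j' ∧ i = i' ∧ j = j' := by
  have hi := h.marked.lt
  have hj := (entry_eq_one (M := x.B).1 h.2.1).2.1
  exact ⟨⟨i, hi⟩, ⟨j, hj⟩, collides_val.1 h, rfl, rfl⟩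

theorem exists_rank {S : Finset (Fin n)} {v : Fin n} (hv : v ∈ S) :
    ∃ r < S.card, (S.sort (· ≤ ·))[r]? = some v := by
  obtain ⟨r, hr⟩ := List.mem_iff_getElem?.1 ((Finset.mem_sort (· ≤ ·)).2 hv)
  refine ⟨r, ?_, hr⟩
  have := (List.getElem?_eq_some_iff.1 hr).1
  rwa [Finset.length_sort] at this

theorem exists_rank_degree {v : Fin n} (hv : degree x.E v ≤ D) :
    ∃ r < (Finset.univ.filter fun i : Fin n => degree x.E i ≤ D).card,
      Oracle.vertI.answer x r D = v := by
  obtain ⟨r, h₁, h₂⟩ := exists_rank (S := Finset.univ.filter fun i : Fin n => degree x.E i ≤ D)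
    (v := v) (by simp [hv])
  exact ⟨r, h₁, by simp [Oracle.answer, getVertI, h₂, encodeAnswer]⟩

theorem card_not_connected (E : Finset (Fin n × Fin n)) (i : Fin n) :
    (Finset.univ.filter fun v : Fin n => (i, v) ∉ E).card = n - degree E i := by
  have := Finset.card_filter_add_card_filter_not (s := (Finset.univ : Finset (Fin n)))
    (fun v : Fin n => (i, v) ∈ E)
  rw [Finset.card_univ, Fintype.card_fin] at this
  unfold degree
  omega

theorem exists_rank_not_connected {i v : Fin n} (hv : (i, v) ∉ x.E) :
    ∃ r < n - degree x.E i, Oracle.vertJ.answer x r i = v := by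
  obtain ⟨r, h₁, h₂⟩ := exists_rank (S := Finset.univ.filter fun v : Fin n => (i, v) ∉ x.E)
    (v := v) (by simp [hv])
  refine ⟨r, h₁.trans_eq (card_not_connected _ _), ?_⟩
  simp [Oracle.answer, getVertJ, h₂, encodeAnswer]

theorem sum_degree (E : Finset (Fin n × Fin n)) : ∑ i, degree E i = E.card := by
  rw [Finset.card_eq_sum_card_fiberwise (f := Prod.fst) (t := Finset.univ) (by simp)]
  refine Finset.sum_congr rfl fun i _ => ?_
  unfold degree
  refine Finset.card_bij (fun v _ => (i, v)) ?_ ?_ ?_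
  · intro v hv
    simpa using hv
  · intro v _ v' _ h
    simpa using h
  · rintro ⟨i', v⟩ h
    simp only [Finset.mem_filter] at h
    obtain ⟨h, rfl⟩ := h
    exact ⟨v, by simpa using h, rfl⟩

/-- There are few vertices of degree at most `D`, since each of them misses at least `n - D` edges. -/
theorem card_low_degree_mul_le (hE : n ^ 2 ≤ x.E.card + L) (D : ℕ) :
    (Finset.univ.filter fun i : Fin n => degree x.E i ≤ D).card * (n - D) ≤ L := by
  have h₁ : ∑ i : Fin n, (n - degree x.E i) + x.E.card = n ^ 2 := by
    rw [← sum_degree, ← Finset.sum_add_distrib,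
      Finset.sum_congr rfl fun i _ => Nat.sub_add_cancel (degree_le x.E i)]
    simp [sq]
  have h₂ : (Finset.univ.filter fun i : Fin n => degree x.E i ≤ D).card * (n - D) ≤
      ∑ i ∈ Finset.univ.filter fun i : Fin n => degree x.E i ≤ D, (n - degree x.E i) := by
    rw [← smul_eq_mul]
    refine Finset.card_nsmul_le_sum _ _ _ fun i hi => ?_
    have := (Finset.mem_filter.1 hi).2
    omega
  have h₃ := Finset.sum_le_sum_of_subset (f := fun i : Fin n => n - degree x.E i)
    (Finset.subset_univ (Finset.univ.filter fun i : Fin n => degree x.E i ≤ D))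
  omega

theorem not_connected {w : ℕ} {u i j : Fin n} (hw : n < 2 ^ w) (hu : Marked x u)
    (hnbr : ∀ j < 2 ^ w, ¬ Collides x u j) (h : x.IsCollision i j) : (u, j) ∉ x.E := fun hj =>
  hnbr j (j.2.trans hw) (collides_val.2 ⟨hj, marked_val.1 hu, h.2.2⟩)

/-- A vertex that is connected to all vertices and in no collision rules out collisions. -/
theorem no_collision_of_full {w : ℕ} (hw : n < 2 ^ w) (hu : Marked x u)
    (hnbr : ∀ j < 2 ^ w, ¬ Collides x u j) (hD : n - deg x u = 0) (i j : Fin n) :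
    ¬ x.IsCollision i j := by
  intro h
  obtain ⟨u, rfl⟩ : ∃ u' : Fin n, (u' : ℕ) = u := ⟨⟨u, hu.lt⟩, rfl⟩
  obtain ⟨r, hr, -⟩ := exists_rank_not_connected (not_connected hw hu hnbr h)
  rw [deg_val] at hD
  omega

/-- If `u` has maximal degree among the marked vertices and no collision with its neighbours, then
every collision is between a vertex of low degree and a vertex not connected to `u`. -/
theorem no_collision {w : ℕ} (hw : n < 2 ^ w) (hE : n ^ 2 ≤ x.E.card + L) (hu : Marked x u)
    (hmax : ∀ v, Marked x v → deg x v ≤ deg x u) (hnbr : ∀ j < 2 ^ w, ¬ Collides x u j)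
    (ha : a = w ∨ L < (n - deg x u) * 2 ^ a) (hc : c = w ∨ n - deg x u < 2 ^ c)
    (hrank : ∀ y < 2 ^ (a + c), ¬ Collides x (Oracle.vertI.answer x (y % 2 ^ a) (deg x u) % 2 ^ w)
      (Oracle.vertJ.answer x (y / 2 ^ a) u % 2 ^ w)) (i j : Fin n) : ¬ x.IsCollision i j := by
  intro h
  obtain ⟨u, rfl⟩ : ∃ u' : Fin n, (u' : ℕ) = u := ⟨⟨u, hu.lt⟩, rfl⟩
  have hi : degree x.E i ≤ deg x u := (deg_val i).symm.trans_le (hmax i (marked_val.2 h.2.1))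
  have hj : (u, j) ∉ x.E := not_connected hw hu hnbr h
  obtain ⟨r, hr, er⟩ := exists_rank_degree hi
  obtain ⟨s, hs, es⟩ := exists_rank_not_connected hj
  rw [← deg_val] at hs
  have hra : r < 2 ^ a := by
    rcases ha with rfl | ha
    · refine (hr.trans_le ?_).trans hw
      exact (Finset.card_le_univ _).trans_eq (Fintype.card_fin n)
    · have h₁ := card_low_degree_mul_le hE (deg x u)
      rw [Nat.mul_comm] at h₁
      exact hr.trans (lt_of_mul_lt_mul_left (h₁.trans_lt ha) (Nat.zero_le _))
  have hsc : s < 2 ^ c := by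
    rcases hc with rfl | hc <;> omega
  refine hrank (r + 2 ^ a * s) ?_ ?_
  · rw [pow_add]
    have := Nat.mul_le_mul_left (2 ^ a) (Nat.succ_le_of_lt hsc)
    rw [Nat.mul_succ] at this
    omega
  · rw [Nat.add_mul_mod_self_left, Nat.mod_eq_of_lt hra, Nat.add_mul_div_left _ _ (by positivity),
      Nat.div_eq_of_lt hra, Nat.zero_add, er, es, Nat.mod_eq_of_lt (i.2.trans hw),
      Nat.mod_eq_of_lt (j.2.trans hw)]
    exact collides_val.2 h

end Combinatorics

/-- Two numbers agree from the digit `t` on if the digits of one differ from those of the complement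
of the other. -/
theorem xor_complement_iff {w t d e : ℕ} (hd : d < 2 ^ w) (he : e < 2 ^ w) :
    (∀ i, t ≤ i → i < w → Bool.xor (d.testBit i) ((2 ^ w - 1 - e).testBit i) = true) ↔
      d / 2 ^ t = e / 2 ^ t := by
  rw [Nat.sub_sub, Nat.add_comm 1]
  constructor
  · intro h
    refine Nat.eq_of_testBit_eq fun i => ?_
    rw [Nat.testBit_div_two_pow, Nat.testBit_div_two_pow]
    by_cases hi : i + t < w
    · have := h (i + t) (by omega) hi
      rw [Nat.testBit_two_pow_sub_succ he] at this
      simp only [hi, decide_true, Bool.true_and] at this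
      revert this
      cases d.testBit (i + t) <;> cases e.testBit (i + t) <;> simp
    · rw [testBit_of_le hd (by omega), testBit_of_le he (by omega)]
  · intro h i hti hi
    have h' := congrArg (fun z => Nat.testBit z (i - t)) h
    simp only [Nat.testBit_div_two_pow, Nat.sub_add_cancel hti] at h'
    rw [Nat.testBit_two_pow_sub_succ he, h']
    simp [hi]

/-! ### The predicates decided by the circuits -/

/-- Numbers of `B` bits suffice for the addresses of the qubits. -/
def Wide (B w : ℕ) : Prop := 2 * w + 5 ≤ B ∧ 64 * w + 64 < 2 ^ B

section Decides

variable {S : Machine n} {L R w : ℕ} {σ : Store}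

theorem degree_decides (hL : Layout S.x L R w σ) (hW : Wide S.B w) {t e : ℕ} (ht : t ≤ w)
    (he : e < 2 ^ w) (h8 : σ 8 = w) (h9 : σ 9 = 2 ^ w - 1) (h10 : σ 10 = 24 * w + t)
    (h11 : σ 11 = w + 1 - t) (h12 : σ 12 = 2 ^ (w + 1 - t) - 1) (h13 : σ 13 = 0) (h14 : σ 14 = 0)
    (h19 : σ 19 = 2 ^ w - 1 - e) :
    Decides S degreeCircuit (2 * w + 3) w (w + 1 - t) w
      (fun y => Marked S.x y ∧ deg S.x y / 2 ^ t = e / 2 ^ t) id id σ := by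
  have hw := hL.w_pos
  have r48 := hL.mul 48 28 rfl (by omega)
  obtain ⟨hW₁, hW₂⟩ := hW
  refine ⟨⟨hL.reg_one, hL.reg_zero⟩, ?_, ?_, hL.reg_w, h8, h9, h11, h12, by omega, by omega,
    by omega, by omega, by omega, by omega, by omega, by omega, by omega, ?_⟩
  · simp [degreeCircuit, Block.Below]
  · have r20 := hL.mul 20 0 rfl (by omega)
    have r24 := hL.mul 24 4 rfl (by omega)
    have r25 := hL.mul 25 5 rfl (by omega)
    have r26 := hL.mul 26 6 rfl (by omega)
    have r28 := hL.mul 28 8 rfl (by omega)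
    have r30 := hL.mul 30 10 rfl (by omega)
    have r44 := hL.mul 44 24 rfl (by omega)
    have r45 := hL.mul 45 25 rfl (by omega)
    simp only [degreeCircuit, List.forall_mem_cons, Block.Ok, r20, r24, r25, r26, r28, r30, r44,
      r45, hL.reg_w, hL.reg_one]
    refine ⟨?_, ?_, ?_, ?_, ?_, ?_, ?_, ?_, by simp⟩ <;> first | trivial | omega
  · intro y hy
    obtain ⟨b, hb, hf, h₀, hd, hm⟩ := degreeCircuit_spec hL hy h19
    have hr : readBits b 0 w = y := h₀.readBits hy
    rw [hb, r48, h13, h14, h10]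
    refine ⟨hf, ?_, hr, hr⟩
    rw [← hm]
    have hsplit : (∀ i < w + 1 - t, b (24 * w + t + i) = true) ↔
        (∀ i, t ≤ i → i < w → b (24 * w + i) = true) ∧ b (25 * w) = true := by
      constructor
      · refine fun h => ⟨fun i hi hiw => ?_, ?_⟩
        · have := h (i - t) (by omega)
          rwa [show 24 * w + t + (i - t) = 24 * w + i by omega] at this
        · have := h (w - t) (by omega)
          rwa [show 24 * w + t + (w - t) = 25 * w by omega] at this
      · rintro ⟨h₁, h₂⟩ i hi
        by_cases hiw : t + i < w
        · rw [Nat.add_assoc]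
          exact h₁ _ (by omega) hiw
        · rwa [show 24 * w + t + i = 25 * w by omega]
    rw [hsplit, and_comm]
    refine and_congr_right fun h => ?_
    have hdeg : deg S.x y < 2 ^ w := (hm.1 h).deg_le.trans_lt hL.n_lt
    rw [← xor_complement_iff hdeg he]
    exact forall_congr' fun i => forall_congr' fun _ => forall_congr' fun hi => by rw [hd i hi]

theorem collisionCircuit_ok (hL : Layout S.x L R w σ) (hW : Wide S.B w) :
    ∀ d ∈ collisionCircuit, d.Ok S.B (2 * w + 3) σ := by
  obtain ⟨hW₁, hW₂⟩ := hW
  have hw := hL.w_pos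
  have r26 := hL.mul 26 6 rfl (by omega)
  have r30 := hL.mul 30 10 rfl (by omega)
  have r32 := hL.mul 32 12 rfl (by omega)
  have r33 := hL.mul 33 13 rfl (by omega)
  have r34 := hL.mul 34 14 rfl (by omega)
  have r36 := hL.mul 36 16 rfl (by omega)
  have r37 := hL.mul 37 17 rfl (by omega)
  have r38 := hL.mul 38 18 rfl (by omega)
  have r40 := hL.mul 40 20 rfl (by omega)
  have r41 := hL.mul 41 21 rfl (by omega)
  have r42 := hL.mul 42 22 rfl (by omega)
  have r44 := hL.mul 44 24 rfl (by omega)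
  simp only [collisionCircuit, List.forall_mem_cons, Block.Ok, r26, r30, r32, r33, r34, r36, r37,
    r38, r40, r41, r42, r44, hL.reg_53, hL.reg_54, hL.reg_w, hL.reg_one]
  refine ⟨?_, ?_, ?_, ?_, ?_, ?_, ?_, ?_, ?_, ?_, ?_, ?_, by simp⟩ <;> first | trivial | omega

theorem collisionCircuit_below : ∀ d ∈ collisionCircuit, d.Below 80 := by
  simp [collisionCircuit, Block.Below]

theorem neighbour_decides (hL : Layout S.x L R w σ) (hW : Wide S.B w) {u : ℕ} (hu : u < 2 ^ w)
    (h8 : σ 8 = w) (h9 : σ 9 = 2 ^ w - 1) (h10 : σ 10 = 24 * w) (h11 : σ 11 = 3) (h12 : σ 12 = 7)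
    (h13 : σ 13 = 6 * w) (h14 : σ 14 = 10 * w) (h55 : σ 55 = u) :
    Decides S neighbourCircuit (2 * w + 3) w 3 w (Collides S.x u) (fun _ => u) id σ := by
  have hw := hL.w_pos
  have r48 := hL.mul 48 28 rfl (by omega)
  have hok := collisionCircuit_ok hL hW
  obtain ⟨hW₁, hW₂⟩ := hW
  refine ⟨⟨hL.reg_one, hL.reg_zero⟩, ?_, ?_, hL.reg_w, h8, h9, h11, h12, by omega, by omega,
    by omega, by omega, by omega, by omega, by omega, by omega, by omega, ?_⟩
  · rw [neighbourCircuit, List.forall_mem_cons, List.forall_mem_cons]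
    exact ⟨by simp [Block.Below], by simp [Block.Below], collisionCircuit_below⟩
  · have r20 := hL.mul 20 0 rfl (by omega)
    have r26 := hL.mul 26 6 rfl (by omega)
    have r30 := hL.mul 30 10 rfl (by omega)
    rw [neighbourCircuit, List.forall_mem_cons, List.forall_mem_cons]
    refine ⟨?_, ?_, hok⟩
    all_goals
      simp only [Block.Ok, r20, r26, r30, hL.reg_w]
      omega
  · intro y hy
    obtain ⟨b, hb, hf, h₁, h₂, h₃⟩ := neighbourCircuit_spec hL h55 hu hy
    rw [hb, r48, h13, h14, h10]
    exact ⟨hf, h₃, h₁.readBits hu, h₂.readBits hy⟩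

theorem rank_decides (hL : Layout S.x L R w σ) (hW : Wide S.B w) {u d a c : ℕ} (hu : u < 2 ^ w)
    (hd : d < 2 ^ w) (ha : a ≤ w) (hc : c ≤ w)
    (h8 : σ 8 = a + c) (h9 : σ 9 = 2 ^ (a + c) - 1) (h10 : σ 10 = 24 * w) (h11 : σ 11 = 3)
    (h12 : σ 12 = 7) (h13 : σ 13 = 6 * w) (h14 : σ 14 = 10 * w) (h15 : σ 15 = d)
    (h55 : σ 55 = u) (h56 : σ 56 = a) (h57 : σ 57 = c) :
    Decides S rankCircuit (2 * w + 3) (a + c) 3 w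
      (fun y => Collides S.x (Oracle.vertI.answer S.x (y % 2 ^ a) d % 2 ^ w)
        (Oracle.vertJ.answer S.x (y / 2 ^ a) u % 2 ^ w))
      (fun y => Oracle.vertI.answer S.x (y % 2 ^ a) d % 2 ^ w)
      (fun y => Oracle.vertJ.answer S.x (y / 2 ^ a) u % 2 ^ w) σ := by
  have hw := hL.w_pos
  have r48 := hL.mul 48 28 rfl (by omega)
  have hok := collisionCircuit_ok hL hW
  obtain ⟨hW₁, hW₂⟩ := hW
  refine ⟨⟨hL.reg_one, hL.reg_zero⟩, ?_, ?_, hL.reg_w, h8, h9, h11, h12, by omega, by omega,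
    by omega, by omega, by omega, by omega, by omega, by omega, by omega, ?_⟩
  · simp only [rankCircuit, List.forall_mem_cons]
    refine ⟨?_, ?_, ?_, ?_, ?_, ?_, collisionCircuit_below⟩ <;> simp [Block.Below]
  · have r20 := hL.mul 20 0 rfl (by omega)
    have r24 := hL.mul 24 4 rfl (by omega)
    have r25 := hL.mul 25 5 rfl (by omega)
    have r28 := hL.mul 28 8 rfl (by omega)
    have r29 := hL.mul 29 9 rfl (by omega)
    simp only [rankCircuit, List.forall_mem_cons]
    refine ⟨?_, ?_, ?_, ?_, ?_, ?_, hok⟩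
    all_goals
      simp only [Block.Ok, r20, r24, r25, r28, r29, hL.reg_w, h56, h57]
      try omega
  · intro y hy
    obtain ⟨b, hb, hf, h₁, h₂, h₃⟩ := rankCircuit_spec hL h55 hu h15 hd h56 ha h57 hc hy
    rw [hb, r48, h13, h14, h10]
    exact ⟨hf, h₃, h₁.readBits (Nat.mod_lt _ (by positivity)),
      h₂.readBits (Nat.mod_lt _ (by positivity))⟩

end Decides

/-! ### The marked vertices of maximal degree -/

/-- A bound for the number of steps of any of the searches of the algorithm, if `Q` bounds the square
root of the number of items. -/
def searchBound (R w Q : ℕ) : ℕ :=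
  20 + (w + 1) * (R * ((Q + 3) * (56 * (20 * (2 * w + 3) + 20)) + 6) + 20)

theorem searchSteps_le {b R w m Q : ℕ} (hb : b ≤ 18) (hm : m ≤ 2 * w) (hQ : 2 ^ (m / 2) ≤ Q) :
    searchSteps b R (2 * w + 3) m ≤ searchBound R w Q := by
  unfold searchSteps searchBound
  gcongr <;> omega

/-- Search for a marked vertex whose degree agrees with register `18` from the digit in register `17`
on. -/
def degreeSearch : Prog :=
  .seq (code [.sub 19 6 18, .sub 19 19 3, .add 8 5 4, .sub 9 6 3, .add 10 44 17, .add 11 5 3,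
    .sub 11 11 17, .sub 12 64 3, .add 13 4 4, .add 14 4 4]) (search degreeCircuit)

/-- Registers `80` and `81` hold a correct result of `degreeSearch`. -/
def DegreeFound (x : Input n) (t e : ℕ) (σ : Store) : Prop :=
  (σ 80 ≠ 0 → Marked x (σ 81) ∧ deg x (σ 81) / 2 ^ t = e / 2 ^ t) ∧
    (σ 80 = 0 → ∀ v, Marked x v → deg x v / 2 ^ t ≠ e / 2 ^ t)

section Programs

variable {S : Machine n} {L R w Q : ℕ} {σ : Store}

theorem degreeSearch_expect (hB : Bounded S.B σ) (hL : Layout S.x L R w σ) (hW : Wide S.B w)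
    (hQ : 2 ^ (w / 2) ≤ Q) {t e : ℕ} (ht : t ≤ w) (he : e < 2 ^ w) (h17 : σ 17 = t)
    (h18 : σ 18 = e) (h64 : σ 64 = 2 ^ (w + 1 - t)) :
    CleanExpect S degreeSearch σ (searchBound R w Q + 22)
      (fun σ' => miss (DegreeFound S.x t e σ')) ((3 / 4) ^ R)
      (fun σ' => Bounded S.B σ' ∧ (∀ r < 80, (r < 8 ∨ 15 ≤ r) → r ≠ 19 → σ' r = σ r) ∧
        σ' 81 < 2 ^ w) := by
  have r44 := hL.mul 44 24 rfl (by omega)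
  have h3 := hL.reg_one
  have h4 := hL.reg_zero
  have h5 := hL.reg_w
  have h6 := hL.reg_pow
  have hwB : 2 ^ w < 2 ^ S.B := Nat.pow_lt_pow_right (by omega) (by have := hW.1; omega)
  have hWB := hW.2
  refine CleanExpect.mono (N := 21 + searchSteps degreeCircuit.length R (2 * w + 3) w + 1)
    (F := fun σ' => miss (GoodResult w
      (fun y => Marked S.x y ∧ deg S.x y / 2 ^ t = e / 2 ^ t) id id σ')) (v := (3 / 4) ^ R)
    (Q := fun σ' => Bounded S.B σ' ∧ (∀ r < 80, (r < 8 ∨ 15 ≤ r) → r ≠ 19 → σ' r = σ r) ∧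
        σ' 81 < 2 ^ w) ?_ ?_ le_rfl ?_
  · refine (Run.code hB ?_).clean_seq ?_
    · simp [FitsCode, Instr.eval, Instr.Fits, h3, h4, h5, r44, h17]
      omega
    rintro σ₁ ⟨rfl, hB₁⟩
    have hkeep : ∀ r, (r < 8 ∨ 15 ≤ r) → r ≠ 19 → evalCode [.sub 19 6 18, .sub 19 19 3, .add 8 5 4,
        .sub 9 6 3, .add 10 44 17, .add 11 5 3, .sub 11 11 17, .sub 12 64 3, .add 13 4 4,
        .add 14 4 4] σ r = σ r := by
      intro r hr hr'
      simp [evalCode, Instr.eval, show r ≠ 8 by omega, show r ≠ 9 by omega, show r ≠ 10 by omega,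
        show r ≠ 11 by omega, show r ≠ 12 by omega, show r ≠ 13 by omega, show r ≠ 14 by omega, hr']
    have hD := degree_decides (σ := evalCode [.sub 19 6 18, .sub 19 19 3, .add 8 5 4,
        .sub 9 6 3, .add 10 44 17, .add 11 5 3, .sub 11 11 17, .sub 12 64 3, .add 13 4 4,
        .add 14 4 4] σ) (hL.frame fun r hr => hkeep r (by omega) (by omega)) hW ht he
      (by simp [evalCode, Instr.eval, h4, h5])
      (by simp [evalCode, Instr.eval, h3, h6])
      (by simp [evalCode, Instr.eval, r44, h17])
      (by simp [evalCode, Instr.eval, h3, h5, h17])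
      (by simp [evalCode, Instr.eval, h3, h64])
      (by simp [evalCode, Instr.eval, h4])
      (by simp [evalCode, Instr.eval, h4])
      (by simp [evalCode, Instr.eval, h3, h6, h18]; omega)
    refine (search_expect hB₁ hD (by rw [hkeep 7 (by omega) (by omega), hL.reg_R])).mono le_rfl
      le_rfl ?_
    rintro σ' ⟨g₁, g₂, g₃, g₄, g₅⟩
    exact ⟨⟨g₁, fun r hr hr' hr'' => (g₂ r hr).trans (hkeep r hr' hr''), g₄⟩, le_rfl⟩
  · have := searchSteps_le (b := degreeCircuit.length) (R := R) (by simp [degreeCircuit])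
      (show w ≤ 2 * w by omega) hQ
    omega
  · intro σ' hσ'
    refine ⟨hσ', miss_le fun hG => ⟨fun h => ?_, fun h v hv hd => ?_⟩⟩
    · obtain ⟨y, -, hy, h₁, -⟩ := hG.1 h
      rw [h₁]
      exact hy
    · exact hG.2 h v (hv.lt.trans hL.n_lt) ⟨hv, hd⟩

/-- The invariant of the search for the maximal degree of the marked vertices: it lies between `D`
and `D + 2 ^ t`. -/
def DegreeBetween (x : Input n) (t D : ℕ) : Prop :=
  (∀ v, Marked x v → deg x v < D + 2 ^ t) ∧ ((∃ v, Marked x v) → ∃ v, Marked x v ∧ D ≤ deg x v)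

theorem div_eq_div_iff_between {d e p : ℕ} (hp : 0 < p) (he : p ∣ e) :
    d / p = e / p ↔ e ≤ d ∧ d < e + p := by
  obtain ⟨q, rfl⟩ := he
  rw [Nat.mul_div_cancel_left _ hp, Nat.div_eq_iff hp, Nat.mul_comm p q]
  omega

theorem DegreeBetween.found {x : Input n} {t D v : ℕ} (h : DegreeBetween x (t + 1) D)
    (hD : 2 ^ t ∣ D + 2 ^ t) (hv : Marked x v)
    (hd : deg x v / 2 ^ t = (D + 2 ^ t) / 2 ^ t) : DegreeBetween x t (D + 2 ^ t) := by
  rw [div_eq_div_iff_between (by positivity) hD] at hd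
  refine ⟨fun v' hv' => ?_, fun _ => ⟨v, hv, hd.1⟩⟩
  have := h.1 v' hv'
  rw [pow_succ] at this
  omega

theorem DegreeBetween.not_found {x : Input n} {t D : ℕ} (h : DegreeBetween x (t + 1) D)
    (hD : 2 ^ t ∣ D + 2 ^ t)
    (hd : ∀ v, Marked x v → deg x v / 2 ^ t ≠ (D + 2 ^ t) / 2 ^ t) : DegreeBetween x t D := by
  refine ⟨fun v hv => ?_, h.2⟩
  have h₁ := h.1 v hv
  have h₂ := hd v hv
  rw [Ne, div_eq_div_iff_between (by positivity) hD] at h₂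
  rw [pow_succ] at h₁
  omega

/-- Find a marked vertex of maximal degree: the degree is determined digit by digit in register `15`,
and then a vertex of this degree is put in register `81`. -/
def maxDegree : Prog :=
  .seq (code [.add 15 4 4, .add 16 6 4, .add 17 5 4, .add 64 3 3]) <|
  .seq (.whileNonzero 17 <|
    .seq (code [.sub 17 17 3, .half 16 16, .add 64 64 64, .add 18 15 16]) <|
    .seq degreeSearch (.ifNonzero 80 (code [.add 15 18 4]) skip)) <|
  .seq (code [.add 18 15 4]) degreeSearch

/-- Registers `15`, `80` and `81` hold a correct result of `maxDegree`. -/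
def MaxFound (x : Input n) (σ : Store) : Prop :=
  (σ 80 ≠ 0 → Marked x (σ 81) ∧ deg x (σ 81) = σ 15 ∧ ∀ v, Marked x v → deg x v ≤ σ 15) ∧
    (σ 80 = 0 → ∀ v, ¬ Marked x v)

/-- One search for each of the `w` digits, and a last one for the vertex. -/
theorem maxDegree_expect (hB : Bounded S.B σ) (hL : Layout S.x L R w σ) (hW : Wide S.B w)
    (hQ : 2 ^ (w / 2) ≤ Q) :
    CleanExpect S maxDegree σ ((w + 1) * (searchBound R w Q + 60))
      (fun σ' => miss (MaxFound S.x σ')) ((w + 1) * (3 / 4) ^ R)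
      (fun σ' => Bounded S.B σ' ∧ Frame σ σ' ∧ σ' 15 < 2 ^ w ∧ σ' 81 < 2 ^ w) := by
  obtain ⟨ε, hε⟩ : ∃ ε : ℝ, ε = (3 / 4) ^ R := ⟨_, rfl⟩
  have h3 := hL.reg_one
  have h4 := hL.reg_zero
  have h5 := hL.reg_w
  have h6 := hL.reg_pow
  have hwB : 2 * 2 ^ (w + 1) ≤ 2 ^ S.B := by
    rw [← pow_succ']
    exact Nat.pow_le_pow_right (by omega) (by have := hW.1; omega)
  have hw' : 2 ^ (w + 1) = 2 * 2 ^ w := pow_succ' _ _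
  have hw2 := Nat.one_le_two_pow (n := w)
  have hwlt : w < 2 ^ w := Nat.lt_two_pow_self
  obtain ⟨K, hK⟩ : ∃ K, K = searchBound R w Q := ⟨_, rfl⟩
  rw [← hK, ← hε]
  refine CleanExpect.mono (N := 9 + ((w * ((9 + ((K + 22) + (3 + 1) + 1) + 1) + 1) + 1) +
    (3 + (K + 22) + 1) + 1) + 1) (F := fun σ' => miss (MaxFound S.x σ')) (v := (w + 1) * ε)
    (Q := fun σ' => Bounded S.B σ' ∧ Frame σ σ' ∧ σ' 15 < 2 ^ w ∧ σ' 81 < 2 ^ w) ?_ ?_ le_rfl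
    (fun _ h => ⟨h, le_rfl⟩)
  · refine (Run.code hB ?_).clean_seq ?_
    · simp [FitsCode, Instr.eval, Instr.Fits, h3, h4, h5, h6]
      omega
    rintro σ₁ ⟨hσ₁, hB₁⟩
    have hF₁ : Frame σ σ₁ := fun r hr => by
      rw [hσ₁]
      simp [evalCode, Instr.eval, show r ≠ 15 by omega, show r ≠ 16 by omega,
        show r ≠ 17 by omega, show r ≠ 64 by omega]
    have hv₁ : σ₁ 15 = 0 ∧ σ₁ 16 = 2 ^ w ∧ σ₁ 17 = w ∧ σ₁ 64 = 2 := by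
      rw [hσ₁]
      simp [evalCode, Instr.eval, h3, h4, h5, h6]
    obtain ⟨a₁, a₂, a₃, a₄⟩ := hv₁
    clear hσ₁
    have hloop := CleanExpect.loop (S := S) (r := 17) (σ := σ₁) (l := w)
      (p := .seq (code [.sub 17 17 3, .half 16 16, .add 64 64 64, .add 18 15 16]) <|
        .seq degreeSearch (.ifNonzero 80 (code [.add 15 18 4]) skip))
      (N := 9 + ((K + 22) + (3 + 1) + 1) + 1)
      (F := fun i σ' => miss (DegreeBetween S.x (w - i) (σ' 15)) + (w - i : ℕ) * ε)
      (Inv := fun i σ' => Bounded S.B σ' ∧ Frame σ σ' ∧ σ' 17 = w - i ∧ σ' 16 = 2 ^ (w - i) ∧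
        σ' 64 = 2 ^ (i + 1) ∧ 2 ^ (w - i) ∣ σ' 15 ∧ σ' 15 + 2 ^ (w - i) ≤ 2 ^ w) ?_ ?_ ?_
    · refine CleanExpect.seq ((hloop.add_const ε).mono le_rfl ?_ fun σ' h => ⟨h, le_rfl⟩) ?_
      · have h₀ : DegreeBetween S.x w 0 := ⟨fun v hv => by
          rw [Nat.zero_add]
          exact hv.deg_le.trans_lt hL.n_lt, fun ⟨v, hv⟩ => ⟨v, hv, Nat.zero_le _⟩⟩
        simp only [Nat.sub_zero, a₁, miss_of h₀]
        linarith
      · rintro σ₂ ⟨hB₂, hF₂, c17, c16, c64, -, hle⟩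
        have hL₂ := hL.frame hF₂
        rw [Nat.sub_self, pow_zero] at hle
        refine (Run.code hB₂ ?_).clean_seq ?_
        · simp [FitsCode, Instr.Fits, hL₂.reg_zero]
          omega
        rintro σ₃ ⟨hσ₃, hB₃⟩
        have hag : ∀ r ≠ 18, σ₃ r = σ₂ r := fun r hr => by
          rw [hσ₃]
          simp [evalCode, Instr.eval, hr]
        have h18 : σ₃ 18 = σ₂ 15 := by
          rw [hσ₃]
          simp [evalCode, Instr.eval, hL₂.reg_zero]
        have hF₃ : Frame σ σ₃ := fun r hr => by rw [hag r (by omega), hF₂ r hr]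
        have hs := (degreeSearch_expect hB₃ (hL.frame hF₃) hW hQ (t := 0) (e := σ₂ 15)
          (by omega) (by omega) (by rw [hag 17 (by omega), c17, Nat.sub_self]) h18
          (by rw [hag 64 (by omega), c64, Nat.sub_zero])).add_const
            (miss (DegreeBetween S.x 0 (σ₂ 15)))
        rw [← hK, ← hε] at hs
        refine hs.mono le_rfl (by rw [Nat.sub_self]; push_cast; linarith) ?_
        rintro σ' ⟨g₁, g₂, g₃⟩
        have h15 : σ' 15 = σ₂ 15 := by
          rw [g₂ 15 (by omega) (by omega) (by omega), hag 15 (by omega)]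
        refine ⟨⟨g₁, fun r hr => ?_, by omega, g₃⟩, miss_le_add fun h₁ h₂ => ⟨fun h => ?_, fun h => ?_⟩⟩
        · rw [g₂ r (by omega) (by omega) (by omega), hF₃ r hr]
        · obtain ⟨k₁, k₂⟩ := h₁.1 h
          rw [pow_zero, Nat.div_one, Nat.div_one] at k₂
          rw [h15]
          refine ⟨k₁, k₂, fun v hv => ?_⟩
          have := h₂.1 v hv
          rw [pow_zero] at this
          omega
        · intro v hv
          obtain ⟨v', k₁, k₂⟩ := h₂.2 ⟨v, hv⟩
          have k₃ := h₂.1 v' k₁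
          rw [pow_zero] at k₃
          refine h₁.2 h v' k₁ ?_
          rw [pow_zero, Nat.div_one, Nat.div_one]
          omega
    · rintro i hi σ' ⟨h, -, h', -⟩
      exact ⟨h, h'⟩
    · rintro i hi σ₂ ⟨hB₂, hF₂, c17, c16, c64, hdvd, hle⟩
      obtain ⟨t, ht⟩ : ∃ t, t = w - (i + 1) := ⟨_, rfl⟩
      have hL₂ := hL.frame hF₂
      rw [show w - i = t + 1 by omega, pow_succ] at hle hdvd c16
      rw [show w - i = t + 1 by omega] at c17
      rw [show w - i = t + 1 by omega, ← ht]
      have hpt := Nat.one_le_two_pow (n := t)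
      have hi2 : 2 ^ (i + 1) ≤ 2 ^ w := Nat.pow_le_pow_right (by omega) (by omega)
      have hdvd' : 2 ^ t ∣ σ₂ 15 := (Dvd.intro _ rfl).trans hdvd
      refine (Run.code hB₂ ?_).clean_seq ?_
      · simp [FitsCode, Instr.eval, Instr.Fits, hL₂.reg_one, c16, c64]
        omega
      rintro σ₃ ⟨hσ₃, hB₃⟩
      have hag : ∀ r, r ≠ 16 → r ≠ 17 → r ≠ 18 → r ≠ 64 → σ₃ r = σ₂ r := fun r _ _ _ _ => by
        rw [hσ₃]
        simp [evalCode, Instr.eval, *]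
      have hv₃ : σ₃ 16 = 2 ^ t ∧ σ₃ 17 = t ∧ σ₃ 64 = 2 ^ (i + 2) ∧ σ₃ 18 = σ₂ 15 + 2 ^ t := by
        rw [hσ₃]
        simp [evalCode, Instr.eval, hL₂.reg_one, c16, c17, c64]
        ring
      obtain ⟨d16, d17, d64, d18⟩ := hv₃
      clear hσ₃
      have hF₃ : Frame σ σ₃ := fun r hr => by
        rw [hag r (by omega) (by omega) (by omega) (by omega), hF₂ r hr]
      -- the constant provides for earlier errors and for the searches that follow
      have hs := (degreeSearch_expect hB₃ (hL.frame hF₃) hW hQ (t := t) (e := σ₂ 15 + 2 ^ t)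
        (by omega) (by omega) d17 d18 (by rw [d64, show w + 1 - t = i + 2 by omega])).add_const
          (miss (DegreeBetween S.x (t + 1) (σ₂ 15)) + t * ε)
      rw [← hK, ← hε] at hs
      refine CleanExpect.seq (N₁ := K + 22) (N₂ := 3 + 1) (hs.mono le_rfl (by push_cast; linarith)
        fun σ' h => ⟨h, le_rfl⟩) ?_
      rintro σ₄ ⟨hB₄, hk, -⟩
      have hF₄ : Frame σ σ₄ := fun r hr => by
        rw [hk r (by omega) (by omega) (by omega), hF₃ r hr]
      have e15 : σ₄ 15 = σ₂ 15 := by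
        rw [hk 15 (by omega) (by omega) (by omega), hag 15 (by omega) (by omega) (by omega) (by omega)]
      have e16 := (hk 16 (by omega) (by omega) (by omega)).trans d16
      have e17 := (hk 17 (by omega) (by omega) (by omega)).trans d17
      have e18 := (hk 18 (by omega) (by omega) (by omega)).trans d18
      have e64 := (hk 64 (by omega) (by omega) (by omega)).trans d64
      have h4₄ := (hL.frame hF₄).reg_zero
      refine CleanExpect.ifNonzero hB₄ ?_
      by_cases h80 : σ₄ 80 = 0
      · rw [if_pos h80]
        refine ((Run.skip hB₄).mono (N' := 3) (by omega)).clean ?_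
        rintro σ' rfl
        refine ⟨⟨hB₄, hF₄, e17, e16, e64, by rwa [e15], by omega⟩, ?_⟩
        have := miss_le_add (T := DegreeBetween S.x t (σ₂ 15))
          (P := DegreeFound S.x t (σ₂ 15 + 2 ^ t) σ') (Q := DegreeBetween S.x (t + 1) (σ₂ 15))
          fun h₁ h₂ => h₂.not_found (by rwa [Nat.dvd_add_self_right]) (h₁.2 h80)
        rw [e15]
        linarith
      · rw [if_neg h80]
        refine (Run.code hB₄ ?_).clean ?_
        · simp [FitsCode, Instr.Fits, h4₄, e18]
          omega
        rintro σ' ⟨hσ', hB'⟩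
        have hag' : ∀ r ≠ 15, σ' r = σ₄ r := fun r hr => by
          rw [hσ']
          simp [evalCode, Instr.eval, hr]
        have f15 : σ' 15 = σ₂ 15 + 2 ^ t := by
          rw [hσ']
          simp [evalCode, Instr.eval, h4₄, e18]
        refine ⟨⟨hB', fun r hr => ?_, ?_, ?_, ?_, ?_, by omega⟩, ?_⟩
        · rw [hag' r (by omega), hF₄ r hr]
        · rw [hag' 17 (by omega), e17]
        · rw [hag' 16 (by omega), e16]
        · rw [hag' 64 (by omega), e64]
        · rwa [f15, Nat.dvd_add_self_right]
        have := miss_le_add (T := DegreeBetween S.x t (σ₂ 15 + 2 ^ t))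
          (P := DegreeFound S.x t (σ₂ 15 + 2 ^ t) σ₄) (Q := DegreeBetween S.x (t + 1) (σ₂ 15))
          fun h₁ h₂ => h₂.found (by rwa [Nat.dvd_add_self_right]) (h₁.1 h80).1 (h₁.1 h80).2
        rw [f15]
        linarith
    · refine ⟨hB₁, hF₁, by omega, by simpa using a₂, by simpa using a₄, ?_, ?_⟩
      · rw [a₁]; exact dvd_zero _
      · rw [a₁]; simp
  · ring_nf
    omega

end Programs

/-! ### The collisions with vertices not connected to the chosen one -/

/-- Double the registers `X` and `60` and increase the register `a` until the register `lim` is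
exceeded, but at most as often as register `61` says. -/
def fit (X lim a : ℕ) : Prog :=
  .whileNonzero 61 <|
    .seq (code [.sub 62 X lim]) <|
    .seq (.ifNonzero 62 skip (code [.add X X X, .add 60 60 60, .add a a 3])) (code [.sub 61 61 3])

/-- The contents of the registers after `fit`, in terms of the initial ones. -/
def Fitted (X lim a w e : ℕ) (σ σ' : Store) : Prop :=
  e ≤ w ∧ σ' a = e ∧ σ' X = σ X * 2 ^ e ∧ σ' 60 = σ 60 * 2 ^ e ∧
    (e = w ∨ σ lim < σ X * 2 ^ e) ∧ (e = 0 ∨ σ X * 2 ^ e ≤ 2 * σ lim) ∧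
    ∀ r, r ≠ X → r ≠ a → r ≠ 60 → r ≠ 61 → r ≠ 62 → σ' r = σ r

theorem fit_run {S : Machine n} {σ : Store} {X lim a w : ℕ} (hB : Bounded S.B σ) (hc : Consts σ)
    (hX : X < 60 ∨ 62 < X) (hX' : 4 < X) (ha : 4 < a ∧ a < 60) (hXa : X ≠ a)
    (hlim : lim < 60 ∧ lim ≠ X ∧ lim ≠ a) (h₁ : 2 * σ lim < 2 ^ S.B) (h₂ : w < 2 ^ S.B)
    (h₃ : σ 60 * 2 ^ w < 2 ^ S.B) (h61 : σ 61 = w) (h0 : σ a = 0) :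
    Run S (fit X lim a) σ (w * 17 + 1) .id
      (fun σ' => Bounded S.B σ' ∧ ∃ e, Fitted X lim a w e σ σ') := by
  refine (Run.while_id (N := 16) (l := w)
    (Inv := fun i σ' => Bounded S.B σ' ∧ σ' 61 = w - i ∧ ∃ e, Fitted X lim a i e σ σ') ?_ ?_ ?_).post
    (fun σ' h => ⟨h.1, h.2.2⟩)
  · exact fun i _ σ' h => ⟨h.1, by rw [h.2.1]; omega⟩
  · rintro i hi σ₂ ⟨hB₂, c61, e, he, ca, cX, c60, hlow, hhigh, hfr⟩
    have h3 : σ₂ 3 = 1 := (hfr 3 (by omega) (by omega) (by omega) (by omega) (by omega)).trans hc.1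
    have h4 : σ₂ 4 = 0 := (hfr 4 (by omega) (by omega) (by omega) (by omega) (by omega)).trans hc.2
    have hl₂ : σ₂ lim = σ lim :=
      hfr lim (by omega) (by omega) (by omega) (by omega) (by omega)
    refine Run.mono (N := 3 + ((7 + 1) + 3 + 1) + 1) ((Run.code hB₂ ?_).seq_id ?_) (by omega)
    · simp [FitsCode, Instr.Fits]
    rintro σ₃ ⟨hσ₃, hB₃⟩
    have hag : ∀ r ≠ 62, σ₃ r = σ₂ r := fun r hr => by
      rw [hσ₃]
      simp [evalCode, Instr.eval, hr]
    have h62 : σ₃ 62 = σ₂ X - σ lim := by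
      rw [hσ₃, ← hl₂]
      simp [evalCode, Instr.eval]
    refine Run.id_seq (N₁ := 7 + 1) (N₂ := 3) (P := fun σ' => Bounded S.B σ' ∧ σ' 61 = w - i ∧
      ∃ e, Fitted X lim a (i + 1) e σ σ') ?_ ?_
    · refine Run.ifNonzero hB₃ ?_
      by_cases hz : σ₃ 62 = 0
      · rw [if_pos hz]
        have hle : σ X * 2 ^ e ≤ σ lim := by omega
        have hei : e = i := by omega
        have hpow : σ 60 * (2 ^ e * 2) ≤ σ 60 * 2 ^ w := by
          rw [← pow_succ]
          exact Nat.mul_le_mul_left _ (Nat.pow_le_pow_right (by omega) (by omega))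
        rw [← Nat.mul_assoc] at hpow
        have e60 := (hag 60 (by omega)).trans c60
        have eX := (hag X (by omega)).trans cX
        have ea := (hag a (by omega)).trans ca
        have e3 := (hag 3 (by omega)).trans h3
        refine (Run.code hB₃ ?_).post ?_
        · simp [FitsCode, Instr.eval, Instr.Fits, e60, eX, ea, e3, show (60 : ℕ) ≠ X by omega,
            hXa.symm, show a ≠ 60 by omega, show (3 : ℕ) ≠ X by omega]
          omega
        · rintro σ' ⟨hσ', hB'⟩
          have v61 : σ' 61 = w - i := by
            rw [hσ']
            simp [evalCode, Instr.eval, show (61 : ℕ) ≠ X by omega, show 61 ≠ a by omega,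
              hag, c61]
          refine ⟨hB', v61, e + 1, by omega, ?_, ?_, ?_, by omega, Or.inr ?_, fun r _ _ _ _ _ => ?_⟩
          · rw [hσ']
            simp [evalCode, Instr.eval, ea, e3, hXa.symm, show a ≠ 60 by omega,
              show (3 : ℕ) ≠ X by omega]
          · rw [hσ']
            simp [evalCode, Instr.eval, eX, hXa, show X ≠ 60 by omega]
            ring
          · rw [hσ']
            simp [evalCode, Instr.eval, e60, show (60 : ℕ) ≠ X by omega, show 60 ≠ a by omega]
            ring
          · rw [pow_succ, ← Nat.mul_assoc]
            omega
          · rw [hσ']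
            simp [evalCode, Instr.eval, *]
      · rw [if_neg hz]
        refine ((Run.skip hB₃).mono (N' := 7) (by omega)).post ?_
        rintro σ' rfl
        refine ⟨hB₃, by rw [hag 61 (by omega), c61], e, by omega, ?_, ?_, ?_, by omega, hhigh,
          fun r h₁ h₂ h₃ h₄ h₅ => ?_⟩
        · rw [hag a (by omega), ca]
        · rw [hag X (by omega), cX]
        · rw [hag 60 (by omega), c60]
        · rw [hag r (by omega), hfr r h₁ h₂ h₃ h₄ h₅]
    · rintro σ₄ ⟨hB₄, d61, e', g₁, ga, gX, g60, g₂, g₃, g₄⟩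
      have h3₄ : σ₄ 3 = 1 :=
        (g₄ 3 (by omega) (by omega) (by omega) (by omega) (by omega)).trans hc.1
      refine (Run.code hB₄ ?_).post ?_
      · simp [FitsCode, Instr.Fits]
      rintro σ' ⟨hσ', hB'⟩
      have hag' : ∀ r ≠ 61, σ' r = σ₄ r := fun r hr => by
        rw [hσ']
        simp [evalCode, Instr.eval, hr]
      refine ⟨hB', ?_, e', g₁, ?_, ?_, ?_, g₂, g₃, fun r k₁ k₂ k₃ k₄ k₅ => ?_⟩
      · rw [hσ']
        simp [evalCode, Instr.eval, d61, h3₄]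
        omega
      · rw [hag' a (by omega), ga]
      · rw [hag' X (by omega), gX]
      · rw [hag' 60 (by omega), g60]
      · rw [hag' r k₄, g₄ r k₁ k₂ k₃ k₄ k₅]
  · exact ⟨hB, by omega, 0, le_rfl, h0, by simp, by simp, Or.inl rfl, Or.inl rfl,
      fun _ _ _ _ _ _ => rfl⟩

/-- Report that there is no collision. -/
def giveUp : Prog := code [.add 0 4 4]

/-- Report the result of a successful search. -/
def finish : Prog := code [.add 0 3 4, .add 1 81 4, .add 2 82 4]

/-- Search for a collision between a vertex of degree at most that in register `15` and a vertex not
connected to that in register `55`. -/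
def rankSearch : Prog :=
  .seq (code [.add 59 58 4, .add 56 4 4, .add 60 3 4, .add 61 5 4]) <|
  .seq (fit 59 1 56) <|
  .seq (code [.add 63 3 4, .add 57 4 4, .add 61 5 4]) <|
  .seq (fit 63 58 57) <|
  .seq (code [.add 8 56 57, .sub 9 60 3]) <|
  .seq (search rankCircuit) (.ifNonzero 80 finish giveUp)

/-- Search for a collision of the vertex in register `81`, and if there is none, go on with the other
vertices. -/
def collisionSearch : Prog :=
  .seq (code [.add 55 81 4, .add 8 5 4, .sub 9 6 3, .add 10 44 4, .const 11 3, .const 12 7,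
    .add 13 26 4, .add 14 30 4]) <|
  .seq (search neighbourCircuit) <|
  .ifNonzero 80 finish (.seq (code [.sub 58 0 15]) (.ifNonzero 58 rankSearch giveUp))

section Programs

variable {S : Machine n} {L R w Q : ℕ} {σ : Store}

theorem finish_run (hB : Bounded S.B σ) (hc : Consts σ) :
    Run S finish σ 7 .id (fun σ' => σ' 0 = 1 ∧ σ' 1 = σ 81 ∧ σ' 2 = σ 82) := by
  refine (Run.code hB ?_).post ?_
  · have h₃ := hB 3
    rw [hc.1] at h₃
    simp only [FitsCode, Instr.eval, Instr.Fits]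
    simp [hc.1, hc.2, hB 81, hB 82, h₃]
  · rintro σ' ⟨rfl, -⟩
    simp [evalCode, Instr.eval, hc.1, hc.2]

theorem giveUp_run (hB : Bounded S.B σ) (hc : Consts σ) :
    Run S giveUp σ 3 .id (fun σ' => σ' 0 = 0) := by
  refine (Run.code hB ?_).post ?_
  · simp [FitsCode, Instr.Fits, hc.2]
  · rintro σ' ⟨rfl, -⟩
    simp [evalCode, Instr.eval, hc.2]

theorem Collides.correct {x : Input n} {i j : ℕ} (h : Collides x i j) (h₀ : σ 0 = 1) (h₁ : σ 1 = i)
    (h₂ : σ 2 = j) : x.Correct σ := by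
  obtain ⟨i', j', h', rfl, rfl⟩ := h.exists
  exact Or.inl ⟨i', j', h', h₀, h₁, h₂⟩

end Programs

section Programs

variable {S : Machine n} {L R w Q : ℕ} {σ : Store}

/-- `u` is marked and has the maximal degree `D` among the marked vertices, and it is in no
collision. -/
def Stuck (x : Input n) (w D u : ℕ) : Prop :=
  Marked x u ∧ deg x u = D ∧ (∀ v, Marked x v → deg x v ≤ D) ∧ ∀ j < 2 ^ w, ¬ Collides x u j

/-- The number of pairs of ranks is at most `4 L + 2 n`, because the first power of two is at most
`2 L / (n - D)` or else `1`, and the second is at most `2 (n - D)`. The search is complete if the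
chosen vertex is `Stuck`, which is only assumed with the corresponding probability. -/
theorem rankSearch_expect (hB : Bounded S.B σ) (hL : Layout S.x L R w σ) (hW : Wide S.B w)
    (hE : n ^ 2 ≤ S.x.E.card + L) (hLw : L < 2 ^ (2 * w))
    (hQ : ∀ m, 2 ^ m ≤ 4 * L + 2 * n → 2 ^ (m / 2) ≤ Q) {D u : ℕ} (hD : D < 2 ^ w)
    (hu : u < 2 ^ w) (h10 : σ 10 = 24 * w) (h11 : σ 11 = 3) (h12 : σ 12 = 7) (h13 : σ 13 = 6 * w)
    (h14 : σ 14 = 10 * w) (h15 : σ 15 = D) (h55 : σ 55 = u) (h58 : σ 58 = n - D)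
    (hnD : n - D ≠ 0) :
    CleanExpect S rankSearch σ (searchBound R w Q + 34 * w + 60)
      (fun σ' => miss (S.x.Correct σ')) ((3 / 4) ^ R + miss (Stuck S.x w D u)) (fun _ => True) := by
  have h3 := hL.reg_one
  have h4 := hL.reg_zero
  have h5 := hL.reg_w
  have hn := hL.n_lt
  have hwlt : w < 2 ^ w := Nat.lt_two_pow_self
  have hww : 2 ^ w ≤ 2 ^ (2 * w) := Nat.pow_le_pow_right (by omega) (by omega)
  have hB0 : S.B ≠ 0 := by have := hW.1; omega
  have hwB : 4 * 2 ^ (2 * w) ≤ 2 ^ S.B := by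
    rw [show 4 * 2 ^ (2 * w) = 2 ^ (2 * w + 2) by rw [pow_add]; ring]
    exact Nat.pow_le_pow_right (by omega) (by have := hW.1; omega)
  obtain ⟨K, hK⟩ : ∃ K, K = searchBound R w Q := ⟨_, rfl⟩
  obtain ⟨V, hV⟩ : ∃ V, V = 2 ^ (2 * w) := ⟨_, rfl⟩
  rw [← hV] at hww hwB hLw
  rw [← hK]
  refine CleanExpect.mono (N := 9 + ((w * 17 + 1) + (7 + ((w * 17 + 1) +
    (5 + (K + (7 + 1) + 1) + 1) + 1) + 1) + 1) + 1) (Q := fun _ => True) ?_ (by omega) le_rfl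
    (fun _ _ => ⟨trivial, le_rfl⟩)
  refine (Run.code hB ?_).clean_seq ?_
  · simp [FitsCode, Instr.eval, Instr.Fits, h3, h4, h5, h58]
    omega
  rintro σ₁ ⟨hσ₁, hB₁⟩
  have ag₁ : ∀ r, r < 56 ∨ r = 58 → σ₁ r = σ r := fun r hr => by
    rw [hσ₁]
    simp [evalCode, Instr.eval, show r ≠ 59 by omega, show r ≠ 56 by omega, show r ≠ 60 by omega,
      show r ≠ 61 by omega]
  have v₁ : σ₁ 59 = n - D ∧ σ₁ 56 = 0 ∧ σ₁ 60 = 1 ∧ σ₁ 61 = w := by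
    rw [hσ₁]
    simp [evalCode, Instr.eval, h3, h4, h5, h58]
  obtain ⟨a59, a56, a60, a61⟩ := v₁
  clear hσ₁
  have b1 : σ₁ 1 = L := (ag₁ 1 (by omega)).trans hL.reg_L
  refine (fit_run (X := 59) (lim := 1) (a := 56) (w := w) hB₁
    ⟨(ag₁ 3 (by omega)).trans h3, (ag₁ 4 (by omega)).trans h4⟩ (by omega) (by omega) (by omega)
    (by omega) (by omega) (by omega) (by omega) (by rw [a60]; omega) a61 a56).clean_seq ?_
  rintro σ₂ ⟨hB₂, a, ha, c56, -, c60, hlow, hhigh, fr₂⟩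
  rw [a59, b1] at hlow hhigh
  rw [a60, Nat.one_mul] at c60
  have ag₂ : ∀ r, r < 56 ∨ r = 58 → σ₂ r = σ r := fun r hr => by
    rw [fr₂ r (by omega) (by omega) (by omega) (by omega) (by omega), ag₁ r hr]
  have h3₂ := (ag₂ 3 (by omega)).trans h3
  have h4₂ := (ag₂ 4 (by omega)).trans h4
  have h5₂ := (ag₂ 5 (by omega)).trans h5
  refine (Run.code hB₂ ?_).clean_seq ?_
  · simp [FitsCode, Instr.eval, Instr.Fits, h3₂, h4₂, h5₂]
    omega
  rintro σ₃ ⟨hσ₃, hB₃⟩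
  have ag₃' : ∀ r, r ≠ 63 → r ≠ 57 → r ≠ 61 → σ₃ r = σ₂ r := fun r _ _ _ => by
    rw [hσ₃]
    simp [evalCode, Instr.eval, *]
  have v₃ : σ₃ 63 = 1 ∧ σ₃ 57 = 0 ∧ σ₃ 61 = w := by
    rw [hσ₃]
    simp [evalCode, Instr.eval, h3₂, h4₂, h5₂]
  obtain ⟨d63, d57, d61⟩ := v₃
  clear hσ₃
  have d56 := (ag₃' 56 (by omega) (by omega) (by omega)).trans c56
  have d60 := (ag₃' 60 (by omega) (by omega) (by omega)).trans c60
  have ag₃ : ∀ r, r < 56 ∨ r = 58 → σ₃ r = σ r := fun r hr => by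
    rw [ag₃' r (by omega) (by omega) (by omega), ag₂ r hr]
  have d58 := (ag₃ 58 (by omega)).trans h58
  have haw : 2 ^ a * 2 ^ w ≤ V := by
    rw [hV, ← pow_add]
    exact Nat.pow_le_pow_right (by omega) (by omega)
  refine (fit_run (X := 63) (lim := 58) (a := 57) (w := w) hB₃
    ⟨(ag₃ 3 (by omega)).trans h3, (ag₃ 4 (by omega)).trans h4⟩ (by omega) (by omega) (by omega)
    (by omega) (by omega) (by omega) (by omega) (by rw [d60]; omega) d61 d57).clean_seq ?_
  rintro σ₄ ⟨hB₄, c, hc, e57, -, e60, hlow', hhigh', fr₄⟩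
  rw [d63, d58, Nat.one_mul] at hlow' hhigh'
  rw [d60, ← pow_add] at e60
  have e56 := (fr₄ 56 (by omega) (by omega) (by omega) (by omega) (by omega)).trans d56
  have ag₄ : ∀ r < 56, σ₄ r = σ r := fun r hr => by
    rw [fr₄ r (by omega) (by omega) (by omega) (by omega) (by omega), ag₃ r (by omega)]
  refine (Run.code hB₄ ?_).clean_seq ?_
  · simp [FitsCode, Instr.Fits, e56, e57]
    omega
  rintro σ₅ ⟨hσ₅, hB₅⟩
  have ag₅' : ∀ r, r ≠ 8 → r ≠ 9 → σ₅ r = σ₄ r := fun r _ _ => by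
    rw [hσ₅]
    simp [evalCode, Instr.eval, *]
  have v₅ : σ₅ 8 = a + c ∧ σ₅ 9 = 2 ^ (a + c) - 1 := by
    rw [hσ₅]
    simp [evalCode, Instr.eval, e56, e57, e60, (ag₄ 3 (by omega)).trans h3]
  have ag₅ : ∀ r < 56, r ≠ 8 → r ≠ 9 → σ₅ r = σ r := fun r hr h₁ h₂ => by
    rw [ag₅' r h₁ h₂, ag₄ r hr]
  clear hσ₅
  have hL₅ := hL.frame (σ' := σ₅) fun r hr => ag₅ r (by omega) (by omega) (by omega)
  have hmB : 2 ^ (a + c) ≤ 4 * L + 2 * n := by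
    have hc2 : 2 ^ c ≤ 2 * (n - D) := by
      rcases hhigh' with rfl | h
      · simp; omega
      · exact h
    have h₁ := Nat.mul_le_mul_left (2 ^ a) hc2
    rw [← pow_add, show 2 ^ a * (2 * (n - D)) = 2 * ((n - D) * 2 ^ a) by ring] at h₁
    rcases hhigh with rfl | h
    · rw [pow_zero] at h₁; omega
    · omega
  have hdec := rank_decides hL₅ hW hu hD ha hc v₅.1 v₅.2
    ((ag₅ 10 (by omega) (by omega) (by omega)).trans h10)
    ((ag₅ 11 (by omega) (by omega) (by omega)).trans h11)
    ((ag₅ 12 (by omega) (by omega) (by omega)).trans h12)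
    ((ag₅ 13 (by omega) (by omega) (by omega)).trans h13)
    ((ag₅ 14 (by omega) (by omega) (by omega)).trans h14)
    ((ag₅ 15 (by omega) (by omega) (by omega)).trans h15)
    ((ag₅ 55 (by omega) (by omega) (by omega)).trans h55)
    ((ag₅' 56 (by omega) (by omega)).trans e56) ((ag₅' 57 (by omega) (by omega)).trans e57)
  have hsteps := searchSteps_le (b := rankCircuit.length) (R := R)
    (by simp [rankCircuit, collisionCircuit]) (show a + c ≤ 2 * w by omega) (hQ _ hmB)
  rw [← hK] at hsteps
  have hs := (search_expect hB₅ hdec hL₅.reg_R).add_const (miss (Stuck S.x w D u))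
  refine CleanExpect.seq (N₁ := K) (N₂ := 7 + 1)
    (hs.mono hsteps le_rfl fun σ' h => ⟨h, le_rfl⟩) ?_
  rintro σ₆ ⟨hB₆, ag₆, -, -, -⟩
  have hc₆ : Consts σ₆ :=
    ⟨(ag₆ 3 (by omega)).trans hL₅.reg_one, (ag₆ 4 (by omega)).trans hL₅.reg_zero⟩
  refine CleanExpect.ifNonzero hB₆ ?_
  by_cases h80 : σ₆ 80 = 0
  · rw [if_pos h80]
    refine ((giveUp_run hB₆ hc₆).mono (N' := 7) (by omega)).clean fun σ' h => ⟨trivial, ?_⟩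
    refine miss_le_add fun hG hS => Or.inr ⟨?_, h⟩
    obtain ⟨hm, rfl, hmax, hnbr⟩ := hS
    rintro ⟨i, j, hij⟩
    exact no_collision hn hE hm hmax hnbr hlow hlow' (hG.2 h80) i j hij
  · rw [if_neg h80]
    refine (finish_run hB₆ hc₆).clean fun σ' h => ⟨trivial, ?_⟩
    refine miss_le_add fun hG _ => ?_
    obtain ⟨y, -, hy, k₁, k₂⟩ := hG.1 h80
    exact hy.correct h.1 (h.2.1.trans k₁) (h.2.2.trans k₂)

theorem collisionSearch_expect (hB : Bounded S.B σ) (hL : Layout S.x L R w σ) (hW : Wide S.B w)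
    (hE : n ^ 2 ≤ S.x.E.card + L) (hLw : L < 2 ^ (2 * w)) (hwQ : 2 ^ (w / 2) ≤ Q)
    (hQ : ∀ m, 2 ^ m ≤ 4 * L + 2 * n → 2 ^ (m / 2) ≤ Q) (h15 : σ 15 < 2 ^ w)
    (h81 : σ 81 < 2 ^ w) (h80 : σ 80 ≠ 0) :
    CleanExpect S collisionSearch σ (2 * searchBound R w Q + 34 * w + 100)
      (fun σ' => miss (S.x.Correct σ')) (2 * (3 / 4) ^ R + miss (MaxFound S.x σ))
      (fun _ => True) := by
  obtain ⟨ε, hε⟩ : ∃ ε : ℝ, ε = (3 / 4) ^ R := ⟨_, rfl⟩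
  obtain ⟨K, hK⟩ : ∃ K, K = searchBound R w Q := ⟨_, rfl⟩
  have h3 := hL.reg_one
  have h4 := hL.reg_zero
  have h5 := hL.reg_w
  have h6 := hL.reg_pow
  have r26 := hL.mul 26 6 rfl (by omega)
  have r30 := hL.mul 30 10 rfl (by omega)
  have r44 := hL.mul 44 24 rfl (by omega)
  have hWB := hW.2
  obtain ⟨D, hD⟩ : ∃ D, σ 15 = D := ⟨_, rfl⟩
  obtain ⟨u, hu⟩ : ∃ u, σ 81 = u := ⟨_, rfl⟩
  have h81B := hB 81
  rw [← hK, ← hε]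
  refine CleanExpect.mono (N := 17 + (K + ((3 + ((K + 34 * w + 60) + 1) + 1) + 1) + 1) + 1)
    (Q := fun _ => True) ?_ (by omega) le_rfl (fun _ _ => ⟨trivial, le_rfl⟩)
  refine (Run.code hB ?_).clean_seq ?_
  · simp [FitsCode, Instr.eval, Instr.Fits, h4, h5, r26, r30, r44]
    omega
  rintro σ₁ ⟨hσ₁, hB₁⟩
  have ag₁ : ∀ r < 55, (r < 8 ∨ 14 < r) → σ₁ r = σ r := fun r h h' => by
    rw [hσ₁]
    simp [evalCode, Instr.eval, show r ≠ 8 by omega, show r ≠ 9 by omega, show r ≠ 10 by omega,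
      show r ≠ 11 by omega, show r ≠ 12 by omega, show r ≠ 13 by omega, show r ≠ 14 by omega,
      show r ≠ 55 by omega]
  have v₁ : σ₁ 8 = w ∧ σ₁ 9 = 2 ^ w - 1 ∧ σ₁ 10 = 24 * w ∧ σ₁ 11 = 3 ∧ σ₁ 12 = 7 ∧
      σ₁ 13 = 6 * w ∧ σ₁ 14 = 10 * w ∧ σ₁ 55 = u := by
    rw [hσ₁]
    simp [evalCode, Instr.eval, h3, h4, h5, h6, r26, r30, r44, hu]
  obtain ⟨a8, a9, a10, a11, a12, a13, a14, a55⟩ := v₁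
  clear hσ₁
  have hL₁ := hL.frame (σ' := σ₁) fun r hr => ag₁ r (by omega) (by omega)
  rw [hD] at h15
  rw [hu] at h81
  have hdec := neighbour_decides hL₁ hW h81 a8 a9 a10 a11 a12 a13 a14 a55
  have hsteps := searchSteps_le (b := neighbourCircuit.length) (R := R)
    (by simp [neighbourCircuit, collisionCircuit]) (show w ≤ 2 * w by omega) hwQ
  rw [← hK] at hsteps
  -- the constant provides for the last search and for a wrong choice of the vertex
  have hs := (search_expect hB₁ hdec hL₁.reg_R).add_const (ε + miss (MaxFound S.x σ))
  rw [← hε] at hs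
  refine CleanExpect.seq (N₁ := K) (N₂ := (3 + ((K + 34 * w + 60) + 1) + 1) + 1)
    (hs.mono hsteps (by linarith) fun σ' h => ⟨h, le_rfl⟩) ?_
  rintro σ₂ ⟨hB₂, ag₂, -, -, -⟩
  have hL₂ := hL₁.frame (σ' := σ₂) fun r hr => ag₂ r (by omega)
  have hc₂ : Consts σ₂ := ⟨hL₂.reg_one, hL₂.reg_zero⟩
  have hε0 : 0 ≤ ε := by rw [hε]; positivity
  have hM := miss_nonneg (MaxFound S.x σ)
  refine CleanExpect.ifNonzero hB₂ ?_
  by_cases hf : σ₂ 80 = 0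
  · rw [if_pos hf]
    have hstuck := miss_le_add (T := Stuck S.x w D u)
      (P := GoodResult w (Collides S.x u) (fun _ => u) id σ₂) (Q := MaxFound S.x σ) fun hG hm => by
        obtain ⟨k₁, k₂, k₃⟩ := hm.1 h80
        rw [hu] at k₁ k₂
        rw [hD] at k₂ k₃
        exact ⟨k₁, k₂, k₃, hG.2 hf⟩
    have b15 : σ₂ 15 = D := by rw [ag₂ 15 (by omega), ag₁ 15 (by omega) (by omega), hD]
    refine (Run.code hB₂ ?_).clean_seq ?_
    · simp [FitsCode, Instr.Fits]
    rintro σ₃ ⟨hσ₃, hB₃⟩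
    have ag₃' : ∀ r ≠ 58, σ₃ r = σ₂ r := fun r hr => by
      rw [hσ₃]
      simp [evalCode, Instr.eval, hr]
    have c58 : σ₃ 58 = n - D := by
      rw [hσ₃]
      simp [evalCode, Instr.eval, hL₂.reg_n, b15]
    clear hσ₃
    have ag₃ : ∀ r < 58, σ₃ r = σ₁ r := fun r hr => by rw [ag₃' r (by omega), ag₂ r (by omega)]
    have hL₃ := hL₂.frame (σ' := σ₃) fun r hr => ag₃' r (by omega)
    refine CleanExpect.ifNonzero hB₃ ?_
    by_cases hz : σ₃ 58 = 0
    · rw [if_pos hz]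
      refine ((giveUp_run hB₃ ⟨hL₃.reg_one, hL₃.reg_zero⟩).mono (N' := K + 34 * w + 60)
        (by omega)).clean fun σ' h => ⟨trivial, ?_⟩
      have hcorr : miss (S.x.Correct σ') ≤ miss (Stuck S.x w D u) := miss_le fun hS =>
        Or.inr ⟨?_, h⟩
      · linarith
      obtain ⟨k₁, k₂, k₃, k₄⟩ := hS
      rintro ⟨i, j, hij⟩
      exact no_collision_of_full hL.n_lt k₁ k₄ (by omega) i j hij
    · rw [if_neg hz]
      refine (rankSearch_expect hB₃ hL₃ hW hE hLw hQ h15 h81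
        ((ag₃ 10 (by omega)).trans a10) ((ag₃ 11 (by omega)).trans a11)
        ((ag₃ 12 (by omega)).trans a12) ((ag₃ 13 (by omega)).trans a13)
        ((ag₃ 14 (by omega)).trans a14) ((ag₃' 15 (by omega)).trans b15)
        ((ag₃ 55 (by omega)).trans a55) c58 (by omega)).mono (by omega) ?_
        fun _ h => ⟨h, le_rfl⟩
      rw [← hε]
      linarith
  · rw [if_neg hf]
    refine ((finish_run hB₂ hc₂).mono (N' := 3 + ((K + 34 * w + 60) + 1) + 1)
      (by omega)).clean fun σ' h => ⟨trivial, ?_⟩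
    have hcorr : miss (S.x.Correct σ') ≤ miss (GoodResult w (Collides S.x u) (fun _ => u) id σ₂) :=
      miss_le fun hG => by
        obtain ⟨y, -, hy, k₁, k₂⟩ := hG.1 hf
        exact hy.correct h.1 (h.2.1.trans k₁) (h.2.2.trans k₂)
    linarith

end Programs

/-! ### The whole algorithm -/

theorem evalCode_append (l l' : List Instr) (σ : Store) :
    evalCode (l ++ l') σ = evalCode l' (evalCode l σ) := by
  induction l generalizing σ with
  | nil => rfl
  | cons c l ih => exact ih _

theorem FitsCode.append {B : ℕ} {l l' : List Instr} {σ : Store} (h : FitsCode B l σ)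
    (h' : FitsCode B l' (evalCode l σ)) : FitsCode B (l ++ l') σ := by
  induction l generalizing σ with
  | nil => exact h'
  | cons c l ih => exact ⟨h.1, ih h.2 h'⟩

/-- Add register `63` to register `7` as often as `k` says. -/
theorem evalCode_replicate (k : ℕ) (σ : Store) :
    evalCode (List.replicate k (.add 7 7 63)) σ = Function.update σ 7 (σ 7 + k * σ 63) := by
  induction k generalizing σ with
  | zero => simp [evalCode]
  | succ k ih =>
    rw [List.replicate_succ, evalCode, ih]
    simp only [Instr.eval, Function.update_idem, Function.update_self,
      Function.update_of_ne (show (63 : ℕ) ≠ 7 by omega)]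
    congr 1
    ring

theorem fitsCode_replicate {B k : ℕ} {σ : Store} (h : σ 7 + k * σ 63 < 2 ^ B) :
    FitsCode B (List.replicate k (.add 7 7 63)) σ := by
  induction k generalizing σ with
  | zero => trivial
  | succ k ih =>
    rw [List.replicate_succ]
    rw [Nat.succ_mul] at h
    refine ⟨show σ 7 + σ 63 < 2 ^ B by omega, ih ?_⟩
    simp only [Instr.eval, Function.update_self,
      Function.update_of_ne (show (63 : ℕ) ≠ 7 by omega)]
    omega

/-- Put the multiples of register `5` in the registers from `21` on. -/
def multiples (k : ℕ) : List Instr := (List.range k).map fun i => .add (21 + i) (20 + i) 5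

theorem evalCode_multiples {σ : Store} (h : σ 20 = 0) (k r : ℕ) :
    evalCode (multiples k) σ r = if 20 ≤ r ∧ r ≤ 20 + k then (r - 20) * σ 5 else σ r := by
  induction k generalizing r with
  | zero =>
    simp only [multiples, List.range_zero, List.map_nil, evalCode]
    split_ifs with hr
    · obtain rfl : r = 20 := by omega
      simpa using h
    · rfl
  | succ k ih =>
    have e : multiples (k + 1) = multiples k ++ [.add (21 + k) (20 + k) 5] := by
      simp [multiples, List.range_succ]
    rw [e, evalCode_append]
    simp only [evalCode, Instr.eval]
    by_cases hr : r = 21 + k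
    · subst hr
      rw [Function.update_self, ih, ih, if_pos (by omega), if_neg (by omega), if_pos (by omega),
        show 20 + k - 20 = k by omega, show 21 + k - 20 = k + 1 by omega]
      ring
    · rw [Function.update_of_ne hr, ih]
      refine if_congr ?_ rfl rfl
      omega

theorem fitsCode_multiples {B : ℕ} {σ : Store} (h : σ 20 = 0) {k : ℕ} (hk : k * σ 5 < 2 ^ B) :
    FitsCode B (multiples k) σ := by
  induction k with
  | zero => trivial
  | succ k ih =>
    have e : multiples (k + 1) = multiples k ++ [.add (21 + k) (20 + k) 5] := by
      simp [multiples, List.range_succ]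
    rw [Nat.succ_mul] at hk
    rw [e]
    refine (ih (by omega)).append ⟨?_, trivial⟩
    simp only [Instr.Fits]
    rw [evalCode_multiples h, evalCode_multiples h, if_pos (by omega), if_neg (by omega),
      show 20 + k - 20 = k by omega]
    exact hk

/-- Compute the word length `w`, the number `3 * (c + 2) * w` of repetitions in a search, and the
addresses. -/
def init (c : ℕ) : Prog :=
  .seq (code [.const 3 1, .add 6 3 4, .add 60 0 4]) <|
  .seq (.whileNonzero 60 (code [.half 60 60, .add 5 5 3, .add 6 6 6])) <|
  .seq (code [.add 63 5 5, .add 63 63 5]) <|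
  .seq (code (List.replicate (c + 2) (.add 7 7 63))) <|
  .seq (code (multiples 32)) (code [.add 53 44 3, .add 54 53 3])

/-- Graph collision: find a marked vertex of maximal degree; if it has no collision, then search
among the vertices of at most the same degree and the vertices not connected to it. -/
def graphCollision (c : ℕ) : Prog :=
  .seq (init c) (.seq maxDegree (.ifNonzero 80 collisionSearch giveUp))

theorem init_run {S : Machine n} {σ : Store} {L c w : ℕ} (hw : w = Nat.size n) (hn : 0 < n)
    (hB : Bounded S.B σ) (h0 : σ 0 = n) (h1 : σ 1 = L) (h2 : σ 2 = S.x.k)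
    (hσ : ∀ r, 2 < r → σ r = 0) (hW : Wide S.B w) (hR : (c + 2) * (3 * w) < 2 ^ S.B) :
    Run S (init c) σ (8 * w + 2 * c + 100) .id
      (fun σ' => Bounded S.B σ' ∧ Layout S.x L ((c + 2) * (3 * w)) w σ') := by
  have hB0 : S.B ≠ 0 := by have := hW.1; omega
  have hWB := hW.2
  refine Run.mono (N := 7 + ((w * 8 + 1) + (5 + ((2 * (c + 2) + 1) + (65 + 5 + 1) + 1) + 1) + 1) + 1)
    ?_ (by omega)
  refine (Run.code hB ?_).seq_id ?_
  · have := hB 0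
    rw [h0] at this
    simp [FitsCode, Instr.eval, Instr.Fits, hσ 4 (by omega), h0, this]
    omega
  rintro σ₁ ⟨hσ₁, hB₁⟩
  have ag₁ : ∀ r, r ≠ 3 → r ≠ 6 → r ≠ 60 → σ₁ r = σ r := fun r _ _ _ => by
    rw [hσ₁]
    simp [evalCode, Instr.eval, *]
  have v₁ : σ₁ 3 = 1 ∧ σ₁ 6 = 1 ∧ σ₁ 60 = n := by
    rw [hσ₁]
    simp [evalCode, Instr.eval, hσ 4 (by omega), h0]
  obtain ⟨a3, a6, a60⟩ := v₁
  clear hσ₁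
  refine (Run.while_id (N := 7) (l := w) (Inv := fun i σ' => Bounded S.B σ' ∧ σ' 60 = n / 2 ^ i ∧
    σ' 5 = i ∧ σ' 6 = 2 ^ i ∧ ∀ r, r ≠ 5 → r ≠ 6 → r ≠ 60 → σ' r = σ₁ r) ?_ ?_ ?_).seq_id ?_
  · rintro i hi σ' ⟨hB', h60, -⟩
    refine ⟨hB', ?_⟩
    rw [h60, Nat.div_eq_zero_iff, ← Nat.size_le, ← hw]
    have := Nat.one_le_two_pow (n := i)
    omega
  · rintro i hi σ₂ ⟨hB₂, c60, c5, c6, ag₂⟩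
    have h3 := (ag₂ 3 (by omega) (by omega) (by omega)).trans a3
    have hpow : 2 ^ i * 2 ≤ 2 ^ w := by
      rw [← pow_succ]
      exact Nat.pow_le_pow_right (by omega) (by omega)
    have hwB : 2 ^ w < 2 ^ S.B := Nat.pow_lt_pow_right (by omega) (by have := hW.1; omega)
    refine (Run.code hB₂ ?_).post ?_
    · simp [FitsCode, Instr.eval, Instr.Fits, h3, c5, c6]
      omega
    · rintro σ' ⟨hσ', hB'⟩
      refine ⟨hB', ?_, ?_, ?_, fun r _ _ _ => ?_⟩
      · rw [hσ', pow_succ, ← Nat.div_div_eq_div_mul, ← c60]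
        simp [evalCode, Instr.eval]
      · rw [hσ']
        simp [evalCode, Instr.eval, c5, h3]
      · rw [hσ']
        simp [evalCode, Instr.eval, c6]
        ring
      · rw [hσ', ← ag₂ r (by assumption) (by assumption) (by assumption)]
        simp [evalCode, Instr.eval, *]
  · refine ⟨hB₁, by simpa using a60, ?_, by simpa using a6, fun _ _ _ _ => rfl⟩
    rw [ag₁ 5 (by omega) (by omega) (by omega), hσ 5 (by omega)]
  rintro σ₂ ⟨hB₂, -, c5, c6, ag₂⟩
  refine (Run.code hB₂ ?_).seq_id ?_
  · simp [FitsCode, Instr.eval, Instr.Fits, c5]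
    omega
  rintro σ₃ ⟨hσ₃, hB₃⟩
  have ag₃ : ∀ r ≠ 63, σ₃ r = σ₂ r := fun r _ => by
    rw [hσ₃]
    simp [evalCode, Instr.eval, *]
  have d63 : σ₃ 63 = 3 * w := by
    rw [hσ₃]
    simp [evalCode, Instr.eval, c5]
    ring
  clear hσ₃
  have base : ∀ r, r ≠ 3 → r ≠ 5 → r ≠ 6 → r ≠ 60 → r ≠ 63 → σ₃ r = σ r := fun r _ _ _ _ _ => by
    rw [ag₃ r (by assumption), ag₂ r (by assumption) (by assumption) (by assumption),
      ag₁ r (by assumption) (by assumption) (by assumption)]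
  have d7 : σ₃ 7 = 0 := by
    rw [base 7 (by omega) (by omega) (by omega) (by omega) (by omega), hσ 7 (by omega)]
  refine Run.seq_id (N₁ := 2 * (c + 2) + 1) (N₂ := 65 + 5 + 1)
    ((Run.code hB₃ (fitsCode_replicate (by rwa [d7, d63, Nat.zero_add]))).mono (by simp)) ?_
  rintro σ₄ ⟨hσ₄, hB₄⟩
  rw [evalCode_replicate, d7, d63, Nat.zero_add] at hσ₄
  have ag₄ : ∀ r ≠ 7, σ₄ r = σ₃ r := fun r hr => by
    rw [hσ₄, Function.update_of_ne hr]
  have e7 : σ₄ 7 = (c + 2) * (3 * w) := by rw [hσ₄, Function.update_self]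
  have e20 : σ₄ 20 = 0 := by
    rw [ag₄ 20 (by omega), base 20 (by omega) (by omega) (by omega) (by omega) (by omega),
      hσ 20 (by omega)]
  have e5 : σ₄ 5 = w := by rw [ag₄ 5 (by omega), ag₃ 5 (by omega), c5]
  clear hσ₄
  refine Run.seq_id (N₁ := 65) (N₂ := 5)
    ((Run.code hB₄ (fitsCode_multiples e20 (by rw [e5]; omega))).mono (by simp [multiples])) ?_
  rintro σ₅ ⟨hσ₅, hB₅⟩
  have ag₅ : ∀ r < 20, σ₅ r = σ₄ r := fun r hr => by
    rw [hσ₅, evalCode_multiples e20, if_neg (by omega)]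
  have mul : ∀ i ≤ 32, σ₅ (20 + i) = i * w := fun i hi => by
    rw [hσ₅, evalCode_multiples e20, if_pos (by omega), e5, Nat.add_sub_cancel_left]
  have f3 : σ₅ 3 = 1 := by
    rw [ag₅ 3 (by omega), ag₄ 3 (by omega), ag₃ 3 (by omega), ag₂ 3 (by omega) (by omega) (by omega),
      a3]
  have f44 := mul 24 (by omega)
  refine (Run.code hB₅ ?_).post ?_
  · simp [FitsCode, Instr.eval, Instr.Fits, f3, f44]
    omega
  rintro σ' ⟨hσ', hB'⟩
  have ag : ∀ r, r ≠ 53 → r ≠ 54 → σ' r = σ₅ r := fun r _ _ => by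
    rw [hσ']
    simp [evalCode, Instr.eval, *]
  have low : ∀ r < 20, σ' r = σ₄ r := fun r hr => by
    rw [ag r (by omega) (by omega), ag₅ r hr]
  have low' : ∀ r < 20, r ≠ 3 → r ≠ 5 → r ≠ 6 → r ≠ 7 → σ' r = σ r := fun r hr _ _ _ h7 => by
    rw [low r hr, ag₄ r h7, base r (by assumption) (by assumption) (by assumption) (by omega)
      (by omega)]
  refine ⟨hB', hw, hn, ?_, ?_, ?_, ?_, ?_, ?_, ?_, ?_, fun i hi => ?_, ?_, ?_⟩
  · rw [low' 0 (by omega) (by omega) (by omega) (by omega) (by omega), h0]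
  · rw [low' 1 (by omega) (by omega) (by omega) (by omega) (by omega), h1]
  · rw [low' 2 (by omega) (by omega) (by omega) (by omega) (by omega), h2]
  · rw [ag 3 (by omega) (by omega), f3]
  · rw [low' 4 (by omega) (by omega) (by omega) (by omega) (by omega), hσ 4 (by omega)]
  · rw [low 5 (by omega), e5]
  · rw [low 6 (by omega), ag₄ 6 (by omega), ag₃ 6 (by omega), c6]
  · rw [low 7 (by omega), e7]
  · rw [ag _ (by omega) (by omega), mul i hi]
  · rw [hσ']
    simp [evalCode, Instr.eval, f3, f44]
  · rw [hσ']
    simp [evalCode, Instr.eval, f3, f44]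

theorem graphCollision_expect {S : Machine n} {σ : Store} {L c w Q : ℕ} (hw : w = Nat.size n)
    (hn : 0 < n) (hB : Bounded S.B σ) (h0 : σ 0 = n) (h1 : σ 1 = L) (h2 : σ 2 = S.x.k)
    (hσ : ∀ r, 2 < r → σ r = 0) (hW : Wide S.B w) (hR : (c + 2) * (3 * w) < 2 ^ S.B)
    (hE : n ^ 2 ≤ S.x.E.card + L) (hLn : L ≤ n ^ 2)
    (hQ : ∀ m, 2 ^ m ≤ 4 * L + 2 * n → 2 ^ (m / 2) ≤ Q) :
    CleanExpect S (graphCollision c) σ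
      ((w + 3) * (searchBound ((c + 2) * (3 * w)) w Q + 110) + 2 * c)
      (fun σ' => miss (S.x.Correct σ')) ((w + 3) * (3 / 4) ^ ((c + 2) * (3 * w)))
      (fun _ => True) := by
  obtain ⟨R, hRe⟩ : ∃ R, R = (c + 2) * (3 * w) := ⟨_, rfl⟩
  have hinit := init_run hw hn hB h0 h1 h2 hσ hW hR
  rw [← hRe] at hinit ⊢
  obtain ⟨ε, hε⟩ : ∃ ε : ℝ, ε = (3 / 4) ^ R := ⟨_, rfl⟩
  have hε0 : 0 ≤ ε := by rw [hε]; positivity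
  obtain ⟨K, hK⟩ : ∃ K, K = searchBound R w Q := ⟨_, rfl⟩
  have hwn : 2 ^ w ≤ 2 * n := by
    have hpos : 0 < w := by rw [hw]; exact Nat.size_pos.2 hn
    obtain ⟨v, rfl⟩ : ∃ v, w = v + 1 := ⟨w - 1, by omega⟩
    have := (Nat.lt_size (m := v) (n := n)).1 (by omega)
    rw [pow_succ]
    omega
  have hwQ : 2 ^ (w / 2) ≤ Q := hQ w (by omega)
  have hLw : L < 2 ^ (2 * w) := by
    refine hLn.trans_lt ?_
    rw [Nat.mul_comm, pow_mul]
    exact Nat.pow_lt_pow_left (by rw [hw]; exact Nat.lt_size_self n) (by omega)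
  rw [← hK, ← hε]
  refine CleanExpect.mono (N := (8 * w + 2 * c + 100) + (((w + 1) * (K + 60)) +
    ((2 * K + 34 * w + 100) + 1) + 1) + 1) (Q := fun _ => True) ?_ ?_ le_rfl
    (fun _ _ => ⟨trivial, le_rfl⟩)
  · refine hinit.clean_seq ?_
    rintro σ₁ ⟨hB₁, hL₁⟩
    -- the constant provides for the two searches that follow
    have hs := (maxDegree_expect hB₁ hL₁ hW hwQ).add_const (2 * ε)
    rw [← hK, ← hε] at hs
    refine CleanExpect.seq (hs.mono le_rfl (by linarith) fun σ' h => ⟨h, le_rfl⟩) ?_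
    rintro σ₂ ⟨hB₂, hF₂, h15, h81⟩
    have hL₂ := hL₁.frame hF₂
    refine CleanExpect.ifNonzero hB₂ ?_
    by_cases h80 : σ₂ 80 = 0
    · rw [if_pos h80]
      refine ((giveUp_run hB₂ ⟨hL₂.reg_one, hL₂.reg_zero⟩).mono (N' := 2 * K + 34 * w + 100)
        (by omega)).clean fun σ' h => ⟨trivial, ?_⟩
      have : miss (S.x.Correct σ') ≤ miss (MaxFound S.x σ₂) := miss_le fun hm =>
        Or.inr ⟨fun ⟨i, j, hij⟩ => hm.2 h80 i (marked_val.2 hij.2.1), h⟩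
      linarith
    · rw [if_neg h80]
      refine (collisionSearch_expect hB₂ hL₂ hW hE hLw hwQ hQ h15 h81 h80).mono (by omega) ?_
        fun _ h => ⟨h, le_rfl⟩
      rw [← hε]
      linarith
  · ring_nf
    omega

/-! ### Success probability and running time -/

/-- A program that runs as expected from the start of the computation halts in time and is correct
with the expected probability. -/
theorem CleanExpect.success {S : Machine n} {P : Prog} {L N : ℕ} {v : ℝ}
    (h : CleanExpect S P (start P S.x L).store N (fun σ' => miss (S.x.Correct σ')) v
      (fun _ => True)) :
    HaltsWithin P S.x L S.κ (N * S.unit) ∧ 1 - v ≤ successProb P S.x L S.κ (N * S.unit) := by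
  obtain ⟨outs, h₁, -, h₃⟩ := h 1
  have hu : N ≤ N * S.unit := Nat.le_mul_of_pos_right _ (by unfold Machine.unit; omega)
  obtain ⟨hmap, htime⟩ := h₁.halts 0 (N * S.unit) hu
  have hstart : start P S.x L = ⟨[P], (start P S.x L).store, Finsupp.single blank 1, 0⟩ := rfl
  rw [← hstart] at hmap htime
  refine ⟨fun C hC _ => ⟨?_, by simpa using htime C hC⟩, ?_⟩
  · have hC' := List.mem_map_of_mem (f := fun C : Config => (C.todo, C.store, C.state)) hC
    rw [hmap] at hC'
    obtain ⟨o, -, ho⟩ := List.mem_map.1 hC'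
    exact (congrArg Prod.fst ho).symm
  · classical
    have hsum := congrArg (fun l : List (List Prog × Store × QState) => (l.map fun y =>
      if y.1 = [] ∧ S.x.Correct y.2.1 then weight y.2.2 else 0).sum) hmap
    simp only [List.map_map, Function.comp_def, true_and] at hsum
    have hw := h₁.weight_sum
    have hsplit : (outs.map fun o => if S.x.Correct o.1 then weight o.2 else 0).sum +
        (outs.map fun o => miss (S.x.Correct o.1) * weight o.2).sum =
          (outs.map fun o => weight o.2).sum := by
      rw [← List.sum_map_add]
      refine congrArg List.sum (List.map_congr_left fun o _ => ?_)
      by_cases ho : S.x.Correct o.1 <;> simp [ho, miss]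
    have hone : weight (Finsupp.single blank (1 : ℂ)) = 1 := by simp [weight]
    have hprob : successProb P S.x L S.κ (N * S.unit) =
        (outs.map fun o => if S.x.Correct o.1 then weight o.2 else 0).sum := by
      rw [← hsum, successProb]
    rw [hprob]
    simp only [norm_one, one_pow, mul_one] at h₃
    linarith

/-- The word length is logarithmic. -/
theorem size_le_log (hn : 1 ≤ n) : (Nat.size n : ℝ) ≤ 2 * (1 + Real.log n) := by
  have hpos : 0 < Nat.size n := Nat.size_pos.2 hn
  obtain ⟨v, hv⟩ : ∃ v, Nat.size n = v + 1 := ⟨Nat.size n - 1, by omega⟩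
  have h₁ : 2 ^ v ≤ n := (Nat.lt_size).1 (by omega)
  have h₂ : (2 : ℝ) ^ v ≤ n := by exact_mod_cast h₁
  have h₃ := Real.log_le_log (by positivity) h₂
  rw [Real.log_pow] at h₃
  have h₄ : (1 : ℝ) / 2 < Real.log 2 := by have := Real.log_two_gt_d9; linarith
  have h₅ : (v : ℝ) * (1 / 2) ≤ v * Real.log 2 := by gcongr
  rw [hv]
  push_cast
  linarith

/-- The union bound over the `w + 3` searches: `(3 / 4) ^ 3` is at most `1 / 2`, `w + 3` is at most
`4 ^ w`, and `n + 1` is at most `2 ^ w`. -/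
theorem error_le (hn : 1 ≤ n) (c : ℕ) :
    ((Nat.size n : ℝ) + 3) * (3 / 4) ^ ((c + 2) * (3 * Nat.size n)) ≤ 1 / ((n : ℝ) + 1) ^ c := by
  have hw : 0 < Nat.size n := Nat.size_pos.2 hn
  have hn' : n + 1 ≤ 2 ^ Nat.size n := Nat.lt_size_self n
  generalize Nat.size n = w at hw hn'
  have h₁ : ((3 : ℝ) / 4) ^ ((c + 2) * (3 * w)) ≤ (1 / 2) ^ ((c + 2) * w) := by
    rw [show (c + 2) * (3 * w) = 3 * ((c + 2) * w) by ring, pow_mul]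
    exact pow_le_pow_left₀ (by norm_num) (by norm_num) _
  have h₂ : ((w : ℝ) + 3) ≤ 4 ^ w := by
    have : w + 3 ≤ 4 ^ w := by
      clear h₁ hn'
      induction w, hw using Nat.le_induction with
      | base => norm_num
      | succ w _ ih => rw [pow_succ]; omega
    exact_mod_cast this
  have h₃ : ((n : ℝ) + 1) ^ c ≤ 2 ^ (c * w) := by
    rw [Nat.mul_comm, pow_mul]
    exact pow_le_pow_left₀ (by positivity) (by exact_mod_cast hn') c
  calc ((w : ℝ) + 3) * (3 / 4) ^ ((c + 2) * (3 * w))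
      ≤ 4 ^ w * (1 / 2) ^ ((c + 2) * w) := by gcongr
    _ = 1 / 2 ^ (c * w) := by
      rw [Nat.add_mul, pow_add, pow_mul (1 / 2 : ℝ) 2 w, one_div_pow, mul_comm (1 / 2 ^ (c * w)),
        ← mul_assoc, ← mul_pow]
      norm_num
    _ ≤ 1 / ((n : ℝ) + 1) ^ c := one_div_le_one_div_of_le (by positivity) h₃

/-- A bound for the running time: the number of steps times the cost of a step, where the registers
have at most `2 w + 3 c + 20` bits. -/
def timeBound (c : ℕ) (κ : ℕ → ℕ) (n L : ℕ) : ℕ :=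
  ((Nat.size n + 3) * (searchBound ((c + 2) * (3 * Nat.size n)) (Nat.size n)
    (Nat.sqrt (4 * L + 2 * n)) + 110) + 2 * c) * (κ n + 3 * (2 * Nat.size n + 3 * c + 20) + 3)

theorem sqrt_le (L n : ℕ) : (Nat.sqrt (4 * L + 2 * n) : ℝ) ≤ 2 * (√(L : ℝ) + √(n : ℝ)) := by
  refine (Real.nat_sqrt_le_real_sqrt).trans ?_
  refine Real.sqrt_le_iff.2 ⟨by positivity, ?_⟩
  have h₁ := Real.sq_sqrt (Nat.cast_nonneg (α := ℝ) L)
  have h₂ := Real.sq_sqrt (Nat.cast_nonneg (α := ℝ) n)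
  have h₃ := Real.sqrt_nonneg (L : ℝ)
  have h₄ := Real.sqrt_nonneg (n : ℝ)
  push_cast
  nlinarith [mul_nonneg h₃ h₄]

theorem add_le_mul_of_one_le {X A Y B : ℝ} (h : X ≤ A * Y) (hY : 1 ≤ Y) (hB : 0 ≤ B) :
    X + B ≤ (A + B) * Y := by
  nlinarith

theorem timeBound_isSoftO (c : ℕ) {κ : ℕ → ℕ} (hκ : IsPolylog κ) :
    IsSoftO (timeBound c κ) (fun n L => √(L : ℝ) + √(n : ℝ)) := by
  obtain ⟨C, a, hC⟩ := hκ
  obtain ⟨C₁, hC₁⟩ : ∃ C₁ : ℝ, C₁ = (6 * ((c : ℝ) + 2) * 44806 + 20) * 3 + 20 := ⟨_, rfl⟩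
  refine ⟨((C₁ + 110) * 5 + 2 * c) * (|C| + (12 + (9 * c + 63))), 4 + (a + 1),
    fun n L hn _ => ?_⟩
  have hw := size_le_log hn
  have hQ := sqrt_le L n
  have hκ := hC n hn
  unfold timeBound searchBound
  generalize Nat.sqrt (4 * L + 2 * n) = Q at hQ
  generalize Nat.size n = w at hw
  obtain ⟨s, hs⟩ : ∃ s, s = √(L : ℝ) + √(n : ℝ) := ⟨_, rfl⟩
  obtain ⟨l, hl⟩ : ∃ l, l = 1 + Real.log n := ⟨_, rfl⟩
  have hl1 : 1 ≤ l := by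
    rw [hl]
    have := Real.log_nonneg (show (1 : ℝ) ≤ n by exact_mod_cast hn)
    linarith
  have hs1 : 1 ≤ s := by
    rw [hs]
    have h₁ : 1 ≤ √(n : ℝ) := Real.one_le_sqrt.2 (by exact_mod_cast hn)
    have := Real.sqrt_nonneg (L : ℝ)
    linarith
  simp only
  rw [← hs] at hQ ⊢
  rw [← hl] at hw hκ ⊢
  push_cast
  have hw0 : (0 : ℝ) ≤ w := Nat.cast_nonneg w
  have hQ0 : (0 : ℝ) ≤ Q := Nat.cast_nonneg Q
  have hc0 : (0 : ℝ) ≤ c := Nat.cast_nonneg c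
  have g₁ : ((Q : ℝ) + 3) * (56 * (20 * (2 * w + 3) + 20)) + 6 ≤ 44806 * (s * l) := by
    have k₁ : (Q : ℝ) + 3 ≤ 5 * s := by linarith
    have k₂ : (56 * (20 * (2 * (w : ℝ) + 3) + 20)) ≤ 8960 * l := by linarith
    have := add_le_mul_of_one_le (B := 6) (A := 44800) (Y := s * l)
      ((mul_le_mul k₁ k₂ (by positivity) (by positivity)).trans_eq (by ring))
      (one_le_mul_of_one_le_of_one_le hs1 hl1) (by norm_num)
    linarith
  have g₂ : ((c : ℝ) + 2) * (3 * w) ≤ 6 * (c + 2) * l := by nlinarith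
  have g₃ := add_le_mul_of_one_le (B := 20) (A := 6 * ((c : ℝ) + 2) * 44806) (Y := s * l ^ 2)
    ((mul_le_mul g₂ g₁ (by positivity) (by positivity)).trans_eq (by ring))
    (one_le_mul_of_one_le_of_one_le hs1 (one_le_pow₀ hl1)) (by norm_num)
  have g₄ : (w : ℝ) + 1 ≤ 3 * l := by linarith
  have g₅ := add_le_mul_of_one_le (B := 20) (A := (6 * ((c : ℝ) + 2) * 44806 + 20) * 3)
    (Y := s * l ^ 3) ((mul_le_mul g₄ g₃ (by positivity) (by positivity)).trans_eq (by ring))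
    (one_le_mul_of_one_le_of_one_le hs1 (one_le_pow₀ hl1)) (by norm_num)
  rw [← hC₁, add_comm _ (20 : ℝ)] at g₅
  have g₆ := add_le_mul_of_one_le (B := 110) g₅
    (one_le_mul_of_one_le_of_one_le hs1 (one_le_pow₀ hl1)) (by norm_num)
  have g₇ : (w : ℝ) + 3 ≤ 5 * l := by linarith
  have g₈ := add_le_mul_of_one_le (B := 2 * (c : ℝ)) (A := (C₁ + 110) * 5) (Y := s * l ^ 4)
    ((mul_le_mul g₇ g₆ (by positivity) (by positivity)).trans_eq (by ring))
    (one_le_mul_of_one_le_of_one_le hs1 (one_le_pow₀ hl1)) (by positivity)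
  have g₉ : (κ n : ℝ) + 3 * (2 * w + 3 * c + 20) + 3 ≤
      (|C| + (12 + (9 * c + 63))) * l ^ (a + 1) := by
    have k₁ : (κ n : ℝ) ≤ |C| * l ^ (a + 1) := by
      refine hκ.trans (mul_le_mul (le_abs_self C) ?_ (by positivity) (abs_nonneg C))
      exact pow_le_pow_right₀ hl1 (by omega)
    have k₂ : l ≤ l ^ (a + 1) := le_self_pow₀ hl1 (by omega)
    have k₃ : (9 * (c : ℝ) + 63) * 1 ≤ (9 * c + 63) * l ^ (a + 1) :=
      mul_le_mul_of_nonneg_left (one_le_pow₀ hl1) (by positivity)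
    nlinarith
  have hC₁0 : 0 ≤ C₁ := by rw [hC₁]; positivity
  refine (mul_le_mul g₈ g₉ (by positivity) (by positivity)).trans_eq ?_
  rw [pow_add l 4 (a + 1)]
  ring

/-- The registers need `2 w` bits for `L`, and the remaining ones for addresses and repetitions. -/
theorem wide_bits (c w : ℕ) : Wide (2 * w + 3 * c + 20) w ∧
    (c + 2) * (3 * w) < 2 ^ (2 * w + 3 * c + 20) := by
  have hw : w < 2 ^ w := Nat.lt_two_pow_self
  have hc : c < 2 ^ c := Nat.lt_two_pow_self
  have hW : 1 ≤ 2 ^ w := Nat.one_le_two_pow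
  have hC : 1 ≤ 2 ^ c := Nat.one_le_two_pow
  have e : 2 ^ (2 * w + 3 * c + 20) = (2 ^ w * 2 ^ c) * (2 ^ w * 2 ^ c * 2 ^ c * 2 ^ 20) := by ring
  rw [Wide, e]
  have h₁ : 1 ≤ 2 ^ w * 2 ^ c := Nat.mul_pos hW hC
  have h₂ : 2 ^ 20 ≤ 2 ^ w * 2 ^ c * 2 ^ c * 2 ^ 20 :=
    Nat.le_mul_of_pos_left _ (Nat.mul_pos h₁ hC)
  have h₃ : 2 ^ w * 2 ^ c * 2 ^ 20 ≤ 2 ^ w * 2 ^ c * (2 ^ w * 2 ^ c * 2 ^ c * 2 ^ 20) :=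
    Nat.mul_le_mul_left _ h₂
  have h₄ : 2 ^ w ≤ 2 ^ w * 2 ^ c := Nat.le_mul_of_pos_right _ hC
  have h₅ : (c + 1) * w ≤ 2 ^ c * 2 ^ w := Nat.mul_le_mul hc hw.le
  have h₆ : (c + 2) * (3 * w) ≤ 6 * ((c + 1) * w) := by nlinarith [Nat.zero_le (c * w)]
  rw [Nat.mul_comm (2 ^ c)] at h₅
  refine ⟨⟨by omega, ?_⟩, ?_⟩
  · omega
  · omega

theorem graphCollision_correct (c : ℕ) (κ : ℕ → ℕ) {L : ℕ} (hn : 1 ≤ n) (hL : L ≤ n ^ 2)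
    (x : Input n) (hE : n ^ 2 ≤ x.E.card + L) :
    HaltsWithin (graphCollision c) x L (κ n) (timeBound c κ n L) ∧
      1 - 1 / ((n : ℝ) + 1) ^ c ≤
        successProb (graphCollision c) x L (κ n) (timeBound c κ n L) := by
  obtain ⟨hW, hR⟩ := wide_bits c (Nat.size n)
  have hB : Bounded (2 * Nat.size n + 3 * c + 20) (start (graphCollision c) x L).store := by
    have hnB : n < 2 ^ Nat.size n := Nat.lt_size_self n
    have h₁ : 2 ^ Nat.size n ≤ 2 ^ (2 * Nat.size n + 3 * c + 20) :=
      Nat.pow_le_pow_right (by omega) (by omega)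
    have h₂ : L < 2 ^ (2 * Nat.size n + 3 * c + 20) := by
      refine (hL.trans_lt (Nat.pow_lt_pow_left hnB (by omega))).trans_le ?_
      rw [← pow_mul]
      exact Nat.pow_le_pow_right (by omega) (by omega)
    have h₃ := x.k.2
    intro r
    simp only [start]
    split_ifs <;> omega
  have h := graphCollision_expect (S := ⟨x, κ n, 2 * Nat.size n + 3 * c + 20⟩) (c := c)
    (Q := Nat.sqrt (4 * L + 2 * n)) rfl hn hB rfl rfl rfl
    (fun r hr => by
      simp only [start]
      rw [if_neg (by omega), if_neg (by omega), if_neg (by omega)])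
    hW hR hE hL fun m hm => by
      rw [Nat.le_sqrt, ← pow_add]
      exact (Nat.pow_le_pow_right (by omega) (by omega)).trans hm
  obtain ⟨h₁, h₂⟩ := CleanExpect.success h
  have := error_le hn c
  exact ⟨h₁, le_trans (by linarith) h₂⟩

end GraphCollision

theorem proposition3p1 (c : ℕ) :
    ∃ P : GraphCollision.Prog, ∀ κ : ℕ → ℕ, GraphCollision.IsPolylog κ →
      ∃ T : ℕ → ℕ → ℕ,
        GraphCollision.IsSoftO T (fun n L => √(L : ℝ) + √(n : ℝ)) ∧
        ∀ n L : ℕ, 1 ≤ n → L ≤ n ^ 2 →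
          ∀ x : GraphCollision.Input n, n ^ 2 ≤ x.E.card + L →
            GraphCollision.HaltsWithin P x L (κ n) (T n L) ∧
            1 - 1 / ((n : ℝ) + 1) ^ c ≤
              GraphCollision.successProb P x L (κ n) (T n L) :=
  ⟨GraphCollision.graphCollision c, fun κ hκ =>
    ⟨GraphCollision.timeBound c κ, GraphCollision.timeBound_isSoftO c hκ, fun _ _ hn hL x hE =>
      GraphCollision.graphCollision_correct c κ hn hL x hE⟩⟩
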